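/- Let $d\ge 1$, let $\ell_1,\dots,\ell_d>0$ be the edge lengths of a compact quantum graph, let $U$ be a unitary $2d\times 2d$ matrix with $-1\notin\sigma(U)$, and let $q_i\in W^{1,1}((0,\ell_i))$ be real (identified with its continuous representative on $[0,\ell_i]$). Let $\mathcal H(q)$ be the operator acting as $-\frac{d^2}{dx^2}+q_i$ on the $i$-th edge in $\bigoplus_{i=1}^d L^2((0,\ell_i))$, whose domain consists of the functions with components $f_i\in W^{2,2}((0,\ell_i))$ that satisfy $(U-I)\Psi+\mathrm i(U+I)\Psi'=0$, where $\Psi=(f_1(0),f_1(\ell_1),\dots,f_d(0),f_d(\ell_d))^{\mathrm T}$ and $\Psi'=(f_1'(0),-f_1'(\ell_1),\dots,f_d'(0),-f_d'(\ell_d))^{\mathrm T}$. (Every graph with $d$ edges and vertex conditions $(U_v-I)\Psi_v+\mathrm i(U_v+I)\Psi_v'=0$, $-1\notin\sigma(U_v)$, is of this form.) The eigenvalues of $\mathcal H(q)$ are real and, repeated according to multiplicity, form an increasing sequence $\lambda_1(q)\le\lambda_2(q)\le\cdots$. Let $\mu_1\le\mu_2\le\cdots$ be the increasing list of the numbers $n\pi/\ell_i$,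 $1\le i\le d$, $n\ge 0$, each listed once for every such pair $(i,n)$; thus the first $d$ entries are $0$ and the others are the positive zeros of $\prod_{i}\sin(k\ell_i)$. Let $\lambda_{in}(q)=\lambda_m(q)$, where $m$ is the position of the zero $n\pi/\ell_i$ of $\sin(k\ell_i)$ in this list (coinciding zeros may be assigned to their positions in any order, possibly a different one for $q$ and for the zero potential). Then $$\sum_{i=1}^d\sum_{n=0}^\infty\Big[\lambda_{in}(q)-\lambda_{in}(0)-\frac1{\ell_i}\int_0^{\ell_i}q_i(x)\,dx\Big]=\sum_{i=1}^d\Big\{\frac14\big[q_i(\ell_i)+q_i(0)\big]-\frac1{2\ell_i}\int_0^{\ell_i}q_i(x)\,dx\Big\},$$ where the sum on the left is taken jointly over the edges: for every $\varepsilon>0$, the finite sums $\sum_{i=1}^d\sum_{n=0}^{\lfloor N\ell_i/\pi\rfloor}[\cdots]$ converge to the right-hand side as $N\to\infty$ through the set of those $N$ with $|N-n\pi/\ell_i|\ge\varepsilon/\ell_i$ for all $i$ and all $n\ge 0$; for some $\varepsilon>0$ (and then for all smaller ones) this set is unbounded. In particular, if the inner series $\sum_{n=0}^\infty[\cdots]$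 converges for each $i$, the formula holds as an iterated sum. -/

import Mathlib

open MeasureTheory Filter Topology Matrix

noncomputable section

namespace QuantumGraph

/-- On `[0, L]` the function `f` is absolutely continuous with integrable derivative `g`:
`g ∈ L¹(0, L)` and `f x = f 0 + ∫₀ˣ g` for `0 ≤ x ≤ L`. Equivalently, `f` is the continuous
representative of an element of `W^{1,1}((0, L))` with weak derivative `g`. -/
def HasWeakDeriv {E : Type*} [NormedAddCommGroup E] [NormedSpace ℝ E]
    (L : ℝ) (f g : ℝ → E) : Prop :=
  IntervalIntegrable g volume 0 L ∧ ∀ x ∈ Set.Icc 0 L, f x = f 0 + ∫ t in (0 : ℝ)..x, g t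

/-- `f` is, on `[0, L]`, the continuous representative of a real element of `W^{1,1}((0, L))`. -/
def IsW11 (L : ℝ) (f : ℝ → ℝ) : Prop :=
  ∃ g : ℝ → ℝ, HasWeakDeriv L f g

/-- `f` represents an element of `W^{2,2}((0, L))`, with first derivative `f'` (its continuous
representative) and second derivative `f'' ∈ L²(0, L)`. -/
structure IsW22 (L : ℝ) (f f' f'' : ℝ → ℂ) : Prop where
  deriv_one : HasWeakDeriv L f f'
  deriv_two : HasWeakDeriv L f' f''
  memLp : MemLp f'' 2 (volume.restrict (Set.Ioo 0 L))

theorem HasWeakDeriv.intervalIntegrable {E : Type*} [NormedAddCommGroup E] [NormedSpace ℝ E]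
    {L : ℝ} {f g : ℝ → E} (h : HasWeakDeriv L f g) {x : ℝ} (hx : x ∈ Set.Icc 0 L) :
    IntervalIntegrable g volume 0 x := by
  refine h.1.mono_set ?_
  rw [Set.uIcc_of_le hx.1, Set.uIcc_of_le (hx.1.trans hx.2)]
  exact Set.Icc_subset_Icc le_rfl hx.2

theorem HasWeakDeriv.zero (L : ℝ) : HasWeakDeriv L (0 : ℝ → ℂ) 0 := by
  refine ⟨?_, fun x _ => ?_⟩
  · exact intervalIntegrable_const (c := (0 : ℂ))
  · simp

theorem HasWeakDeriv.add {L : ℝ} {f g f₁ g₁ : ℝ → ℂ}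
    (h : HasWeakDeriv L f g) (h₁ : HasWeakDeriv L f₁ g₁) :
    HasWeakDeriv L (f + f₁) (g + g₁) := by
  refine ⟨h.1.add h₁.1, fun x hx => ?_⟩
  simp only [Pi.add_apply]
  rw [intervalIntegral.integral_add (h.intervalIntegrable hx) (h₁.intervalIntegrable hx),
    h.2 x hx, h₁.2 x hx]
  ring

theorem HasWeakDeriv.smul {L : ℝ} {f g : ℝ → ℂ} (c : ℂ)
    (h : HasWeakDeriv L f g) : HasWeakDeriv L (c • f) (c • g) := by
  refine ⟨h.1.smul c, fun x hx => ?_⟩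
  simp only [Pi.smul_apply, intervalIntegral.integral_smul]
  rw [h.2 x hx, smul_add]

theorem IsW22.zero (L : ℝ) : IsW22 L 0 0 0 :=
  ⟨HasWeakDeriv.zero L, HasWeakDeriv.zero L, MemLp.zero⟩

theorem IsW22.add {L : ℝ} {f f' f'' g g' g'' : ℝ → ℂ}
    (hf : IsW22 L f f' f'') (hg : IsW22 L g g' g'') :
    IsW22 L (f + g) (f' + g') (f'' + g'') :=
  ⟨hf.deriv_one.add hg.deriv_one, hf.deriv_two.add hg.deriv_two, hf.memLp.add hg.memLp⟩

theorem IsW22.smul {L : ℝ} {f f' f'' : ℝ → ℂ} (c : ℂ)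
    (hf : IsW22 L f f' f'') : IsW22 L (c • f) (c • f') (c • f'') :=
  ⟨hf.deriv_one.smul c, hf.deriv_two.smul c, hf.memLp.const_smul c⟩

/-- The edge ends: `(i, 0)` is the beginning and `(i, 1)` the end of the `i`-th edge. -/
abbrev Ends (d : ℕ) : Type := Fin d × Fin 2

/-- The vector `Ψ` of the boundary values at all edge ends. -/
def boundaryValues {d : ℕ} (ℓ : Fin d → ℝ) (f : Fin d → ℝ → ℂ) : Ends d → ℂ :=
  fun e => if e.2 = 0 then f e.1 0 else f e.1 (ℓ e.1)

/-- The vector `Ψ'` of the derivatives at all edge ends, directed from the vertex into the edge;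
`f'` is the family of edgewise derivatives. -/
def boundaryDerivs {d : ℕ} (ℓ : Fin d → ℝ) (f' : Fin d → ℝ → ℂ) : Ends d → ℂ :=
  fun e => if e.2 = 0 then f' e.1 0 else -f' e.1 (ℓ e.1)

/-- The coupling condition `(U - I) Ψ + i (U + I) Ψ' = 0`. -/
def Coupling {d : ℕ} (ℓ : Fin d → ℝ) (U : Matrix (Ends d) (Ends d) ℂ)
    (f f' : Fin d → ℝ → ℂ) : Prop :=
  (U - 1) *ᵥ boundaryValues ℓ f + Complex.I • ((U + 1) *ᵥ boundaryDerivs ℓ f') = 0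

/-- The Hilbert space `L²(Γ) = ⨁ᵢ L²((0, ℓᵢ))`. -/
abbrev GraphL2 {d : ℕ} (ℓ : Fin d → ℝ) : Type :=
  PiLp 2 (fun i : Fin d => Lp ℂ 2 (volume.restrict (Set.Ioo 0 (ℓ i))))

/-- `(ψ, χ)` belongs to the graph of the Hamiltonian: `ψ` is edgewise in `W^{2,2}` and satisfies
the coupling condition, and `χ = -ψ'' + q ψ` on each edge. -/
def IsHamiltonianPair {d : ℕ} (ℓ : Fin d → ℝ) (U : Matrix (Ends d) (Ends d) ℂ)
    (q : Fin d → ℝ → ℝ) (ψ χ : GraphL2 ℓ) : Prop :=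
  ∃ f f' f'' : Fin d → ℝ → ℂ,
    (∀ i, IsW22 (ℓ i) (f i) (f' i) (f'' i)) ∧
    Coupling ℓ U f f' ∧
    (∀ i, ⇑(ψ i) =ᵐ[volume.restrict (Set.Ioo 0 (ℓ i))] f i) ∧
    (∀ i, ⇑(χ i) =ᵐ[volume.restrict (Set.Ioo 0 (ℓ i))]
      fun x => -f'' i x + (q i x : ℂ) * f i x)

theorem boundaryValues_add {d : ℕ} (ℓ : Fin d → ℝ) (f g : Fin d → ℝ → ℂ) :
    boundaryValues ℓ (f + g) = boundaryValues ℓ f + boundaryValues ℓ g := by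
  funext e
  by_cases h : e.2 = 0 <;> simp [boundaryValues, h]

theorem boundaryDerivs_add {d : ℕ} (ℓ : Fin d → ℝ) (f g : Fin d → ℝ → ℂ) :
    boundaryDerivs ℓ (f + g) = boundaryDerivs ℓ f + boundaryDerivs ℓ g := by
  funext e
  by_cases h : e.2 = 0 <;> simp [boundaryDerivs, h, add_comm]

theorem boundaryValues_smul {d : ℕ} (ℓ : Fin d → ℝ) (c : ℂ) (f : Fin d → ℝ → ℂ) :
    boundaryValues ℓ (c • f) = c • boundaryValues ℓ f := by
  funext e
  by_cases h : e.2 = 0 <;> simp [boundaryValues, h]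

theorem boundaryDerivs_smul {d : ℕ} (ℓ : Fin d → ℝ) (c : ℂ) (f : Fin d → ℝ → ℂ) :
    boundaryDerivs ℓ (c • f) = c • boundaryDerivs ℓ f := by
  funext e
  by_cases h : e.2 = 0 <;> simp [boundaryDerivs, h]

/-- The Hamiltonian `-d²/dx² + qᵢ` on `L²(Γ)` with coupling matrix `U`, as an unbounded operator
given by its graph. -/
def hamiltonian {d : ℕ} (ℓ : Fin d → ℝ) (U : Matrix (Ends d) (Ends d) ℂ)
    (q : Fin d → ℝ → ℝ) : Submodule ℂ (GraphL2 ℓ × GraphL2 ℓ) where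
  carrier := {p | IsHamiltonianPair ℓ U q p.1 p.2}
  zero_mem' := by
    refine ⟨0, 0, 0, fun i => IsW22.zero _, ?_, fun i => ?_, fun i => ?_⟩
    · have h0 : boundaryValues ℓ (0 : Fin d → ℝ → ℂ) = 0 := by
        simpa using boundaryValues_smul ℓ 0 0
      have h1 : boundaryDerivs ℓ (0 : Fin d → ℝ → ℂ) = 0 := by
        simpa using boundaryDerivs_smul ℓ 0 0
      simp [Coupling, h0, h1]
    · exact Lp.coeFn_zero _ _ _
    · filter_upwards [Lp.coeFn_zero ℂ 2 (volume.restrict (Set.Ioo 0 (ℓ i)))] with x hx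
      simpa using hx
  add_mem' := by
    rintro ⟨ψ, χ⟩ ⟨φ, ω⟩ ⟨f, f', f'', hf, hc, h1, h2⟩ ⟨g, g', g'', hg, hc', h3, h4⟩
    refine ⟨f + g, f' + g', f'' + g'', fun i => (hf i).add (hg i), ?_, fun i => ?_, fun i => ?_⟩
    · unfold Coupling at *
      rw [boundaryValues_add, boundaryDerivs_add, mulVec_add, mulVec_add, smul_add,
        add_add_add_comm, hc, hc', add_zero]
    · filter_upwards [Lp.coeFn_add (ψ i) (φ i), h1 i, h3 i] with x hx hx1 hx3
      simp only [Pi.add_apply] at hx ⊢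
      rw [← hx1, ← hx3, ← hx]
      rfl
    · filter_upwards [Lp.coeFn_add (χ i) (ω i), h2 i, h4 i] with x hx hx2 hx4
      simp only [Pi.add_apply] at hx ⊢
      refine Eq.trans hx ?_
      rw [hx2, hx4]
      ring
  smul_mem' := by
    rintro c ⟨ψ, χ⟩ ⟨f, f', f'', hf, hc, h1, h2⟩
    refine ⟨c • f, c • f', c • f'', fun i => (hf i).smul c, ?_, fun i => ?_, fun i => ?_⟩
    · unfold Coupling at *
      rw [boundaryValues_smul, boundaryDerivs_smul, mulVec_smul, mulVec_smul, smul_comm,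
        ← smul_add, hc, smul_zero]
    · filter_upwards [Lp.coeFn_smul c (ψ i), h1 i] with x hx hx1
      simp only [Pi.smul_apply] at hx ⊢
      rw [← hx1, ← hx]
      rfl
    · filter_upwards [Lp.coeFn_smul c (χ i), h2 i] with x hx hx2
      simp only [Pi.smul_apply, smul_eq_mul] at hx ⊢
      refine Eq.trans hx ?_
      rw [hx2]
      ring

/-- The space of all `ψ` in the domain of the Hamiltonian that it maps to `z • ψ`. -/
def eigenspace {d : ℕ} (ℓ : Fin d → ℝ) (U : Matrix (Ends d) (Ends d) ℂ)
    (q : Fin d → ℝ → ℝ) (z : ℂ) : Submodule ℂ (GraphL2 ℓ) :=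
  (hamiltonian ℓ U q).comap (LinearMap.id.prod (z • LinearMap.id))

/-- `lam 0 ≤ lam 1 ≤ ⋯` lists all eigenvalues of the Hamiltonian in increasing order, each as often
as its multiplicity. As `z` runs over `ℂ`, this includes that all eigenvalues are real. -/
def IsEigenvalueSequence {d : ℕ} (ℓ : Fin d → ℝ) (U : Matrix (Ends d) (Ends d) ℂ)
    (q : Fin d → ℝ → ℝ) (lam : ℕ → ℝ) : Prop :=
  Monotone lam ∧
    ∀ z : ℂ, {n : ℕ | (lam n : ℂ) = z}.encard =
      Cardinal.toENat (Module.rank ℂ (eigenspace ℓ U q z))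

/-- The `n`-th non-negative zero of `k ↦ sin (k ℓᵢ)`. -/
def sineZero {d : ℕ} (ℓ : Fin d → ℝ) (p : Fin d × ℕ) : ℝ :=
  p.2 * Real.pi / ℓ p.1

/-- `σ` numbers the zeros `n π / ℓᵢ` (`n ≥ 0`, `1 ≤ i ≤ d`, a common zero of several sines counted
once for each of them) in increasing order: `σ (i, n)` is the position of the `n`-th zero of
`sin (k ℓᵢ)` in the ordered list `μ`. Zeros that coincide may be numbered in any order. -/
def IsZeroNumbering {d : ℕ} (ℓ : Fin d → ℝ) (σ : Fin d × ℕ ≃ ℕ) : Prop :=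
  Monotone fun m : ℕ => sineZero ℓ (σ.symm m)

/-- The cut-offs `N` at distance at least `ε / ℓᵢ` from all the zeros `n π / ℓᵢ`. -/
def admissibleCutoffs {d : ℕ} (ℓ : Fin d → ℝ) (ε : ℝ) : Set ℝ :=
  {N | ∀ (i : Fin d) (n : ℕ), ε / ℓ i ≤ |N - sineZero ℓ (i, n)|}

/-- The summand `λᵢₙ(q) - λᵢₙ(0) - (1/ℓᵢ) ∫ qᵢ`, where `λᵢₙ(q) = lam (σ (i, n))` and
`λᵢₙ(0) = lam₀ (σ₀ (i, n))`. -/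
def traceTerm {d : ℕ} (ℓ : Fin d → ℝ) (q : Fin d → ℝ → ℝ) (lam lam₀ : ℕ → ℝ)
    (σ σ₀ : Fin d × ℕ ≃ ℕ) (i : Fin d) (n : ℕ) : ℝ :=
  lam (σ (i, n)) - lam₀ (σ₀ (i, n)) - 1 / ℓ i * ∫ x in (0 : ℝ)..ℓ i, q i x

/-- The right-hand side of the trace formula. -/
def traceValue {d : ℕ} (ℓ : Fin d → ℝ) (q : Fin d → ℝ → ℝ) : ℝ :=
  ∑ i, (1 / 4 * (q i (ℓ i) + q i 0) - 1 / (2 * ℓ i) * ∫ x in (0 : ℝ)..ℓ i, q i x)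

end QuantumGraph

end

noncomputable section

namespace QuantumGraph

/-! ### The argument principle on discs -/

/-! Since `-1 ∉ σ(U)`, the coupling condition reads `Ψ' = A Ψ` with `A` Hermitian, the Cayley
transform of `U`. Expressing boundary values and derivatives through the initial data of edgewise
solutions turns the eigenvalue problem into `det B(z) = 0` for an entire matrix function
(`secMatrix`, `secFun`). Self-adjointness, in the form of Green's identity, makes the order of each
zero equal to the multiplicity of the eigenvalue (`analyticOrderAt_secFun`,
`toENat_rank_eigenspace`).

The argument principle with weight `z` on `|z| = N²`, after one integration by parts, gives `2πi (∑
λ(q) - ∑ λ(0)) = -∮ log (F_q / F_0) dz` (`sum_zeros_sub_sum_zeros`). With weight `1` it shows that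
the disc contains exactly as many eigenvalues as there are sine zeros below `N`, so both finite sums
run over the same initial segment of indices.

The integrand is computed from `F = det (1 - A M) ∏ yᵢ'(ℓᵢ)`, where `yᵢ` has Neumann data at `0` and
`M` is the Neumann-to-Dirichlet matrix of the decoupled edges (`secFun_eq`). Put `z = k²` with `Im k
≥ 0` and `Qᵢ = ∫ qᵢ`. The coupling contributes nothing in the limit, because `k² (M_q - M_0) → 0` as
`Im k → ∞` (`tendsto_edgeM_sub`). An edge contributes `-(Qᵢ/2) k cot (k ℓᵢ)` plus a bounded term
tending to `-(qᵢ(ℓᵢ) + qᵢ(0))/4` (`tendsto_edge_log`); one integration by parts against `qᵢ ∈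
W^{1,1}` produces these endpoint values.

The cotangent is removed exactly, not asymptotically. For the free edge function `D(k²) = -k sin (k
ℓ)` one has `z D'/D = 1/2 + (ℓ/2) k cot (k ℓ)`, so its contour integral counts the zeros `(nπ/ℓ)²`,
`n ≥ 0`, less `1/2`. The count cancels the subtracted mean values of `q`, and the `1/2` leaves
`-Qᵢ/(2ℓᵢ)`. The remaining angular integral converges by dominated convergence: admissible cut-offs
keep the sines away from zero on the whole circle, and `Im k → ∞` along every ray except the
positive axis (`tendsto_circleLog`). -/

theorem exists_factor_of_order {f : ℂ → ℂ} (hf : Differentiable ℂ f) {a : ℂ} {m : ℕ}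
    (hm : analyticOrderAt f a = m) :
    ∃ g : ℂ → ℂ, Differentiable ℂ g ∧ g a ≠ 0 ∧ ∀ z, f z = (z - a) ^ m * g z := by
  obtain ⟨g₀, hg₀, hne, heq⟩ := (hf.analyticAt a).analyticOrderAt_eq_natCast.1 hm
  have hfa : f a = (a - a) ^ m * g₀ a := by simpa using heq.self_of_nhds
  refine ⟨Function.update (fun z => f z / (z - a) ^ m) a (g₀ a), ?_, by simpa using hne, ?_⟩
  · intro z
    by_cases hz : z = a
    · subst hz
      refine hg₀.differentiableAt.congr_of_eventuallyEq ?_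
      filter_upwards [heq] with w hw
      by_cases hwz : w = z
      · simp [hwz]
      · have : (w - z) ^ m ≠ 0 := pow_ne_zero _ (sub_ne_zero.2 hwz)
        simp [Function.update_of_ne hwz, hw, this]
    · have h1 : (z - a) ^ m ≠ 0 := pow_ne_zero _ (sub_ne_zero.2 hz)
      have h2 : DifferentiableAt ℂ (fun z => f z / (z - a) ^ m) z :=
        (hf z).div (by fun_prop) h1
      refine h2.congr_of_eventuallyEq ?_
      filter_upwards [isOpen_ne.mem_nhds hz] with w hw
      simp [Function.update_of_ne hw]
  · intro z
    by_cases hz : z = a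
    · subst hz; simpa using hfa
    · have h1 : (z - a) ^ m ≠ 0 := pow_ne_zero _ (sub_ne_zero.2 hz)
      simp only [Function.update_of_ne hz]
      field_simp

theorem exists_factorization {f : ℂ → ℂ} (hf : Differentiable ℂ f) {m : ℂ → ℕ}
    (hm : ∀ a, analyticOrderAt f a = m a) (Z : Finset ℂ) :
    ∃ g : ℂ → ℂ, Differentiable ℂ g ∧ (∀ a ∈ Z, g a ≠ 0) ∧
      ∀ z, f z = (∏ a ∈ Z, (z - a) ^ m a) * g z := by
  induction Z using Finset.induction_on with
  | empty => exact ⟨f, hf, by simp, by simp⟩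
  | insert a Z ha ih =>
    obtain ⟨g, hg, hne, heq⟩ := ih
    have hP : Differentiable ℂ (fun z : ℂ => ∏ b ∈ Z, (z - b) ^ m b) := by fun_prop
    have hPa : (∏ b ∈ Z, (a - b) ^ m b) ≠ 0 :=
      Finset.prod_ne_zero_iff.2 fun b hb =>
        pow_ne_zero _ (sub_ne_zero.2 fun h => ha (h ▸ hb))
    -- The factors already extracted do not vanish at the new point, so the cofactor retains the
    -- full order there.
    have hord : analyticOrderAt g a = m a := by
      have h1 : f = (fun z : ℂ => ∏ b ∈ Z, (z - b) ^ m b) * g := funext heq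
      have h2 := hm a
      rw [h1, analyticOrderAt_mul (hP.analyticAt a) (hg.analyticAt a),
        (hP.analyticAt a).analyticOrderAt_eq_zero.2 hPa, zero_add] at h2
      exact h2
    obtain ⟨g', hg', hne', heq'⟩ := exists_factor_of_order hg hord
    refine ⟨g', hg', ?_, ?_⟩
    · intro b hb
      rcases Finset.mem_insert.1 hb with rfl | hb
      · exact hne'
      · have := hne b hb
        rw [heq'] at this
        exact right_ne_zero_of_mul this
    · intro z
      rw [Finset.prod_insert ha, heq, heq']
      ring

/-- The weighted argument principle for an entire function on a disc centred at `0`. -/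
theorem circleIntegral_mul_logDeriv {f φ : ℂ → ℂ} (hf : Differentiable ℂ f) {m : ℂ → ℕ}
    (hm : ∀ a, analyticOrderAt f a = m a) {R : ℝ} (hR : 0 < R)
    (h0 : ∀ z ∈ Metric.sphere (0 : ℂ) R, f z ≠ 0) (Z : Finset ℂ)
    (hZ : ∀ z, z ∈ Z ↔ z ∈ Metric.ball 0 R ∧ f z = 0) (hφ : Differentiable ℂ φ) :
    (∮ z in C(0, R), φ z * logDeriv f z) = 2 * Real.pi * Complex.I * ∑ a ∈ Z, m a * φ a := by
  obtain ⟨g, hg, hne, heq⟩ := exists_factorization hf hm Z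
  have hgK : ∀ z ∈ Metric.closedBall (0 : ℂ) R, g z ≠ 0 := by
    intro z hz hgz
    by_cases hzZ : z ∈ Z
    · exact hne z hzZ hgz
    · have hfz : f z = 0 := by rw [heq, hgz, mul_zero]
      rcases (Metric.mem_closedBall.1 hz).lt_or_eq with h | h
      · exact hzZ ((hZ z).2 ⟨h, hfz⟩)
      · exact h0 z h hfz
  have hZs : ∀ z ∈ Metric.sphere (0 : ℂ) R, ∀ a ∈ Z, z - a ≠ 0 := by
    intro z hz a ha h
    rw [sub_eq_zero] at h
    subst h
    exact h0 z hz ((hZ z).1 ha).2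
  -- The zeros become simple poles, handled by Cauchy's integral formula; the cofactor is zero-free
  -- on the closed disc, so Cauchy's theorem removes its part.
  have hlog : ∀ z ∈ Metric.sphere (0 : ℂ) R,
      φ z * logDeriv f z = (∑ a ∈ Z, m a * ((z - a)⁻¹ • φ z)) + φ z * logDeriv g z := by
    intro z hz
    have h1 : f = fun z => (∏ a ∈ Z, (z - a) ^ m a) * g z := funext heq
    have h2 : logDeriv f z = (∑ a ∈ Z, m a * (z - a)⁻¹) + logDeriv g z := by
      conv_lhs => rw [h1]
      rw [logDeriv_mul z (Finset.prod_ne_zero_iff.2 fun a ha => pow_ne_zero _ (hZs z hz a ha))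
        (hgK z (Metric.sphere_subset_closedBall hz)) (by fun_prop) (hg z)]
      congr 1
      rw [logDeriv_prod (f := fun a z => (z - a) ^ m a) (fun a ha => pow_ne_zero _ (hZs z hz a ha))
        (fun a _ => by fun_prop)]
      refine Finset.sum_congr rfl fun a ha => ?_
      rw [logDeriv_fun_pow (by fun_prop)]
      simp [logDeriv_apply]
    rw [h2, mul_add, Finset.mul_sum]
    congr 1
    refine Finset.sum_congr rfl fun a _ => ?_
    rw [smul_eq_mul]; ring
  have hci : ∀ a ∈ Z, CircleIntegrable (fun z => (m a : ℂ) * ((z - a)⁻¹ • φ z)) 0 R := by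
    intro a ha
    refine ContinuousOn.circleIntegrable hR.le ?_
    refine continuousOn_const.mul (ContinuousOn.smul (ContinuousOn.inv₀ (by fun_prop)
      fun z hz => hZs z hz a ha) hφ.continuous.continuousOn)
  have hgd : Differentiable ℂ (deriv g) := fun z =>
    (hg.analyticAt z).deriv.differentiableAt
  have hdg : ∀ z ∈ Metric.closedBall (0 : ℂ) R,
      DifferentiableAt ℂ (fun z => φ z * logDeriv g z) z := by
    intro z hz
    exact (hφ z).mul ((hgd z).div (hg z) (hgK z hz))
  rw [circleIntegral.integral_congr hR.le hlog, circleIntegral.integral_add,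
    circleIntegral.integral_fun_sum hci]
  · rw [Complex.circleIntegral_eq_zero_of_differentiable_on_off_countable hR.le
      Set.countable_empty (fun z hz => (hdg z hz).continuousAt.continuousWithinAt)
      (fun z hz => hdg z (Metric.ball_subset_closedBall hz.1)), add_zero, Finset.mul_sum]
    refine Finset.sum_congr rfl fun a ha => ?_
    rw [circleIntegral.integral_const_mul]
    have := DifferentiableOn.circleIntegral_sub_inv_smul (f := φ) (c := 0) (R := R) (w := a)
      hφ.differentiableOn ((hZ a).1 ha).1
    rw [this, smul_eq_mul]
    ring
  · exact CircleIntegrable.fun_sum Z hci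
  · exact ContinuousOn.circleIntegrable hR.le fun z hz =>
      (hdg z (Metric.sphere_subset_closedBall hz)).continuousAt.continuousWithinAt

/-- Integration by parts on a closed curve: as `ρ` avoids the branch cut, `φ log ρ` is single-valued
near the circle and the integral of its derivative vanishes. -/
theorem circleIntegral_mul_logDeriv_eq_neg {ρ φ : ℂ → ℂ} {R : ℝ} (hR : 0 ≤ R)
    (hρ : ∀ z ∈ Metric.sphere (0 : ℂ) R, AnalyticAt ℂ ρ z)
    (hs : ∀ z ∈ Metric.sphere (0 : ℂ) R, ρ z ∈ Complex.slitPlane) (hφ : Differentiable ℂ φ) :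
    (∮ z in C(0, R), φ z * logDeriv ρ z) = -∮ z in C(0, R), deriv φ z * Complex.log (ρ z) := by
  have hφd : Differentiable ℂ (deriv φ) := fun z => (hφ.analyticAt z).deriv.differentiableAt
  have h1 : CircleIntegrable (fun z => φ z * logDeriv ρ z) 0 R := by
    refine ContinuousOn.circleIntegrable hR fun z hz => ContinuousAt.continuousWithinAt ?_
    exact (hφ z).continuousAt.mul (((hρ z hz).deriv.continuousAt).div (hρ z hz).continuousAt
      (Complex.slitPlane_ne_zero (hs z hz)))
  have h2 : CircleIntegrable (fun z => deriv φ z * Complex.log (ρ z)) 0 R := by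
    refine ContinuousOn.circleIntegrable hR fun z hz => ContinuousAt.continuousWithinAt ?_
    exact (hφd z).continuousAt.mul ((hρ z hz).continuousAt.clog (hs z hz))
  rw [eq_neg_iff_add_eq_zero, ← circleIntegral.integral_add h1 h2]
  refine circleIntegral.integral_eq_zero_of_hasDerivWithinAt
    (f := fun z => φ z * Complex.log (ρ z)) hR fun z hz => ?_
  have h3 := (hφ z).hasDerivAt.mul ((hρ z hz).differentiableAt.hasDerivAt.clog (hs z hz))
  refine (h3.congr_deriv ?_).hasDerivWithinAt
  rw [logDeriv_apply]
  ring

/-- Weighted Rouché formula: comparison of the zeros of two entire functions in a disc whose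
quotient avoids the negative axis on the boundary circle. -/
theorem sum_zeros_sub_sum_zeros {f₁ f₂ φ : ℂ → ℂ} (hf₁ : Differentiable ℂ f₁)
    (hf₂ : Differentiable ℂ f₂) {m₁ m₂ : ℂ → ℕ} (hm₁ : ∀ a, analyticOrderAt f₁ a = m₁ a)
    (hm₂ : ∀ a, analyticOrderAt f₂ a = m₂ a) {R : ℝ} (hR : 0 < R)
    (hs : ∀ z ∈ Metric.sphere (0 : ℂ) R, f₁ z / f₂ z ∈ Complex.slitPlane) (Z₁ Z₂ : Finset ℂ)
    (hZ₁ : ∀ z, z ∈ Z₁ ↔ z ∈ Metric.ball 0 R ∧ f₁ z = 0)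
    (hZ₂ : ∀ z, z ∈ Z₂ ↔ z ∈ Metric.ball 0 R ∧ f₂ z = 0) (hφ : Differentiable ℂ φ) :
    2 * Real.pi * Complex.I * (∑ a ∈ Z₁, m₁ a * φ a - ∑ a ∈ Z₂, m₂ a * φ a) =
      -∮ z in C(0, R), deriv φ z * Complex.log (f₁ z / f₂ z) := by
  have h01 : ∀ z ∈ Metric.sphere (0 : ℂ) R, f₁ z ≠ 0 := fun z hz h =>
    Complex.slitPlane_ne_zero (hs z hz) (by simp [h])
  have h02 : ∀ z ∈ Metric.sphere (0 : ℂ) R, f₂ z ≠ 0 := fun z hz h =>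
    Complex.slitPlane_ne_zero (hs z hz) (by simp [h])
  rw [mul_sub, ← circleIntegral_mul_logDeriv hf₁ hm₁ hR h01 Z₁ hZ₁ hφ,
    ← circleIntegral_mul_logDeriv hf₂ hm₂ hR h02 Z₂ hZ₂ hφ,
    ← circleIntegral_mul_logDeriv_eq_neg (ρ := fun z => f₁ z / f₂ z) hR.le
      (fun z hz => (hf₁.analyticAt z).div (hf₂.analyticAt z) (h02 z hz)) hs hφ,
    ← circleIntegral.integral_sub]
  · refine circleIntegral.integral_congr hR.le fun z hz => ?_
    have : logDeriv (fun z => f₁ z / f₂ z) z = _ :=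
      logDeriv_div z (h01 z hz) (h02 z hz) (hf₁ z) (hf₂ z)
    simp only [this]
    ring
  · refine ContinuousOn.circleIntegrable hR.le fun z hz => ContinuousAt.continuousWithinAt ?_
    exact (hφ z).continuousAt.mul (((hf₁.analyticAt z).deriv.continuousAt).div
      (hf₁ z).continuousAt (h01 z hz))
  · refine ContinuousOn.circleIntegrable hR.le fun z hz => ContinuousAt.continuousWithinAt ?_
    exact (hφ z).continuousAt.mul (((hf₂.analyticAt z).deriv.continuousAt).div
      (hf₂ z).continuousAt (h02 z hz))

theorem finite_zeros_inter_closedBall {f : ℂ → ℂ} (hf : Differentiable ℂ f)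
    (hm : ∀ a, analyticOrderAt f a ≠ ⊤) (R : ℝ) :
    {z | z ∈ Metric.closedBall (0 : ℂ) R ∧ f z = 0}.Finite := by
  by_contra h
  obtain ⟨a, -, ha⟩ := Set.Infinite.exists_accPt_of_subset_isCompact h
    (isCompact_closedBall (0 : ℂ) R) (fun z hz => hz.1)
  rcases (hf.analyticAt a).eventually_eq_zero_or_eventually_ne_zero with h0 | h0
  · exact hm a (analyticOrderAt_eq_top.2 h0)
  · rw [accPt_iff_frequently_nhdsNE] at ha
    exact ha (h0.mono fun z hz hz' => hz hz'.2)

end QuantumGraph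

end

noncomputable section

namespace QuantumGraph

/-! ### Monotone enumerations and counting -/

/-- An infinite family of reals with finite sublevel sets can be listed in increasing order. -/
theorem exists_monotone_enumeration {X : Type*} [Infinite X] (f : X → ℝ)
    (hf : ∀ a, {x | f x ≤ a}.Finite) : ∃ e : ℕ ≃ X, Monotone fun n => f (e n) := by
  have hc : Countable X := by
    have : (Set.univ : Set X) = ⋃ n : ℕ, {x | f x ≤ n} := by
      ext x
      simpa using exists_nat_ge (f x)
    rw [← Set.countable_univ_iff, this]
    exact Set.countable_iUnion fun n => (hf n).countable
  obtain ⟨ι, hι⟩ := exists_injective_nat X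
  -- Ties of `f` are broken by an arbitrary injection into `ℕ`. Below each key lie only finitely
  -- many others, since they belong to a sublevel set of `f`.
  let key : X → ℝ ×ₗ ℕ := fun x => toLex (f x, ι x)
  have hkey : Function.Injective key := fun x y h => hι (congrArg Prod.snd (toLex.injective h))
  have hle : ∀ {x y}, key x < key y → f x ≤ f y := by
    intro x y h
    rcases Prod.Lex.lt_iff.1 h with h | h
    · exact h.le
    · exact h.1.le
  let rank : X → ℕ := fun x => {y | key y < key x}.ncard
  have hrank : ∀ {x y}, key x < key y → rank x < rank y := by
    intro x y h
    refine Set.ncard_lt_ncard ?_ ((hf (f y)).subset fun z hz => hle hz)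
    refine ⟨fun z hz => lt_trans hz h, fun hs => ?_⟩
    have h3 : key x < key x := hs h
    exact lt_irrefl _ h3
  have hinj : Function.Injective rank := by
    intro x y h
    by_contra hne
    rcases lt_or_gt_of_ne (hkey.ne hne) with h' | h'
    · exact (hrank h').ne h
    · exact (hrank h').ne' h
  -- The ranks need not be shown to exhaust `ℕ`: an infinite subset of `ℕ` is order isomorphic to
  -- `ℕ`.
  have : Infinite (Set.range rank) := Set.infinite_coe_iff.2 (Set.infinite_range_of_injective hinj)
  classical
  let o := Nat.Subtype.orderIsoOfNat (Set.range rank)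
  let e := o.toEquiv.trans (Equiv.ofInjective rank hinj).symm
  have he : ∀ n, rank (e n) = o n := fun n => by
    have := Equiv.apply_ofInjective_symm hinj (o n)
    exact this
  refine ⟨e, fun n n' h => ?_⟩
  by_contra hlt
  push Not at hlt
  have h1 : key (e n') < key (e n) := Prod.Lex.lt_iff.2 (Or.inl hlt)
  have h2 := hrank h1
  rw [he, he] at h2
  exact absurd (o.monotone h) (not_le.2 h2)

theorem eq_range_card_of_isLowerSet {t : Finset ℕ} (ht : ∀ n ∈ t, ∀ n' ≤ n, n' ∈ t) :
    t = Finset.range t.card := by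
  have hsub : t ⊆ Finset.range t.card := by
    intro n hn
    have h1 : Finset.range (n + 1) ⊆ t := fun n' hn' =>
      ht n hn n' (Nat.lt_succ_iff.1 (Finset.mem_range.1 hn'))
    have h2 := Finset.card_le_card h1
    rw [Finset.card_range] at h2
    exact Finset.mem_range.2 h2
  exact Finset.eq_of_subset_of_card_le hsub (by simp)

/-- Summing over an initial set of a monotone numbering is summing over an initial segment. -/
theorem sum_comp_numbering {X M : Type*} [AddCommMonoid M] {f : X → ℝ} {σ : X ≃ ℕ}
    (hσ : Monotone fun m => f (σ.symm m)) {N : ℝ} (s : Finset X) (hs : ∀ x, x ∈ s ↔ f x < N)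
    (F : ℕ → M) : ∑ x ∈ s, F (σ x) = ∑ n ∈ Finset.range s.card, F n := by
  have h1 : s.map σ.toEmbedding = Finset.range s.card := by
    have := eq_range_card_of_isLowerSet (t := s.map σ.toEmbedding) ?_
    · simpa using this
    · intro n hn n' hn'
      rw [Finset.mem_map_equiv, hs] at hn ⊢
      exact (hσ hn').trans_lt hn
  rw [← h1, Finset.sum_map]
  rfl

/-- The indices whose value lies in `Z` form a finite lower set, hence an initial segment. Grouping
them by value gives both its length and the sum over it. -/
theorem sum_range_eq_sum_fibers {lam : ℕ → ℝ} {m : ℂ → ℕ}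
    (hfib : ∀ z : ℂ, {n : ℕ | (lam n : ℂ) = z}.encard = m z) (Z : Finset ℂ)
    (hZ : ∀ n, (lam n : ℂ) ∈ Z → ∀ n' ≤ n, (lam n' : ℂ) ∈ Z) :
    ∑ n ∈ Finset.range (∑ a ∈ Z, m a), (lam n : ℂ) = ∑ a ∈ Z, m a * a := by
  classical
  have hfin : ∀ z : ℂ, {n : ℕ | (lam n : ℂ) = z}.Finite := fun z =>
    Set.finite_of_encard_eq_coe (hfib z)
  have htfin : {n : ℕ | (lam n : ℂ) ∈ Z}.Finite := by
    have : {n : ℕ | (lam n : ℂ) ∈ Z} = ⋃ a ∈ Z, {n : ℕ | (lam n : ℂ) = a} := by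
      ext n; simp
    rw [this]
    exact Set.Finite.biUnion Z.finite_toSet fun a _ => hfin a
  set t := htfin.toFinset with ht
  have hmem : ∀ n, n ∈ t ↔ (lam n : ℂ) ∈ Z := fun n => by simp [ht]
  have hcard : ∀ a ∈ Z, (t.filter fun n => (lam n : ℂ) = a).card = m a := by
    intro a ha
    have h1 : ((t.filter fun n => (lam n : ℂ) = a) : Set ℕ) = {n : ℕ | (lam n : ℂ) = a} := by
      ext n
      simp only [Finset.coe_filter, Set.mem_ofPred_eq, hmem]
      exact ⟨fun h => h.2, fun h => ⟨h ▸ ha, h⟩⟩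
    have h2 := hfib a
    rw [← h1, Set.encard_coe_eq_coe_finsetCard] at h2
    exact_mod_cast h2
  have hmaps : ∀ n ∈ t, (lam n : ℂ) ∈ Z := fun n hn => (hmem n).1 hn
  have htc : t.card = ∑ a ∈ Z, m a := by
    rw [Finset.card_eq_sum_card_fiberwise hmaps]
    exact Finset.sum_congr rfl hcard
  rw [← htc, ← eq_range_card_of_isLowerSet (t := t) fun n hn n' hn' =>
    (hmem n').2 (hZ n ((hmem n).1 hn) n' hn'), ← Finset.sum_fiberwise_of_maps_to hmaps]
  refine Finset.sum_congr rfl fun a ha => ?_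
  rw [Finset.sum_congr rfl fun n hn => (Finset.mem_filter.1 hn).2, Finset.sum_const, hcard a ha,
    nsmul_eq_mul]

theorem exists_isZeroNumbering {d : ℕ} (hd : 0 < d) {ℓ : Fin d → ℝ} (hℓ : ∀ i, 0 < ℓ i) :
    ∃ σ : Fin d × ℕ ≃ ℕ, IsZeroNumbering ℓ σ := by
  have : Nonempty (Fin d) := ⟨⟨0, hd⟩⟩
  obtain ⟨e, he⟩ := exists_monotone_enumeration (sineZero ℓ) fun a => by
    have hsub : {p | sineZero ℓ p ≤ a} ⊆
        ⋃ i : Fin d, (fun n => (i, n)) '' (Set.Iic ⌊a * ℓ i / Real.pi⌋₊) := by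
      rintro ⟨i, n⟩ h
      simp only [sineZero, Set.mem_ofPred_eq] at h
      rw [div_le_iff₀ (hℓ i), ← le_div_iff₀ Real.pi_pos] at h
      exact Set.mem_iUnion.2 ⟨i, n, Nat.le_floor h, rfl⟩
    exact (Set.finite_iUnion fun i => (Set.finite_Iic _).image _).subset hsub
  exact ⟨e.symm, by simpa [IsZeroNumbering] using he⟩

/-- A measure argument: the excluded intervals meeting a window `[T, T + 1]` have total length at
most `ε C`, with `C` independent of `T`. If this is less than `1`, some point of the window is
admissible. -/
theorem exists_frequently_admissibleCutoffs {d : ℕ} {ℓ : Fin d → ℝ} (hℓ : ∀ i, 0 < ℓ i) :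
    ∃ ε > 0, ∃ᶠ N in atTop, N ∈ admissibleCutoffs ℓ ε := by
  set C : ℝ := ∑ i, (4 * ℓ i / Real.pi + 1) * (2 / ℓ i) with hC
  have hCi : ∀ i, 0 ≤ (4 * ℓ i / Real.pi + 1) * (2 / ℓ i) := fun i => by
    have := hℓ i; positivity
  have hC0 : 0 ≤ C := Finset.sum_nonneg fun i _ => hCi i
  set B : ℝ := ∑ i, 1 / ℓ i with hB
  have hBi : ∀ i, 1 / ℓ i ≤ B := fun i =>
    Finset.single_le_sum (f := fun i => 1 / ℓ i) (fun j _ => by have := hℓ j; positivity)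
      (Finset.mem_univ i)
  have hB0 : 0 ≤ B := Finset.sum_nonneg fun i _ => by have := hℓ i; positivity
  -- The term `C` gives `ε C < 1`; the term `B` makes every radius `ε / ℓᵢ` less than `1`, so that
  -- only zeros in `[T - 2, T + 2]` matter. Each edge has at most `4 ℓᵢ / π + 1` of those.
  set ε : ℝ := 1 / (1 + C + B) with hε
  have hε0 : 0 < ε := by positivity
  have hεC : ε * C < 1 := by
    rw [hε, one_div, inv_mul_lt_iff₀ (by positivity)]; linarith
  have hεℓ : ∀ i, ε / ℓ i < 1 := fun i => by
    have h1 : ε / ℓ i = ε * (1 / ℓ i) := by ring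
    rw [h1, hε, one_div (1 + C + B), inv_mul_lt_iff₀ (by positivity)]
    linarith [hBi i]
  refine ⟨ε, hε0, ?_⟩
  rw [frequently_atTop]
  intro T₀
  set T := max T₀ 2 with hT
  by_contra hcon
  push Not at hcon
  let F : Fin d → Finset ℕ := fun i =>
    Finset.Icc ⌈(T - 2) * ℓ i / Real.pi⌉₊ ⌊(T + 2) * ℓ i / Real.pi⌋₊
  have hcover : Set.Icc T (T + 1) ⊆ ⋃ i ∈ (Finset.univ : Finset (Fin d)), ⋃ n ∈ F i,
      Metric.ball (sineZero ℓ (i, n)) (ε / ℓ i) := by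
    intro N hN
    have h1 := hcon N ((le_max_left _ _).trans hN.1)
    simp only [admissibleCutoffs, Set.mem_ofPred_eq, not_forall, not_le] at h1
    obtain ⟨i, n, h1⟩ := h1
    have h2 := (abs_lt.1 (h1.trans (hεℓ i)))
    have hz : sineZero ℓ (i, n) * ℓ i / Real.pi = n := by
      have := (hℓ i).ne'
      have := Real.pi_ne_zero
      simp only [sineZero]; field_simp
    simp only [Set.mem_iUnion]
    refine ⟨i, Finset.mem_univ i, n, ?_, ?_⟩
    · refine Finset.mem_Icc.2 ⟨Nat.ceil_le.2 ?_, Nat.le_floor ?_⟩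
      · rw [← hz]
        have := hℓ i
        gcongr
        linarith [hN.1]
      · rw [← hz]
        have := hℓ i
        gcongr
        linarith [hN.2]
    · rwa [Metric.mem_ball, Real.dist_eq]
  have hcard : ∀ i, ((F i).card : ℝ) ≤ 4 * ℓ i / Real.pi + 1 := by
    intro i
    have hl := hℓ i
    have hT2 : 2 ≤ T := le_max_right _ _
    rw [Nat.card_Icc]
    have h1 : (⌊(T + 2) * ℓ i / Real.pi⌋₊ : ℝ) ≤ (T + 2) * ℓ i / Real.pi :=
      Nat.floor_le (by positivity)
    have h2 := Nat.le_ceil ((T - 2) * ℓ i / Real.pi)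
    have h3 : (T + 2) * ℓ i / Real.pi = (T - 2) * ℓ i / Real.pi + 4 * ℓ i / Real.pi := by ring
    rcases le_total ⌈(T - 2) * ℓ i / Real.pi⌉₊ (⌊(T + 2) * ℓ i / Real.pi⌋₊ + 1) with h | h
    · rw [Nat.cast_sub h]; push_cast; linarith
    · rw [Nat.sub_eq_zero_of_le h]; push_cast; positivity
  have hvol := measure_mono (μ := volume) hcover
  rw [Real.volume_Icc, show T + 1 - T = 1 by ring, ENNReal.ofReal_one] at hvol
  have hle : (1 : ENNReal) ≤ ENNReal.ofReal (ε * C) := by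
    refine hvol.trans ((measure_biUnion_finset_le _ _).trans ?_)
    rw [hC, Finset.mul_sum, ENNReal.ofReal_sum_of_nonneg fun i _ => mul_nonneg hε0.le (hCi i)]
    refine Finset.sum_le_sum fun i _ => (measure_biUnion_finset_le _ _).trans ?_
    simp only [Real.volume_ball]
    rw [Finset.sum_const, nsmul_eq_mul, ← ENNReal.ofReal_natCast,
      ← ENNReal.ofReal_mul (Nat.cast_nonneg _)]
    refine ENNReal.ofReal_le_ofReal ?_
    have hl := hℓ i
    calc ((F i).card : ℝ) * (2 * (ε / ℓ i)) ≤ (4 * ℓ i / Real.pi + 1) * (2 * (ε / ℓ i)) := by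
          gcongr; exact hcard i
      _ = ε * ((4 * ℓ i / Real.pi + 1) * (2 / ℓ i)) := by ring
  rw [ENNReal.one_le_ofReal] at hle
  linarith

end QuantumGraph

end

noncomputable section

namespace QuantumGraph

open scoped BoundedContinuousFunction

/-! ### The Volterra operator and the fundamental solutions on an edge -/

/-- The nearest point projection of `ℝ` onto `[0, L]`. -/
def clamp (L x : ℝ) : ℝ := max 0 (min x L)

theorem continuous_clamp (L : ℝ) : Continuous (clamp L) := by
  unfold clamp; fun_prop

theorem clamp_mem {L : ℝ} (hL : 0 ≤ L) (x : ℝ) : clamp L x ∈ Set.Icc 0 L :=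
  ⟨le_max_left _ _, max_le hL (min_le_right _ _)⟩

theorem clamp_of_mem {L x : ℝ} (hx : x ∈ Set.Icc 0 L) : clamp L x = x := by
  simp [clamp, hx.1, hx.2]

theorem continuous_primitive (y : ℝ →ᵇ ℂ) : Continuous fun x => ∫ t in (0 : ℝ)..x, y t :=
  intervalIntegral.continuous_primitive (fun a b => y.continuous.intervalIntegrable a b) 0

theorem volterra_bound {L : ℝ} (hL : 0 ≤ L) (y : ℝ →ᵇ ℂ) (x : ℝ) :
    ‖∫ t in (0 : ℝ)..clamp L x, y t‖ ≤ ‖y‖ * L := by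
  refine (intervalIntegral.norm_integral_le_of_norm_le_const
    (fun t _ => y.norm_coe_le_norm t)).trans ?_
  have := clamp_mem hL x
  rw [sub_zero, abs_of_nonneg this.1]
  exact mul_le_mul_of_nonneg_left this.2 (norm_nonneg _)

/-- `y ↦ ∫₀ˣ y` on `[0, L]`, extended to the real line by constants. -/
def volterra {L : ℝ} (hL : 0 ≤ L) : (ℝ →ᵇ ℂ) →L[ℂ] (ℝ →ᵇ ℂ) :=
  LinearMap.mkContinuous
    { toFun := fun y => BoundedContinuousFunction.ofNormedAddCommGroup
        (fun x => ∫ t in (0 : ℝ)..clamp L x, y t)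
        ((continuous_primitive y).comp (continuous_clamp L)) (‖y‖ * L)
        (volterra_bound hL y)
      map_add' := fun y z => by
        ext x
        simp only [BoundedContinuousFunction.coe_ofNormedAddCommGroup,
          BoundedContinuousFunction.coe_add, Pi.add_apply]
        exact intervalIntegral.integral_add (y.continuous.intervalIntegrable _ _)
          (z.continuous.intervalIntegrable _ _)
      map_smul' := fun c y => by
        ext x
        simp only [BoundedContinuousFunction.coe_ofNormedAddCommGroup,
          BoundedContinuousFunction.coe_smul, RingHom.id_apply]
        exact intervalIntegral.integral_smul c _ } L
    (fun y => by
      rw [mul_comm]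
      exact BoundedContinuousFunction.norm_ofNormedAddCommGroup_le (C := ‖y‖ * L) _
        (by positivity) (fun x => volterra_bound hL y x))

theorem volterra_apply {L : ℝ} (hL : 0 ≤ L) (y : ℝ →ᵇ ℂ) (x : ℝ) :
    volterra hL y x = ∫ t in (0 : ℝ)..clamp L x, y t := rfl

theorem volterra_apply_of_mem {L : ℝ} (hL : 0 ≤ L) (y : ℝ →ᵇ ℂ) {x : ℝ}
    (hx : x ∈ Set.Icc 0 L) : volterra hL y x = ∫ t in (0 : ℝ)..x, y t := by
  rw [volterra_apply, clamp_of_mem hx]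

theorem hasDerivAt_volterra {L : ℝ} (hL : 0 ≤ L) (y : ℝ →ᵇ ℂ) {x : ℝ}
    (hx : x ∈ Set.Ioo 0 L) : HasDerivAt (volterra hL y) (y x) x := by
  have h1 : HasDerivAt (fun x => ∫ t in (0 : ℝ)..x, y t) (y x) x :=
    intervalIntegral.integral_hasDerivAt_right (y.continuous.intervalIntegrable _ _)
      (y.continuous.stronglyMeasurableAtFilter _ _) y.continuous.continuousAt
  refine h1.congr_of_eventuallyEq ?_
  filter_upwards [isOpen_Ioo.mem_nhds hx] with t ht
  exact volterra_apply_of_mem hL y (Set.Ioo_subset_Icc_self ht)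

/-- The operator `y ↦ ∫₀ˣ ∫₀ᵗ w y`. -/
def solOp {L : ℝ} (hL : 0 ≤ L) (w : ℝ →ᵇ ℂ) : (ℝ →ᵇ ℂ) →L[ℂ] (ℝ →ᵇ ℂ) :=
  ((volterra hL).comp (volterra hL)).comp (ContinuousLinearMap.mul ℂ (ℝ →ᵇ ℂ) w)

theorem solOp_apply {L : ℝ} (hL : 0 ≤ L) (w y : ℝ →ᵇ ℂ) :
    solOp hL w y = volterra hL (volterra hL (w * y)) := rfl

/-- The inner of the two integrals is estimated crudely by the length `L`, the outer one is computed
exactly from `t ^ n / n!`. One factorial per step suffices to make a high power a contraction. -/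
theorem norm_solOp_pow_apply_le {L : ℝ} (hL : 0 ≤ L) (w y : ℝ →ᵇ ℂ) (n : ℕ) (x : ℝ) :
    ‖(solOp hL w ^ n) y x‖ ≤ ‖y‖ * (L * ‖w‖) ^ n * (clamp L x ^ n / n.factorial) := by
  induction n generalizing x with
  | zero => simpa using y.norm_coe_le_norm x
  | succ n ih =>
    rw [pow_succ', mul_apply_eq_comp, solOp_apply]
    set u := (solOp hL w ^ n) y
    set K := ‖y‖ * (L * ‖w‖) ^ n with hK
    have hK0 : 0 ≤ K := by positivity
    have h1 : ∀ s, ‖volterra hL (w * u) s‖ ≤ L * ‖w‖ * K * (clamp L s ^ n / n.factorial) := by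
      intro s
      have hs := clamp_mem hL s
      have h2 : ∀ t ∈ Set.uIoc 0 (clamp L s), ‖(w * u) t‖ ≤
          ‖w‖ * (K * (clamp L s ^ n / n.factorial)) := by
        intro t ht
        rw [Set.uIoc_of_le hs.1] at ht
        have h3 := ih t
        rw [clamp_of_mem ⟨ht.1.le, ht.2.trans hs.2⟩] at h3
        rw [BoundedContinuousFunction.coe_mul, Pi.mul_apply, norm_mul]
        refine mul_le_mul (w.norm_coe_le_norm t) (h3.trans ?_) (norm_nonneg _) (norm_nonneg _)
        have := ht.1.le
        have := ht.2
        gcongr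
      rw [volterra_apply]
      refine (intervalIntegral.norm_integral_le_of_norm_le_const h2).trans ?_
      rw [sub_zero, abs_of_nonneg hs.1]
      have h4 : 0 ≤ ‖w‖ * (K * (clamp L s ^ n / n.factorial)) := by
        have := hs.1; positivity
      calc _ ≤ ‖w‖ * (K * (clamp L s ^ n / n.factorial)) * L :=
            mul_le_mul_of_nonneg_left hs.2 h4
        _ = _ := by ring
    have hx := clamp_mem hL x
    rw [volterra_apply]
    have h5 : ‖∫ t in (0 : ℝ)..clamp L x, volterra hL (w * u) t‖ ≤
        ∫ t in (0 : ℝ)..clamp L x, L * ‖w‖ * K * (t ^ n / n.factorial) := by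
      refine intervalIntegral.norm_integral_le_of_norm_le hx.1 ?_
        (Continuous.intervalIntegrable (by fun_prop) _ _)
      refine Eventually.of_forall fun t ht => ?_
      have := h1 t
      rwa [clamp_of_mem ⟨ht.1.le, ht.2.trans hx.2⟩] at this
    refine h5.trans (le_of_eq ?_)
    rw [intervalIntegral.integral_const_mul, intervalIntegral.integral_div, integral_pow,
      Nat.factorial_succ, hK]
    push_cast
    have : (n : ℝ) + 1 ≠ 0 := by positivity
    have := n.factorial_pos
    field_simp
    ring

/-- Some power `T ^ n` has norm less than `1`, so `1 - T ^ n` is invertible. It is the product of `1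
- T` with a geometric sum commuting with it, which makes `1 - T` invertible without any smallness of
`w` or `L`. -/
theorem isUnit_one_sub_solOp {L : ℝ} (hL : 0 ≤ L) (w : ℝ →ᵇ ℂ) :
    IsUnit (1 - solOp hL w) := by
  have hlim := FloorSemiring.tendsto_pow_div_factorial_atTop (L * ‖w‖ * L)
  obtain ⟨n, hn⟩ := (hlim.eventually (gt_mem_nhds one_pos)).exists
  have hnorm : ‖solOp hL w ^ n‖ < 1 := by
    refine lt_of_le_of_lt (ContinuousLinearMap.opNorm_le_bound _ (by positivity) fun y => ?_) hn
    rw [BoundedContinuousFunction.norm_le (by positivity)]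
    intro x
    refine (norm_solOp_pow_apply_le hL w y n x).trans ?_
    have hx := clamp_mem hL x
    calc ‖y‖ * (L * ‖w‖) ^ n * (clamp L x ^ n / n.factorial)
        ≤ ‖y‖ * (L * ‖w‖) ^ n * (L ^ n / n.factorial) := by
          have := hx.1
          have := hx.2
          gcongr
      _ = (L * ‖w‖ * L) ^ n / n.factorial * ‖y‖ := by rw [mul_pow (L * ‖w‖) L]; ring
  have h1 := isUnit_one_sub_of_norm_lt_one (R := (ℝ →ᵇ ℂ) →L[ℂ] (ℝ →ᵇ ℂ)) hnorm
  rw [← mul_neg_geom_sum] at h1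
  have hcomm : Commute (1 - solOp hL w) (∑ i ∈ Finset.range n, solOp hL w ^ i) := by
    have := (mul_neg_geom_sum (solOp hL w) n).trans (geom_sum_mul_neg (solOp hL w) n).symm
    exact this
  exact (hcomm.isUnit_mul_iff.1 h1).1

/-- The solution of `y'' = w y` on `[0, L]` with `y 0 = a`, `y' 0 = b`. -/
def sol {L : ℝ} (hL : 0 ≤ L) (w : ℝ →ᵇ ℂ) (a b : ℂ) : ℝ →ᵇ ℂ :=
  Ring.inverse (1 - solOp hL w) (a • 1 + b • volterra hL 1)

/-- The derivative of the solution of `y'' = w y` on `[0, L]` with `y 0 = a`, `y' 0 = b`. -/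
def solDeriv {L : ℝ} (hL : 0 ≤ L) (w : ℝ →ᵇ ℂ) (a b : ℂ) : ℝ →ᵇ ℂ :=
  b • 1 + volterra hL (w * sol hL w a b)

theorem sol_unique {L : ℝ} (hL : 0 ≤ L) {w y : ℝ →ᵇ ℂ} {a b : ℂ}
    (hy : y = a • 1 + b • volterra hL 1 + solOp hL w y) : y = sol hL w a b := by
  have h1 : (1 - solOp hL w) y = a • 1 + b • volterra hL 1 := by
    rw [_root_.sub_apply, one_apply_eq_self, sub_eq_iff_eq_add]
    exact hy
  rw [sol, ← h1, ← mul_apply_eq_comp,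
    Ring.inverse_mul_cancel _ (isUnit_one_sub_solOp hL w), one_apply_eq_self]

theorem sol_eq {L : ℝ} (hL : 0 ≤ L) (w : ℝ →ᵇ ℂ) (a b : ℂ) :
    sol hL w a b = a • 1 + volterra hL (solDeriv hL w a b) := by
  have h1 : (1 - solOp hL w) (sol hL w a b) = a • 1 + b • volterra hL 1 := by
    rw [sol, ← mul_apply_eq_comp,
      Ring.mul_inverse_cancel _ (isUnit_one_sub_solOp hL w), one_apply_eq_self]
  rw [_root_.sub_apply, one_apply_eq_self, sub_eq_iff_eq_add,
    solOp_apply] at h1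
  rw [solDeriv, map_add, map_smul, ← add_assoc]
  exact h1

theorem sol_add {L : ℝ} (hL : 0 ≤ L) (w : ℝ →ᵇ ℂ) (a b a' b' : ℂ) :
    sol hL w (a + a') (b + b') = sol hL w a b + sol hL w a' b' := by
  simp only [sol, ← map_add]
  congr 1
  module

theorem sol_smul {L : ℝ} (hL : 0 ≤ L) (w : ℝ →ᵇ ℂ) (r a b : ℂ) :
    sol hL w (r * a) (r * b) = r • sol hL w a b := by
  have h : (r * a) • (1 : ℝ →ᵇ ℂ) + (r * b) • volterra hL 1 =
      r • (a • 1 + b • volterra hL 1) := by module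
  rw [sol, h, map_smul, sol]

theorem solDeriv_add {L : ℝ} (hL : 0 ≤ L) (w : ℝ →ᵇ ℂ) (a b a' b' : ℂ) :
    solDeriv hL w (a + a') (b + b') = solDeriv hL w a b + solDeriv hL w a' b' := by
  simp only [solDeriv, sol_add, mul_add, map_add]
  module

theorem solDeriv_smul {L : ℝ} (hL : 0 ≤ L) (w : ℝ →ᵇ ℂ) (r a b : ℂ) :
    solDeriv hL w (r * a) (r * b) = r • solDeriv hL w a b := by
  simp only [solDeriv, sol_smul, mul_smul_comm, map_smul]
  module

theorem sol_zero_right {L : ℝ} (hL : 0 ≤ L) (w : ℝ →ᵇ ℂ) (a b : ℂ) :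
    sol hL w a b 0 = a := by
  rw [sol_eq]
  have := volterra_apply_of_mem hL (solDeriv hL w a b) (x := 0) ⟨le_rfl, hL⟩
  simp [this]

theorem solDeriv_zero_right {L : ℝ} (hL : 0 ≤ L) (w : ℝ →ᵇ ℂ) (a b : ℂ) :
    solDeriv hL w a b 0 = b := by
  rw [solDeriv]
  have := volterra_apply_of_mem hL (w * sol hL w a b) (x := 0) ⟨le_rfl, hL⟩
  simp only [BoundedContinuousFunction.coe_add, Pi.add_apply, this]
  simp

/-- `y` solves `y'' = w y` on `[0, L]`, with derivative `y'`. -/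
structure IsSol (L : ℝ) (w y y' : ℝ → ℂ) : Prop where
  cont_coeff : ContinuousOn w (Set.Icc 0 L)
  cont : ContinuousOn y (Set.Icc 0 L)
  cont_deriv : ContinuousOn y' (Set.Icc 0 L)
  deriv_one : ∀ x ∈ Set.Ioo 0 L, HasDerivAt y (y' x) x
  deriv_two : ∀ x ∈ Set.Ioo 0 L, HasDerivAt y' (w x * y x) x

theorem isSol_sol {L : ℝ} (hL : 0 ≤ L) (w : ℝ →ᵇ ℂ) (a b : ℂ) :
    IsSol L w (sol hL w a b) (solDeriv hL w a b) where
  cont_coeff := w.continuous.continuousOn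
  cont := (sol hL w a b).continuous.continuousOn
  cont_deriv := (solDeriv hL w a b).continuous.continuousOn
  deriv_one x hx := by
    have h1 : (sol hL w a b : ℝ → ℂ) = fun x => a + volterra hL (solDeriv hL w a b) x := by
      funext x
      conv_lhs => rw [sol_eq]
      simp
    rw [h1]
    exact (hasDerivAt_volterra hL _ hx).const_add a
  deriv_two x hx := by
    have h1 : (solDeriv hL w a b : ℝ → ℂ) = fun x => b + volterra hL (w * sol hL w a b) x := by
      funext x
      simp [solDeriv]
    rw [h1]
    exact (hasDerivAt_volterra hL _ hx).const_add b

theorem IsSol.conj {L : ℝ} {w y y' : ℝ → ℂ} (h : IsSol L w y y') :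
    IsSol L (fun x => starRingEnd ℂ (w x)) (fun x => starRingEnd ℂ (y x))
      (fun x => starRingEnd ℂ (y' x)) where
  cont_coeff := Complex.continuous_conj.comp_continuousOn h.cont_coeff
  cont := Complex.continuous_conj.comp_continuousOn h.cont
  cont_deriv := Complex.continuous_conj.comp_continuousOn h.cont_deriv
  deriv_one x hx := by simpa using (h.deriv_one x hx).star
  deriv_two x hx := by simpa using (h.deriv_two x hx).star

/-- Green's identity for two solutions. -/
theorem IsSol.green {L : ℝ} (hL : 0 ≤ L) {w y y' v z z' : ℝ → ℂ} (hy : IsSol L w y y')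
    (hz : IsSol L v z z') :
    ∫ x in (0 : ℝ)..L, (w x - v x) * (y x * z x) =
      (y' L * z L - y L * z' L) - (y' 0 * z 0 - y 0 * z' 0) := by
  have hI : Set.uIcc 0 L = Set.Icc 0 L := Set.uIcc_of_le hL
  refine (intervalIntegral.integral_eq_sub_of_hasDerivAt_of_le hL
    (f := fun x => y' x * z x - y x * z' x)
    ((hy.cont_deriv.mul hz.cont).sub (hy.cont.mul hz.cont_deriv)) ?_ ?_)
  · intro x hx
    have h1 := ((hy.deriv_two x hx).mul (hz.deriv_one x hx)).sub
      ((hy.deriv_one x hx).mul (hz.deriv_two x hx))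
    exact h1.congr_deriv (by ring)
  · refine ContinuousOn.intervalIntegrable ?_
    rw [hI]
    exact (hy.cont_coeff.sub hz.cont_coeff).mul (hy.cont.mul hz.cont)

/-- The energy enters `1 - solOp` affinely, and inversion in a Banach algebra is differentiable at
units. This is why the secular function is entire. -/
theorem differentiable_sol {L : ℝ} (hL : 0 ≤ L) (p : ℝ →ᵇ ℂ) (a b : ℂ) :
    Differentiable ℂ fun z : ℂ => sol hL (p - z • 1) a b := by
  intro z
  have h1 : DifferentiableAt ℂ (fun z : ℂ => 1 - solOp hL (p - z • 1)) z := by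
    unfold solOp
    have h2 : DifferentiableAt ℂ
        (fun z : ℂ => ContinuousLinearMap.mul ℂ (ℝ →ᵇ ℂ) (p - z • 1)) z :=
      (ContinuousLinearMap.mul ℂ (ℝ →ᵇ ℂ)).differentiableAt.comp z (by fun_prop)
    have h4 : DifferentiableAt ℂ (fun z : ℂ => ((volterra hL).comp (volterra hL)).comp
        (ContinuousLinearMap.mul ℂ (ℝ →ᵇ ℂ) (p - z • 1))) z :=
      (differentiableAt_const _).clm_comp h2
    exact h4.const_sub 1
  have hinv : DifferentiableAt ℂ (Ring.inverse : ((ℝ →ᵇ ℂ) →L[ℂ] (ℝ →ᵇ ℂ)) → _)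
      (1 - solOp hL (p - z • 1)) :=
    differentiableAt_inverse (R := (ℝ →ᵇ ℂ) →L[ℂ] (ℝ →ᵇ ℂ)) (isUnit_one_sub_solOp hL (p - z • 1))
  have h3 := DifferentiableAt.fun_comp'
    (g := (Ring.inverse : ((ℝ →ᵇ ℂ) →L[ℂ] (ℝ →ᵇ ℂ)) → _))
    (f := fun z : ℂ => 1 - solOp hL (p - z • 1)) z hinv h1
  exact h3.clm_apply (differentiableAt_const _)

theorem differentiable_solDeriv {L : ℝ} (hL : 0 ≤ L) (p : ℝ →ᵇ ℂ) (a b : ℂ) :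
    Differentiable ℂ fun z : ℂ => solDeriv hL (p - z • 1) a b := by
  have := differentiable_sol hL p a b
  unfold solDeriv
  refine (differentiable_const _).add ((volterra hL).differentiable.comp ?_)
  refine Differentiable.mul ?_ this
  fun_prop

theorem differentiable_sol_apply {L : ℝ} (hL : 0 ≤ L) (p : ℝ →ᵇ ℂ) (a b : ℂ) (x : ℝ) :
    Differentiable ℂ fun z : ℂ => sol hL (p - z • 1) a b x :=
  Differentiable.comp (g := fun y : ℝ →ᵇ ℂ => y x)
    (BoundedContinuousFunction.evalCLM ℂ x : (ℝ →ᵇ ℂ) →L[ℂ] ℂ).differentiable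
    (differentiable_sol hL p a b)

theorem differentiable_solDeriv_apply {L : ℝ} (hL : 0 ≤ L) (p : ℝ →ᵇ ℂ) (a b : ℂ) (x : ℝ) :
    Differentiable ℂ fun z : ℂ => solDeriv hL (p - z • 1) a b x :=
  Differentiable.comp (g := fun y : ℝ →ᵇ ℂ => y x)
    (BoundedContinuousFunction.evalCLM ℂ x : (ℝ →ᵇ ℂ) →L[ℂ] ℂ).differentiable
    (differentiable_solDeriv hL p a b)

end QuantumGraph

end

noncomputable section

namespace QuantumGraph

open scoped BoundedContinuousFunction

/-! ### Asymptotics of the fundamental solutions in the upper half plane -/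

/-- `exp (i k x)`, which is bounded by `1` for `x ≥ 0` and `Im k ≥ 0`. -/
def expk (k : ℂ) (x : ℝ) : ℂ := Complex.exp (Complex.I * k * x)

/-- The normalised sine `exp (i k x) * sin (k x)`. -/
def expSin (k : ℂ) (x : ℝ) : ℂ := expk k x * Complex.sin (k * x)

/-- The normalised cosine `exp (i k x) * cos (k x)`. -/
def expCos (k : ℂ) (x : ℝ) : ℂ := expk k x * Complex.cos (k * x)

theorem expk_ne_zero (k : ℂ) (x : ℝ) : expk k x ≠ 0 := Complex.exp_ne_zero _

theorem expk_add (k : ℂ) (x y : ℝ) : expk k (x + y) = expk k x * expk k y := by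
  rw [expk, expk, expk, ← Complex.exp_add]
  push_cast
  ring_nf

theorem norm_expk (k : ℂ) (x : ℝ) : ‖expk k x‖ = Real.exp (-(k.im * x)) := by
  simp [expk, Complex.norm_exp]

theorem norm_expk_le {k : ℂ} (hk : 0 ≤ k.im) {x : ℝ} (hx : 0 ≤ x) : ‖expk k x‖ ≤ 1 := by
  rw [norm_expk, Real.exp_le_one_iff]
  have := mul_nonneg hk hx
  linarith

/-- Only the exponential that decays in the upper half plane remains on the right, so bounds and
limits can be read off. -/
theorem expSin_eq (k : ℂ) (x : ℝ) : expSin k x = (expk k x ^ 2 - 1) / (2 * Complex.I) := by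
  have h1 : expk k x * Complex.exp (-(k * x) * Complex.I) = 1 := by
    rw [expk, ← Complex.exp_add]
    ring_nf
    simp
  have h2 : Complex.exp (k * x * Complex.I) = expk k x := by
    rw [expk]; ring_nf
  rw [expSin, Complex.sin, h2, eq_div_iff (by simp)]
  linear_combination (-1 : ℂ) * h1 +
    (expk k x * (Complex.exp (-(k * x) * Complex.I) - expk k x)) * Complex.I_sq

theorem expCos_eq (k : ℂ) (x : ℝ) : expCos k x = (expk k x ^ 2 + 1) / 2 := by
  have h1 : expk k x * Complex.exp (-(k * x) * Complex.I) = 1 := by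
    rw [expk, ← Complex.exp_add]
    ring_nf
    simp
  have h2 : Complex.exp (k * x * Complex.I) = expk k x := by
    rw [expk]; ring_nf
  rw [expCos, Complex.cos, h2]
  linear_combination (1 / 2 : ℂ) * h1

theorem norm_expSin_le {k : ℂ} (hk : 0 ≤ k.im) {x : ℝ} (hx : 0 ≤ x) : ‖expSin k x‖ ≤ 1 := by
  have h1 := norm_expk_le hk hx
  have h2 : ‖expk k x ^ 2 - 1‖ ≤ 2 := by
    refine (norm_sub_le _ _).trans ?_
    rw [norm_pow, norm_one]
    have := pow_le_one₀ (n := 2) (norm_nonneg _) h1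
    linarith
  rw [expSin_eq, norm_div]
  simp only [norm_mul, Complex.norm_I, Complex.norm_ofNat, mul_one]
  linarith

theorem norm_expCos_le {k : ℂ} (hk : 0 ≤ k.im) {x : ℝ} (hx : 0 ≤ x) : ‖expCos k x‖ ≤ 1 := by
  have h1 := norm_expk_le hk hx
  have h2 : ‖expk k x ^ 2 + 1‖ ≤ 2 := by
    refine (norm_add_le _ _).trans ?_
    rw [norm_pow, norm_one]
    have := pow_le_one₀ (n := 2) (norm_nonneg _) h1
    linarith
  rw [expCos_eq, norm_div]
  simp only [Complex.norm_ofNat]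
  linarith

theorem continuous_expk (k : ℂ) : Continuous (expk k) := by
  unfold expk; fun_prop

theorem continuous_expSin (k : ℂ) : Continuous (expSin k) := by
  have := continuous_expk k
  unfold expSin; fun_prop

theorem continuous_expCos (k : ℂ) : Continuous (expCos k) := by
  have := continuous_expk k
  unfold expCos; fun_prop

theorem tendsto_expk {l : Filter ℂ} (hl : Tendsto Complex.im l atTop) {x : ℝ} (hx : 0 < x) :
    Tendsto (fun k => expk k x) l (𝓝 0) := by
  rw [tendsto_zero_iff_norm_tendsto_zero]
  simp only [norm_expk]
  exact Real.tendsto_exp_neg_atTop_nhds_zero.comp (hl.atTop_mul_const hx)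

theorem tendsto_expSin {l : Filter ℂ} (hl : Tendsto Complex.im l atTop) {x : ℝ} (hx : 0 < x) :
    Tendsto (fun k => expSin k x) l (𝓝 (Complex.I / 2)) := by
  simp only [expSin_eq]
  have h := (((tendsto_expk hl hx).pow 2).sub_const 1).div_const (2 * Complex.I)
  convert h using 2
  rw [eq_div_iff (by simp)]
  linear_combination Complex.I_sq

theorem tendsto_expCos {l : Filter ℂ} (hl : Tendsto Complex.im l atTop) {x : ℝ} (hx : 0 < x) :
    Tendsto (fun k => expCos k x) l (𝓝 (1 / 2)) := by
  simp only [expCos_eq]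
  have h := (((tendsto_expk hl hx).pow 2).add_const 1).div_const 2
  convert h using 2
  norm_num

theorem tendsto_inv_of_im {l : Filter ℂ} (hl : Tendsto Complex.im l atTop) :
    Tendsto (fun k : ℂ => k⁻¹) l (𝓝 0) := by
  rw [tendsto_zero_iff_norm_tendsto_zero]
  simp only [norm_inv]
  refine tendsto_inv_atTop_zero.comp (tendsto_atTop_mono (fun k => ?_) hl)
  exact (le_abs_self _).trans (Complex.abs_im_le_norm k)

theorem hasDerivAt_mul_sub_ofReal (k : ℂ) (x t : ℝ) :
    HasDerivAt (fun t : ℝ => k * ((x : ℂ) - (t : ℂ))) (-k) t := by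
  simpa using ((Complex.ofRealCLM.hasDerivAt (x := t)).const_sub (x : ℂ)).const_mul k

theorem hasDerivAt_sin_mul_sub (k : ℂ) (x t : ℝ) :
    HasDerivAt (fun t : ℝ => Complex.sin (k * ((x : ℂ) - (t : ℂ))))
      (Complex.cos (k * ((x : ℂ) - (t : ℂ))) * -k) t :=
  HasDerivAt.comp (h₂ := Complex.sin) t (Complex.hasDerivAt_sin _) (hasDerivAt_mul_sub_ofReal k x t)

theorem hasDerivAt_cos_mul_sub (k : ℂ) (x t : ℝ) :
    HasDerivAt (fun t : ℝ => Complex.cos (k * ((x : ℂ) - (t : ℂ))))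
      (-Complex.sin (k * ((x : ℂ) - (t : ℂ))) * -k) t :=
  HasDerivAt.comp (h₂ := Complex.cos) t (Complex.hasDerivAt_cos _) (hasDerivAt_mul_sub_ofReal k x t)

/-- Variation of constants for `y'' = (p - k²) y`. -/
theorem IsSol.variation {L : ℝ} {p y y' : ℝ → ℂ} {k : ℂ} (hk : k ≠ 0)
    (h : IsSol L (fun t => p t - k ^ 2) y y') {x : ℝ} (hx : x ∈ Set.Icc 0 L) :
    y x = y 0 * Complex.cos (k * x) + y' 0 / k * Complex.sin (k * x) +
      k⁻¹ * ∫ t in (0 : ℝ)..x, Complex.sin (k * ((x : ℂ) - t)) * (p t * y t) := by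
  have hsub : Set.Icc 0 x ⊆ Set.Icc 0 L := Set.Icc_subset_Icc le_rfl hx.2
  have hp : ContinuousOn p (Set.Icc 0 L) := by
    exact (h.cont_coeff.add (continuousOn_const (c := k ^ 2))).congr fun t _ => by simp
  -- This is the Wronskian of `y` with the kernel `sin (k (x - t))`. In its derivative the terms in
  -- `k²` and `y'` cancel; at `t = x` it equals `k y x`.
  have key := intervalIntegral.integral_eq_sub_of_hasDerivAt_of_le hx.1
    (f := fun t : ℝ => Complex.sin (k * ((x : ℂ) - t)) * y' t
      + k * (Complex.cos (k * ((x : ℂ) - t)) * y t))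
    (f' := fun t : ℝ => Complex.sin (k * ((x : ℂ) - t)) * (p t * y t)) ?_ ?_ ?_
  · rw [key]
    simp only [sub_self, mul_zero, Complex.sin_zero, Complex.cos_zero, Complex.ofReal_zero,
      sub_zero]
    field_simp
    ring
  · have h1 := h.cont.mono hsub
    have h2 := h.cont_deriv.mono hsub
    fun_prop
  · intro t ht
    have ht' : t ∈ Set.Ioo 0 L := ⟨ht.1, ht.2.trans_le hx.2⟩
    have h1 := ((hasDerivAt_sin_mul_sub k x t).mul (h.deriv_two t ht')).add
      (((hasDerivAt_cos_mul_sub k x t).mul (h.deriv_one t ht')).const_mul k)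
    exact h1.congr_deriv (by ring)
  · refine ContinuousOn.intervalIntegrable ?_
    rw [Set.uIcc_of_le hx.1]
    have h1 := h.cont.mono hsub
    have h2 := hp.mono hsub
    fun_prop

theorem IsSol.variation_deriv {L : ℝ} {p y y' : ℝ → ℂ} {k : ℂ}
    (h : IsSol L (fun t => p t - k ^ 2) y y') {x : ℝ} (hx : x ∈ Set.Icc 0 L) :
    y' x = y' 0 * Complex.cos (k * x) - k * y 0 * Complex.sin (k * x) +
      ∫ t in (0 : ℝ)..x, Complex.cos (k * ((x : ℂ) - t)) * (p t * y t) := by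
  have hsub : Set.Icc 0 x ⊆ Set.Icc 0 L := Set.Icc_subset_Icc le_rfl hx.2
  have hp : ContinuousOn p (Set.Icc 0 L) := by
    exact (h.cont_coeff.add (continuousOn_const (c := k ^ 2))).congr fun t _ => by simp
  have key := intervalIntegral.integral_eq_sub_of_hasDerivAt_of_le hx.1
    (f := fun t : ℝ => Complex.cos (k * ((x : ℂ) - t)) * y' t
      - k * (Complex.sin (k * ((x : ℂ) - t)) * y t))
    (f' := fun t : ℝ => Complex.cos (k * ((x : ℂ) - t)) * (p t * y t)) ?_ ?_ ?_
  · rw [key]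
    simp only [sub_self, mul_zero, Complex.sin_zero, Complex.cos_zero, Complex.ofReal_zero,
      sub_zero]
    ring
  · have h1 := h.cont.mono hsub
    have h2 := h.cont_deriv.mono hsub
    fun_prop
  · intro t ht
    have ht' : t ∈ Set.Ioo 0 L := ⟨ht.1, ht.2.trans_le hx.2⟩
    have h1 := ((hasDerivAt_cos_mul_sub k x t).mul (h.deriv_two t ht')).sub
      (((hasDerivAt_sin_mul_sub k x t).mul (h.deriv_one t ht')).const_mul k)
    exact h1.congr_deriv (by ring)
  · refine ContinuousOn.intervalIntegrable ?_
    rw [Set.uIcc_of_le hx.1]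
    have h1 := h.cont.mono hsub
    have h2 := hp.mono hsub
    fun_prop

/-- The normalised solution `exp (i k x) y x`, where `y'' = (p - k²) y`, `y 0 = a`, `y' 0 = k b`. -/
def nsol {L : ℝ} (hL : 0 ≤ L) (p : ℝ →ᵇ ℂ) (a b k : ℂ) (x : ℝ) : ℂ :=
  expk k x * sol hL (p - k ^ 2 • 1) a (k * b) x

/-- The sine-type remainder integral of the normalised solution. -/
def sinRem {L : ℝ} (hL : 0 ≤ L) (p : ℝ →ᵇ ℂ) (a b k : ℂ) (x : ℝ) : ℂ :=
  ∫ t in (0 : ℝ)..x, expSin k (x - t) * (p t * nsol hL p a b k t)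

/-- The cosine-type remainder integral of the normalised solution. -/
def cosRem {L : ℝ} (hL : 0 ≤ L) (p : ℝ →ᵇ ℂ) (a b k : ℂ) (x : ℝ) : ℂ :=
  ∫ t in (0 : ℝ)..x, expCos k (x - t) * (p t * nsol hL p a b k t)

theorem isSol_sub_sq {L : ℝ} (hL : 0 ≤ L) (p : ℝ →ᵇ ℂ) (a b k : ℂ) :
    IsSol L (fun t => p t - k ^ 2) (sol hL (p - k ^ 2 • 1) a b)
      (solDeriv hL (p - k ^ 2 • 1) a b) := by
  have h := isSol_sol hL (p - k ^ 2 • 1) a b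
  have h2 : ((p - k ^ 2 • 1 : ℝ →ᵇ ℂ) : ℝ → ℂ) = fun t => p t - k ^ 2 := by
    funext t; simp
  rwa [h2] at h

theorem continuous_nsol {L : ℝ} (hL : 0 ≤ L) (p : ℝ →ᵇ ℂ) (a b k : ℂ) :
    Continuous (nsol hL p a b k) :=
  (continuous_expk k).mul (BoundedContinuousFunction.continuous _)

/-- The factor `exp (i k x)` splits as `exp (i k (x - t)) exp (i k t)`. One part normalises the
kernel and the other the solution, so that each factor under the integral is bounded for `Im k ≥ 0`.
-/
theorem nsol_eq {L : ℝ} (hL : 0 ≤ L) (p : ℝ →ᵇ ℂ) (a b : ℂ) {k : ℂ} (hk : k ≠ 0) {x : ℝ}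
    (hx : x ∈ Set.Icc 0 L) :
    nsol hL p a b k x = a * expCos k x + b * expSin k x + k⁻¹ * sinRem hL p a b k x := by
  have h := (isSol_sub_sq hL p a (k * b) k).variation hk hx
  rw [sol_zero_right, solDeriv_zero_right] at h
  have h2 : sinRem hL p a b k x = expk k x * ∫ t in (0 : ℝ)..x,
      Complex.sin (k * ((x : ℂ) - t)) * (p t * sol hL (p - k ^ 2 • 1) a (k * b) t) := by
    rw [sinRem, ← intervalIntegral.integral_const_mul]
    refine intervalIntegral.integral_congr fun t _ => ?_
    simp only [expSin, nsol]
    rw [show x = (x - t) + t by ring, expk_add]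
    push_cast
    ring_nf
  rw [nsol, h, h2, expCos, expSin]
  field_simp

theorem expk_mul_solDeriv {L : ℝ} (hL : 0 ≤ L) (p : ℝ →ᵇ ℂ) (a b k : ℂ) {x : ℝ}
    (hx : x ∈ Set.Icc 0 L) :
    expk k x * solDeriv hL (p - k ^ 2 • 1) a (k * b) x =
      k * (b * expCos k x - a * expSin k x) + cosRem hL p a b k x := by
  have h := (isSol_sub_sq hL p a (k * b) k).variation_deriv hx
  rw [sol_zero_right, solDeriv_zero_right] at h
  have h2 : cosRem hL p a b k x = expk k x * ∫ t in (0 : ℝ)..x,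
      Complex.cos (k * ((x : ℂ) - t)) * (p t * sol hL (p - k ^ 2 • 1) a (k * b) t) := by
    rw [cosRem, ← intervalIntegral.integral_const_mul]
    refine intervalIntegral.integral_congr fun t _ => ?_
    simp only [expCos, nsol]
    rw [show x = (x - t) + t by ring, expk_add]
    push_cast
    ring_nf
  rw [h, h2, expCos, expSin]
  ring

end QuantumGraph

end

/-! ### A priori bounds, limits as `Im k → ∞`, and integration by parts -/

noncomputable section

namespace QuantumGraph

open scoped BoundedContinuousFunction

theorem norm_integral_kernel_le {L : ℝ} {K u : ℝ → ℂ} (p : ℝ →ᵇ ℂ) {M x : ℝ}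
    (hK : ∀ t ∈ Set.Icc 0 x, ‖K t‖ ≤ 1) (hM : ∀ t ∈ Set.Icc 0 x, ‖u t‖ ≤ M)
    (hx : x ∈ Set.Icc 0 L) : ‖∫ t in (0 : ℝ)..x, K t * (p t * u t)‖ ≤ ‖p‖ * M * L := by
  have hM0 : 0 ≤ M := (norm_nonneg _).trans (hM 0 ⟨le_rfl, hx.1⟩)
  refine (intervalIntegral.norm_integral_le_of_norm_le_const (C := ‖p‖ * M) fun t ht => ?_).trans ?_
  · rw [Set.uIoc_of_le hx.1] at ht
    have ht' : t ∈ Set.Icc 0 x := ⟨ht.1.le, ht.2⟩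
    rw [norm_mul, norm_mul]
    have h1 : ‖p t‖ * ‖u t‖ ≤ ‖p‖ * M :=
      mul_le_mul (p.norm_coe_le_norm t) (hM t ht') (norm_nonneg _) (norm_nonneg _)
    calc ‖K t‖ * (‖p t‖ * ‖u t‖) ≤ 1 * (‖p‖ * M) :=
          mul_le_mul (hK t ht') h1 (by positivity) zero_le_one
      _ = ‖p‖ * M := one_mul _
  · rw [sub_zero, abs_of_nonneg hx.1]
    exact mul_le_mul_of_nonneg_left hx.2 (by positivity)

/-- Absorption at a maximum point: once `|k| ≥ 2 L ‖p‖`, the integral term in `nsol_eq` is at most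
half the maximum `M`, whence `M ≤ ‖a‖ + ‖b‖ + M / 2`. -/
theorem norm_nsol_le {L : ℝ} (hL : 0 ≤ L) (p : ℝ →ᵇ ℂ) (a b : ℂ) {k : ℂ} (hk : k ≠ 0)
    (him : 0 ≤ k.im) (hkp : 2 * (L * ‖p‖) ≤ ‖k‖) {x : ℝ} (hx : x ∈ Set.Icc 0 L) :
    ‖nsol hL p a b k x‖ ≤ 2 * (‖a‖ + ‖b‖) := by
  obtain ⟨s, hs, hmax⟩ := (isCompact_Icc (a := (0 : ℝ)) (b := L)).exists_isMaxOn ⟨x, hx⟩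
    (continuous_nsol hL p a b k).norm.continuousOn
  set M := ‖nsol hL p a b k s‖ with hM
  have hM0 : 0 ≤ M := norm_nonneg _
  refine (hmax hx).trans ?_
  have hr : ‖sinRem hL p a b k s‖ ≤ ‖p‖ * M * L :=
    norm_integral_kernel_le p (fun t ht => norm_expSin_le him (sub_nonneg.2 ht.2))
      (fun t ht => hmax ⟨ht.1, ht.2.trans hs.2⟩) hs
  have hk0 : 0 < ‖k‖ := norm_pos_iff.2 hk
  have h1 : M ≤ ‖a‖ + ‖b‖ + M / 2 := by
    calc M = ‖a * expCos k s + b * expSin k s + k⁻¹ * sinRem hL p a b k s‖ := by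
          rw [hM, nsol_eq hL p a b hk hs]
      _ ≤ ‖a * expCos k s‖ + ‖b * expSin k s‖ + ‖k⁻¹ * sinRem hL p a b k s‖ := norm_add₃_le
      _ ≤ ‖a‖ * 1 + ‖b‖ * 1 + ‖k‖⁻¹ * (‖p‖ * M * L) := by
          rw [norm_mul, norm_mul, norm_mul, norm_inv]
          gcongr
          · exact norm_expCos_le him hs.1
          · exact norm_expSin_le him hs.1
      _ ≤ ‖a‖ + ‖b‖ + M / 2 := by
          have : ‖k‖⁻¹ * (‖p‖ * M * L) ≤ M / 2 := by
            rw [inv_mul_le_iff₀ hk0]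
            nlinarith
          linarith
  linarith

theorem norm_sinRem_le {L : ℝ} (hL : 0 ≤ L) (p : ℝ →ᵇ ℂ) (a b : ℂ) {k : ℂ} (hk : k ≠ 0)
    (him : 0 ≤ k.im) (hkp : 2 * (L * ‖p‖) ≤ ‖k‖) {x : ℝ} (hx : x ∈ Set.Icc 0 L) :
    ‖sinRem hL p a b k x‖ ≤ ‖p‖ * (2 * (‖a‖ + ‖b‖)) * L :=
  norm_integral_kernel_le p (fun _ ht => norm_expSin_le him (sub_nonneg.2 ht.2))
    (fun _ ht => norm_nsol_le hL p a b hk him hkp ⟨ht.1, ht.2.trans hx.2⟩) hx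

theorem norm_cosRem_le {L : ℝ} (hL : 0 ≤ L) (p : ℝ →ᵇ ℂ) (a b : ℂ) {k : ℂ} (hk : k ≠ 0)
    (him : 0 ≤ k.im) (hkp : 2 * (L * ‖p‖) ≤ ‖k‖) {x : ℝ} (hx : x ∈ Set.Icc 0 L) :
    ‖cosRem hL p a b k x‖ ≤ ‖p‖ * (2 * (‖a‖ + ‖b‖)) * L :=
  norm_integral_kernel_le p (fun _ ht => norm_expCos_le him (sub_nonneg.2 ht.2))
    (fun _ ht => norm_nsol_le hL p a b hk him hkp ⟨ht.1, ht.2.trans hx.2⟩) hx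

/-- Dominated convergence on `(0, x)`. -/
theorem tendsto_integral_Ioo {ι : Type*} {l : Filter ι} [l.IsCountablyGenerated]
    {F : ι → ℝ → ℂ} {f : ℝ → ℂ} {x : ℝ} (hx : 0 ≤ x) (bound : ℝ → ℝ)
    (hmeas : ∀ᶠ k in l, AEStronglyMeasurable (F k) (volume.restrict (Set.uIoc 0 x)))
    (hbi : IntervalIntegrable bound volume 0 x)
    (hb : ∀ᶠ k in l, ∀ t ∈ Set.Ioo 0 x, ‖F k t‖ ≤ bound t)
    (hlim : ∀ t ∈ Set.Ioo 0 x, Tendsto (fun k => F k t) l (𝓝 (f t))) :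
    Tendsto (fun k => ∫ t in (0 : ℝ)..x, F k t) l (𝓝 (∫ t in (0 : ℝ)..x, f t)) := by
  have hne : ∀ᵐ t : ℝ, t ≠ x := by simp [ae_iff]
  refine intervalIntegral.tendsto_integral_filter_of_dominated_convergence bound hmeas ?_ hbi ?_
  · filter_upwards [hb] with k hk
    filter_upwards [hne] with t ht htx
    rw [Set.uIoc_of_le hx] at htx
    exact hk t ⟨htx.1, lt_of_le_of_ne htx.2 ht⟩
  · filter_upwards [hne] with t ht htx
    rw [Set.uIoc_of_le hx] at htx
    exact hlim t ⟨htx.1, lt_of_le_of_ne htx.2 ht⟩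

theorem eventually_large {l : Filter ℂ} (hl : Tendsto Complex.im l atTop) (C : ℝ) :
    ∀ᶠ k in l, k ≠ 0 ∧ 0 ≤ k.im ∧ C ≤ ‖k‖ := by
  filter_upwards [hl.eventually_ge_atTop (max 1 C)] with k hk
  have h1 : 1 ≤ k.im := (le_max_left _ _).trans hk
  refine ⟨?_, by linarith, ((le_max_right _ _).trans hk).trans
    ((le_abs_self _).trans (Complex.abs_im_le_norm k))⟩
  rintro rfl
  simp at h1
  linarith

/-- For `x > 0` the normalised cosine and sine tend to `1/2` and `i/2`, and the remainder carries a
factor `k⁻¹`. The point `x = 0`, where the value is `a` for every `k`, is a null set for the later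
integrals. -/
theorem tendsto_nsol {L : ℝ} (hL : 0 ≤ L) (p : ℝ →ᵇ ℂ) (a b : ℂ) {l : Filter ℂ}
    (hl : Tendsto Complex.im l atTop) {x : ℝ} (hx : x ∈ Set.Ioc 0 L) :
    Tendsto (fun k => nsol hL p a b k x) l (𝓝 ((a + Complex.I * b) / 2)) := by
  have hx' : x ∈ Set.Icc 0 L := ⟨hx.1.le, hx.2⟩
  have hlarge := eventually_large hl (2 * (L * ‖p‖))
  have h0 : Tendsto (fun k => k⁻¹ * sinRem hL p a b k x) l (𝓝 0) := by
    refine (tendsto_inv_of_im hl).zero_mul_isBoundedUnder_le ?_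
    refine ⟨‖p‖ * (2 * (‖a‖ + ‖b‖)) * L, ?_⟩
    rw [eventually_map]
    filter_upwards [hlarge] with k hk
    exact norm_sinRem_le hL p a b hk.1 hk.2.1 hk.2.2 hx'
  have h1 := (((tendsto_expCos hl hx.1).const_mul a).add
    ((tendsto_expSin hl hx.1).const_mul b)).add h0
  refine (h1.congr' ?_).trans_eq ?_
  · filter_upwards [hlarge] with k hk
    exact (nsol_eq hL p a b hk.1 hx').symm
  · congr 1; ring

theorem tendsto_integral_kernel {L : ℝ} (hL : 0 ≤ L) (p : ℝ →ᵇ ℂ) (a b : ℂ) {l : Filter ℂ}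
    [l.IsCountablyGenerated] (hl : Tendsto Complex.im l atTop) {K : ℂ → ℝ → ℂ} {κ : ℂ}
    (hKc : ∀ k, Continuous (K k)) (hK1 : ∀ k : ℂ, 0 ≤ k.im → ∀ t, 0 ≤ t → ‖K k t‖ ≤ 1)
    (hKl : ∀ t, 0 < t → Tendsto (fun k => K k t) l (𝓝 κ)) {x : ℝ} (hx : x ∈ Set.Icc 0 L) :
    Tendsto (fun k => ∫ t in (0 : ℝ)..x, K k (x - t) * (p t * nsol hL p a b k t)) l
      (𝓝 (κ * ((a + Complex.I * b) / 2) * ∫ t in (0 : ℝ)..x, p t)) := by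
  rw [← intervalIntegral.integral_const_mul]
  have hlarge := eventually_large hl (2 * (L * ‖p‖))
  refine tendsto_integral_Ioo hx.1 (fun _ => 1 * (‖p‖ * (2 * (‖a‖ + ‖b‖)))) ?_
    intervalIntegrable_const ?_ ?_
  · refine Eventually.of_forall fun k => Continuous.aestronglyMeasurable ?_
    have := continuous_nsol hL p a b k
    have := hKc k
    fun_prop
  · filter_upwards [hlarge] with k hk t ht
    rw [norm_mul, norm_mul]
    have h1 := norm_nsol_le hL p a b hk.1 hk.2.1 hk.2.2 (x := t) ⟨ht.1.le, ht.2.le.trans hx.2⟩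
    have h2 := hK1 k hk.2.1 (x - t) (sub_nonneg.2 ht.2.le)
    have h3 := p.norm_coe_le_norm t
    gcongr
  · intro t ht
    have h1 := (hKl (x - t) (sub_pos.2 ht.2)).mul
      ((tendsto_nsol hL p a b hl (x := t) ⟨ht.1, ht.2.le.trans hx.2⟩).const_mul (p t))
    refine h1.trans_eq ?_
    congr 1; ring

theorem tendsto_sinRem {L : ℝ} (hL : 0 ≤ L) (p : ℝ →ᵇ ℂ) (a b : ℂ) {l : Filter ℂ}
    [l.IsCountablyGenerated] (hl : Tendsto Complex.im l atTop) {x : ℝ} (hx : x ∈ Set.Icc 0 L) :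
    Tendsto (fun k => sinRem hL p a b k x) l
      (𝓝 (Complex.I / 2 * ((a + Complex.I * b) / 2) * ∫ t in (0 : ℝ)..x, p t)) :=
  tendsto_integral_kernel hL p a b hl continuous_expSin (fun _ hk _ ht => norm_expSin_le hk ht)
    (fun _ ht => tendsto_expSin hl ht) hx

theorem tendsto_cosRem {L : ℝ} (hL : 0 ≤ L) (p : ℝ →ᵇ ℂ) (a b : ℂ) {l : Filter ℂ}
    [l.IsCountablyGenerated] (hl : Tendsto Complex.im l atTop) {x : ℝ} (hx : x ∈ Set.Icc 0 L) :
    Tendsto (fun k => cosRem hL p a b k x) l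
      (𝓝 (1 / 2 * ((a + Complex.I * b) / 2) * ∫ t in (0 : ℝ)..x, p t)) :=
  tendsto_integral_kernel hL p a b hl continuous_expCos (fun _ hk _ ht => norm_expCos_le hk ht)
    (fun _ ht => tendsto_expCos hl ht) hx

/-- Fubini on the triangle `u ≤ t`. As `g` is merely integrable, its primitive need not be
differentiable everywhere, and the classical product rule is avoided. -/
theorem integral_mul_primitive {L : ℝ} (hL : 0 ≤ L) {g Φ φ : ℝ → ℂ}
    (hg : IntervalIntegrable g volume 0 L) (hΦ : ∀ t, HasDerivAt Φ (φ t) t) (hφ : Continuous φ) :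
    ∫ t in (0 : ℝ)..L, φ t * ∫ u in (0 : ℝ)..t, g u = ∫ u in (0 : ℝ)..L, (Φ L - Φ u) * g u := by
  set μ := volume.restrict (Set.Ioc 0 L) with hμ
  let s : Set (ℝ × ℝ) := {r | r.2 ≤ r.1}
  have hs : MeasurableSet s := measurableSet_le measurable_snd measurable_fst
  have hgi : Integrable g μ := (intervalIntegrable_iff_integrableOn_Ioc_of_le hL).1 hg
  have hφi : Integrable φ μ :=
    (intervalIntegrable_iff_integrableOn_Ioc_of_le hL).1 (hφ.intervalIntegrable 0 L)
  have hint : Integrable (Function.uncurry fun t u => s.indicator (fun r => φ r.1 * g r.2) (t, u))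
      (μ.prod μ) := (hφi.mul_prod hgi).indicator hs
  have hswap := integral_integral_swap hint
  rw [intervalIntegral.integral_of_le hL, intervalIntegral.integral_of_le hL]
  convert hswap using 1
  · refine setIntegral_congr_fun measurableSet_Ioc fun t ht => ?_
    have h1 : (fun u => s.indicator (fun r => φ r.1 * g r.2) (t, u)) =
        (Set.Iic t).indicator fun u => φ t * g u := by
      funext u
      by_cases hu : u ≤ t <;> simp [s, Set.indicator, hu]
    simp only [h1]
    rw [integral_indicator measurableSet_Iic, hμ, Measure.restrict_restrict measurableSet_Iic,
      integral_const_mul, intervalIntegral.integral_of_le ht.1.le]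
    congr 3
    ext u
    simp only [Set.mem_Ioc, Set.mem_inter_iff, Set.mem_Iic]
    exact ⟨fun h => ⟨h.2, h.1, h.2.trans ht.2⟩, fun h => ⟨h.2.1, h.1⟩⟩
  · refine setIntegral_congr_fun measurableSet_Ioc fun u hu => ?_
    have h1 : (fun t => s.indicator (fun r => φ r.1 * g r.2) (t, u)) =
        (Set.Ici u).indicator fun t => φ t * g u := by
      funext t
      by_cases hut : u ≤ t <;> simp [s, Set.indicator, hut]
    simp only [h1]
    rw [integral_indicator measurableSet_Ici, hμ, Measure.restrict_restrict measurableSet_Ici,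
      integral_mul_const]
    have h2 : Set.Ici u ∩ Set.Ioc 0 L = Set.Icc u L := by
      ext t
      simp only [Set.mem_Ioc, Set.mem_inter_iff, Set.mem_Ici, Set.mem_Icc]
      exact ⟨fun h => ⟨h.1, h.2.2⟩, fun h => ⟨h.1, hu.1.trans_le h.1, h.2⟩⟩
    rw [h2, integral_Icc_eq_integral_Ioc, ← intervalIntegral.integral_of_le hu.2,
      intervalIntegral.integral_eq_sub_of_hasDerivAt (fun t _ => hΦ t)
        (hφ.intervalIntegrable _ _)]

/-- Integration by parts against a function with an integrable weak derivative. -/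
theorem HasWeakDeriv.integral_mul {L : ℝ} (hL : 0 ≤ L) {f g Φ φ : ℝ → ℂ}
    (h : HasWeakDeriv L f g) (hΦ : ∀ t, HasDerivAt Φ (φ t) t) (hφ : Continuous φ) :
    ∫ t in (0 : ℝ)..L, φ t * f t = Φ L * f L - Φ 0 * f 0 - ∫ t in (0 : ℝ)..L, Φ t * g t := by
  have hΦc : Continuous Φ := continuous_iff_continuousAt.2 fun t => (hΦ t).continuousAt
  have h1 : ∫ t in (0 : ℝ)..L, φ t * f t =
      ∫ t in (0 : ℝ)..L, (φ t * f 0 + φ t * ∫ u in (0 : ℝ)..t, g u) := by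
    refine intervalIntegral.integral_congr fun t ht => ?_
    rw [Set.uIcc_of_le hL] at ht
    simp only [h.2 t ht, mul_add]
  have hprim : ContinuousOn (fun t => ∫ u in (0 : ℝ)..t, g u) (Set.uIcc 0 L) :=
    intervalIntegral.continuousOn_primitive_interval (by
      rw [Set.uIcc_of_le hL, integrableOn_Icc_iff_integrableOn_Ioc]
      exact (intervalIntegrable_iff_integrableOn_Ioc_of_le hL).1 h.1)
  have h3 : IntervalIntegrable (fun t => φ t * f 0) volume 0 L :=
    Continuous.intervalIntegrable (by fun_prop) _ _
  have h4 : IntervalIntegrable (fun t => φ t * ∫ u in (0 : ℝ)..t, g u) volume 0 L :=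
    (hφ.continuousOn.mul hprim).intervalIntegrable
  rw [h1, intervalIntegral.integral_add h3 h4, integral_mul_primitive hL h.1 hΦ hφ,
    intervalIntegral.integral_mul_const,
    intervalIntegral.integral_eq_sub_of_hasDerivAt (fun t _ => hΦ t) (hφ.intervalIntegrable _ _)]
  simp only [sub_mul]
  rw [intervalIntegral.integral_sub (h.1.const_mul _)
    (h.1.continuousOn_mul hΦc.continuousOn), intervalIntegral.integral_const_mul]
  have h2 := h.2 L ⟨hL, le_rfl⟩
  rw [h2]
  ring

end QuantumGraph

end

/-! ### The second-order term of the derivative at the end of an edge -/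

noncomputable section

namespace QuantumGraph

open scoped BoundedContinuousFunction

/-- Normalisation turns this sine into a difference of decaying exponentials from the two ends of
the edge: bounded on `[0, L]`, and tending to zero at every interior point. -/
theorem expk_mul_sin_sub_two_mul (k : ℂ) (L t : ℝ) :
    expk k L * Complex.sin (k * ((L : ℂ) - 2 * t)) =
      (expk k t ^ 2 - expk k (L - t) ^ 2) * (Complex.I / 2) := by
  have h0 : expk k L = expk k (L - t) * expk k t := by rw [← expk_add]; ring_nf
  have h1 : expk k (L - t) * Complex.exp (-(k * ((L : ℂ) - 2 * t)) * Complex.I) = expk k t := by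
    rw [expk, expk, ← Complex.exp_add]; push_cast; ring_nf
  have h2 : expk k t * Complex.exp (k * ((L : ℂ) - 2 * t) * Complex.I) = expk k (L - t) := by
    rw [expk, expk, ← Complex.exp_add]; push_cast; ring_nf
  rw [h0, Complex.sin]
  linear_combination (expk k t * (Complex.I / 2)) * h1 - (expk k (L - t) * (Complex.I / 2)) * h2

theorem norm_expk_mul_sin_le {k : ℂ} (hk : 0 ≤ k.im) {L t : ℝ} (ht : t ∈ Set.Icc 0 L) :
    ‖expk k L * Complex.sin (k * ((L : ℂ) - 2 * t))‖ ≤ 1 := by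
  rw [expk_mul_sin_sub_two_mul, norm_mul]
  have h1 := pow_le_one₀ (n := 2) (norm_nonneg _) (norm_expk_le hk ht.1)
  have h2 := pow_le_one₀ (n := 2) (norm_nonneg _) (norm_expk_le hk (sub_nonneg.2 ht.2))
  have h3 : ‖expk k t ^ 2 - expk k (L - t) ^ 2‖ ≤ 2 := by
    refine (norm_sub_le _ _).trans ?_
    rw [norm_pow, norm_pow]
    linarith
  have h4 : ‖Complex.I / 2‖ = 1 / 2 := by simp
  rw [h4]
  linarith

theorem tendsto_expk_mul_sin {l : Filter ℂ} (hl : Tendsto Complex.im l atTop) {L t : ℝ}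
    (ht : t ∈ Set.Ioo 0 L) :
    Tendsto (fun k => expk k L * Complex.sin (k * ((L : ℂ) - 2 * t))) l (𝓝 0) := by
  simp only [expk_mul_sin_sub_two_mul]
  have h := (((tendsto_expk hl ht.1).pow 2).sub
    ((tendsto_expk hl (sub_pos.2 ht.2)).pow 2)).mul_const (Complex.I / 2)
  simpa using h

theorem integral_mul_integral_self (L : ℝ) (p : ℝ →ᵇ ℂ) :
    ∫ t in (0 : ℝ)..L, p t * ∫ u in (0 : ℝ)..t, p u = (∫ t in (0 : ℝ)..L, p t) ^ 2 / 2 := by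
  have hd : ∀ t, HasDerivAt (fun x => ∫ u in (0 : ℝ)..x, p u) (p t) t := fun t =>
    intervalIntegral.integral_hasDerivAt_right (p.continuous.intervalIntegrable _ _)
      (p.continuous.stronglyMeasurableAtFilter _ _) p.continuous.continuousAt
  have h1 := intervalIntegral.integral_eq_sub_of_hasDerivAt (a := (0 : ℝ)) (b := L)
    (f := fun x => (∫ u in (0 : ℝ)..x, p u) ^ 2 / 2)
    (f' := fun t => p t * ∫ u in (0 : ℝ)..t, p u)
    (fun t _ => (((hd t).pow 2).div_const 2).congr_deriv (by simp; ring))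
    ((p.continuous.mul (continuous_primitive p)).intervalIntegrable _ _)
  rw [h1]
  simp

/-- The first remainder of the normalised derivative of the cosine solution, after subtraction of
its leading term, times `k`. -/
def secondRem {L : ℝ} (hL : 0 ≤ L) (p : ℝ →ᵇ ℂ) (k : ℂ) : ℂ :=
  k * (cosRem hL p 1 0 k L - (∫ t in (0 : ℝ)..L, p t) / 2 * expCos k L)

/-- The solution inside `cosRem` is `expCos + k⁻¹ sinRem`. The `sinRem` part becomes the double
integral. The `expCos` part splits by a product formula into the subtracted leading term and an
oscillating integral of `p`, which gains `k⁻¹` on integration by parts; its boundary terms are the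
source of `p L + p 0`. -/
theorem secondRem_eq {L : ℝ} (hL : 0 ≤ L) (p : ℝ →ᵇ ℂ) {g : ℝ → ℂ} (hg : HasWeakDeriv L p g)
    {k : ℂ} (hk : k ≠ 0) :
    secondRem hL p k = 1 / 4 * expSin k L * (p L + p 0) +
      1 / 4 * (∫ t in (0 : ℝ)..L, expk k L * Complex.sin (k * ((L : ℂ) - 2 * t)) * g t) +
      ∫ t in (0 : ℝ)..L, expCos k (L - t) * (p t * sinRem hL p 1 0 k t) := by
  have hcn := continuous_nsol hL p 1 0 k
  have hcc := continuous_expCos k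
  have hce := continuous_expk k
  have h1 : ∫ t in (0 : ℝ)..L, expCos k (L - t) * (p t * sinRem hL p 1 0 k t) =
      k * ∫ t in (0 : ℝ)..L, expCos k (L - t) * (p t * (nsol hL p 1 0 k t - expCos k t)) := by
    rw [← intervalIntegral.integral_const_mul]
    refine intervalIntegral.integral_congr fun t ht => ?_
    rw [Set.uIcc_of_le hL] at ht
    simp only [nsol_eq hL p 1 0 hk ht]
    field_simp
    ring
  have h2 : cosRem hL p 1 0 k L =
      (∫ t in (0 : ℝ)..L, expCos k (L - t) * (p t * (nsol hL p 1 0 k t - expCos k t))) +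
      ∫ t in (0 : ℝ)..L, expCos k (L - t) * (p t * expCos k t) := by
    rw [cosRem, ← intervalIntegral.integral_add]
    · refine intervalIntegral.integral_congr fun t _ => ?_
      ring
    · exact Continuous.intervalIntegrable (by fun_prop) _ _
    · exact Continuous.intervalIntegrable (by fun_prop) _ _
  have h3 : ∫ t in (0 : ℝ)..L, expCos k (L - t) * (p t * expCos k t) =
      1 / 2 * (expCos k L * ∫ t in (0 : ℝ)..L, p t) +
      1 / 2 * ∫ t in (0 : ℝ)..L, expk k L * Complex.cos (k * ((L : ℂ) - 2 * t)) * p t := by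
    rw [← intervalIntegral.integral_const_mul, ← intervalIntegral.integral_const_mul,
      ← intervalIntegral.integral_const_mul, ← intervalIntegral.integral_add]
    · refine intervalIntegral.integral_congr fun t _ => ?_
      have h0 : expk k L = expk k (L - t) * expk k t := by rw [← expk_add]; ring_nf
      -- The first summand is independent of `t` and yields the leading term; the second oscillates
      -- in `t`.
      have hadd : Complex.cos (k * L) + Complex.cos (k * ((L : ℂ) - 2 * t)) =
          2 * (Complex.cos (k * ((L : ℂ) - t)) * Complex.cos (k * t)) := by
        have e1 : k * (L : ℂ) = k * ((L : ℂ) - t) + k * t := by ring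
        have e2 : k * ((L : ℂ) - 2 * t) = k * ((L : ℂ) - t) - k * t := by ring
        rw [e1, e2, Complex.cos_add, Complex.cos_sub]
        ring
      simp only [expCos]
      rw [h0]
      push_cast
      linear_combination (-1 / 2 * expk k (L - t) * expk k t * p t) * hadd
    · exact Continuous.intervalIntegrable (by fun_prop) _ _
    · exact Continuous.intervalIntegrable (by fun_prop) _ _
  have hlin : ∀ t : ℝ, HasDerivAt (fun t : ℝ => k * ((L : ℂ) - 2 * t)) (k * (-2)) t := fun t => by
    have := (((Complex.ofRealCLM.hasDerivAt (x := t)).const_mul (2 : ℂ)).const_sub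
      (L : ℂ)).const_mul k
    simpa using this
  -- The oscillating cosine has a primitive with prefactor `-1/(2k)`; at `t = L` and `t = 0` the
  -- sine takes opposite values, so the two boundary terms add.
  have h4 := hg.integral_mul hL
    (Φ := fun t : ℝ => expk k L * (Complex.sin (k * ((L : ℂ) - 2 * t)) * (-(2 * k)⁻¹)))
    (φ := fun t : ℝ => expk k L * Complex.cos (k * ((L : ℂ) - 2 * t)))
    (fun t => by
      have := ((HasDerivAt.comp (h₂ := Complex.sin) t (Complex.hasDerivAt_sin _)
        (hlin t)).mul_const (-(2 * k)⁻¹)).const_mul (expk k L)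
      refine this.congr_deriv ?_
      field_simp) (by fun_prop)
  have h5 : ∫ t in (0 : ℝ)..L, expk k L * (Complex.sin (k * ((L : ℂ) - 2 * t)) * (-(2 * k)⁻¹)) * g t
      = (-(2 * k)⁻¹) *
        ∫ t in (0 : ℝ)..L, expk k L * Complex.sin (k * ((L : ℂ) - 2 * t)) * g t := by
    rw [← intervalIntegral.integral_const_mul]
    refine intervalIntegral.integral_congr fun t _ => ?_
    ring
  have h6 : Complex.sin (k * ((L : ℂ) - 2 * L)) = -Complex.sin (k * L) := by
    rw [← Complex.sin_neg]; ring_nf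
  rw [h5] at h4
  simp only [Complex.ofReal_zero, mul_zero, sub_zero, h6] at h4
  rw [secondRem, h1, h2, h3, h4, expSin]
  field_simp
  ring

end QuantumGraph

end

/-! ### Boundedness and limits of the remainders as `k → ∞` -/

noncomputable section

namespace QuantumGraph

open scoped BoundedContinuousFunction
open Asymptotics

theorem isBigO_one_of_le {l : Filter ℂ} {f : ℂ → ℂ} {C : ℝ} (h : ∀ᶠ k in l, ‖f k‖ ≤ C) :
    f =O[l] (1 : ℂ → ℂ) :=
  IsBigO.of_bound C (by simpa using h)

theorem isBigO_one_mul {l : Filter ℂ} {f g : ℂ → ℂ} (hf : f =O[l] (1 : ℂ → ℂ))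
    (hg : g =O[l] (1 : ℂ → ℂ)) : (fun k => f k * g k) =O[l] (1 : ℂ → ℂ) :=
  (hf.mul hg).congr_right fun k => by simp

theorem tendsto_inv_mul_of_isBigO_one {l : Filter ℂ} (hinf : Tendsto (fun k : ℂ => ‖k‖) l atTop)
    {f : ℂ → ℂ} (hf : f =O[l] (1 : ℂ → ℂ)) : Tendsto (fun k => k⁻¹ * f k) l (𝓝 0) := by
  have h1 : Tendsto (fun k : ℂ => k⁻¹) l (𝓝 0) := by
    rw [tendsto_zero_iff_norm_tendsto_zero]
    simpa using! tendsto_inv_atTop_zero.comp hinf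
  exact h1.zero_mul_isBoundedUnder_le ((isBigO_one_iff ℂ).1 hf)

theorem eventually_regular {l : Filter ℂ} (hinf : Tendsto (fun k : ℂ => ‖k‖) l atTop)
    (him : ∀ᶠ k in l, 0 ≤ k.im) (C : ℝ) : ∀ᶠ k in l, k ≠ 0 ∧ 0 ≤ k.im ∧ C ≤ ‖k‖ := by
  filter_upwards [hinf.eventually_ge_atTop C, hinf.eventually_gt_atTop 0, him] with k h1 h2 h3
  exact ⟨norm_pos_iff.1 h2, h3, h1⟩

section Bounds

variable {L : ℝ} (hL : 0 ≤ L) (p : ℝ →ᵇ ℂ) {l : Filter ℂ}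

theorem isBigO_sinRem (hinf : Tendsto (fun k : ℂ => ‖k‖) l atTop) (him : ∀ᶠ k in l, 0 ≤ k.im)
    (a b : ℂ) : (fun k => sinRem hL p a b k L) =O[l] (1 : ℂ → ℂ) :=
  isBigO_one_of_le <| (eventually_regular hinf him (2 * (L * ‖p‖))).mono fun _ hk =>
    norm_sinRem_le hL p a b hk.1 hk.2.1 hk.2.2 ⟨hL, le_rfl⟩

theorem isBigO_cosRem (hinf : Tendsto (fun k : ℂ => ‖k‖) l atTop) (him : ∀ᶠ k in l, 0 ≤ k.im)
    (a b : ℂ) : (fun k => cosRem hL p a b k L) =O[l] (1 : ℂ → ℂ) :=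
  isBigO_one_of_le <| (eventually_regular hinf him (2 * (L * ‖p‖))).mono fun _ hk =>
    norm_cosRem_le hL p a b hk.1 hk.2.1 hk.2.2 ⟨hL, le_rfl⟩

theorem isBigO_expSin {L : ℝ} (hL : 0 ≤ L) {l : Filter ℂ} (him : ∀ᶠ k in l, 0 ≤ k.im) :
    (fun k => expSin k L) =O[l] (1 : ℂ → ℂ) :=
  isBigO_one_of_le <| him.mono fun _ hk => norm_expSin_le hk hL

theorem isBigO_expCos {L : ℝ} (hL : 0 ≤ L) {l : Filter ℂ} (him : ∀ᶠ k in l, 0 ≤ k.im) :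
    (fun k => expCos k L) =O[l] (1 : ℂ → ℂ) :=
  isBigO_one_of_le <| him.mono fun _ hk => norm_expCos_le hk hL

theorem isBigO_expk {L : ℝ} (hL : 0 ≤ L) {l : Filter ℂ} (him : ∀ᶠ k in l, 0 ≤ k.im) :
    (fun k => expk k L) =O[l] (1 : ℂ → ℂ) :=
  isBigO_one_of_le <| him.mono fun _ hk => norm_expk_le hk hL

theorem isBigO_secondRem (hinf : Tendsto (fun k : ℂ => ‖k‖) l atTop)
    (him : ∀ᶠ k in l, 0 ≤ k.im) {g : ℝ → ℂ} (hg : HasWeakDeriv L p g) :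
    (fun k => secondRem hL p k) =O[l] (1 : ℂ → ℂ) := by
  have hreg := eventually_regular hinf him (2 * (L * ‖p‖))
  have h1 : (fun k => 1 / 4 * expSin k L * (p L + p 0)) =O[l] (1 : ℂ → ℂ) := by
    have := (isBigO_expSin hL him).const_mul_left (1 / 4 * (p L + p 0))
    refine this.congr_left fun k => by ring
  have h2 : (fun k => 1 / 4 * (∫ t in (0 : ℝ)..L,
      expk k L * Complex.sin (k * ((L : ℂ) - 2 * t)) * g t)) =O[l] (1 : ℂ → ℂ) := by
    refine IsBigO.const_mul_left ?_ _
    refine isBigO_one_of_le (C := ∫ t in (0 : ℝ)..L, ‖g t‖) (him.mono fun k hk => ?_)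
    refine intervalIntegral.norm_integral_le_of_norm_le hL ?_ hg.1.norm
    refine Eventually.of_forall fun t ht => ?_
    rw [norm_mul]
    have h5 := norm_expk_mul_sin_le hk (L := L) (t := t) ⟨ht.1.le, ht.2⟩
    calc _ ≤ 1 * ‖g t‖ := by gcongr
      _ = ‖g t‖ := one_mul _
  have h3 : (fun k => ∫ t in (0 : ℝ)..L, expCos k (L - t) * (p t * sinRem hL p 1 0 k t))
      =O[l] (1 : ℂ → ℂ) :=
    isBigO_one_of_le <| hreg.mono fun k hk => norm_integral_kernel_le p
      (fun t ht => norm_expCos_le hk.2.1 (sub_nonneg.2 ht.2))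
      (fun t ht => norm_sinRem_le hL p 1 0 hk.1 hk.2.1 hk.2.2 ht) ⟨hL, le_rfl⟩
  refine ((h1.add h2).add h3).congr' (hreg.mono fun k hk => ?_) EventuallyEq.rfl
  exact (secondRem_eq hL p hg hk.1).symm

/-- The integral against the weak derivative tends to zero by dominated convergence. The double
integral tends to a multiple of `∫ p P` with `P` the primitive of `p`, which accounts for the square
of `∫ p`. -/
theorem tendsto_secondRem [l.IsCountablyGenerated] (hL' : 0 < L)
    (hl : Tendsto Complex.im l atTop) {g : ℝ → ℂ} (hg : HasWeakDeriv L p g) :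
    Tendsto (fun k => secondRem hL p k) l
      (𝓝 (Complex.I / 8 * (p L + p 0) + Complex.I / 16 * (∫ t in (0 : ℝ)..L, p t) ^ 2)) := by
  have hreg := eventually_large hl (2 * (L * ‖p‖))
  have h1 := ((tendsto_expSin hl hL').const_mul (1 / 4)).mul_const (p L + p 0)
  have h2 : Tendsto (fun k => ∫ t in (0 : ℝ)..L,
      expk k L * Complex.sin (k * ((L : ℂ) - 2 * t)) * g t) l
      (𝓝 (∫ _ in (0 : ℝ)..L, (0 : ℂ))) := by
    refine tendsto_integral_Ioo hL (fun t => ‖g t‖) ?_ hg.1.norm ?_ ?_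
    · refine Eventually.of_forall fun k => ?_
      refine AEStronglyMeasurable.mul (Continuous.aestronglyMeasurable (by fun_prop)) ?_
      exact hg.1.def'.aestronglyMeasurable
    · filter_upwards [hreg] with k hk t ht
      rw [norm_mul]
      have h5 := norm_expk_mul_sin_le hk.2.1 (L := L) (t := t) ⟨ht.1.le, ht.2.le⟩
      calc _ ≤ 1 * ‖g t‖ := by gcongr
        _ = ‖g t‖ := one_mul _
    · intro t ht
      simpa using (tendsto_expk_mul_sin hl ht).mul_const (g t)
  have h3 : Tendsto (fun k => ∫ t in (0 : ℝ)..L, expCos k (L - t) * (p t * sinRem hL p 1 0 k t)) l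
      (𝓝 (∫ t in (0 : ℝ)..L, Complex.I / 8 * (p t * ∫ u in (0 : ℝ)..t, p u))) := by
    refine tendsto_integral_Ioo hL
      (fun _ => 1 * (‖p‖ * (‖p‖ * (2 * (‖(1 : ℂ)‖ + ‖(0 : ℂ)‖)) * L))) ?_
      intervalIntegrable_const ?_ ?_
    · filter_upwards [hreg] with k hk
      have hcn := continuous_nsol hL p 1 0 k
      have hcc := continuous_expCos k
      -- Measurability in `t` of the integrand containing `sinRem`: on `(0, L]`, `nsol_eq` replaces
      -- `sinRem` by an explicitly continuous expression.
      have hc : Continuous fun t =>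
          expCos k (L - t) * (p t * (k * (nsol hL p 1 0 k t - expCos k t))) := by fun_prop
      refine hc.aestronglyMeasurable.congr ?_
      refine (ae_restrict_iff' measurableSet_uIoc).2 (Eventually.of_forall fun t ht => ?_)
      rw [Set.uIoc_of_le hL] at ht
      have hk0 := hk.1
      simp only [nsol_eq hL p 1 0 hk0 (x := t) ⟨ht.1.le, ht.2⟩]
      field_simp
      ring
    · filter_upwards [hreg] with k hk t ht
      have ht' : t ∈ Set.Icc 0 L := ⟨ht.1.le, ht.2.le⟩
      rw [norm_mul, norm_mul]
      have h5 := norm_sinRem_le hL p 1 0 hk.1 hk.2.1 hk.2.2 ht'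
      have h6 := norm_expCos_le hk.2.1 (sub_nonneg.2 ht.2.le)
      have h7 := p.norm_coe_le_norm t
      gcongr
    · intro t ht
      have h5 := (tendsto_expCos hl (sub_pos.2 ht.2)).mul
        ((tendsto_sinRem hL p 1 0 hl (x := t) ⟨ht.1.le, ht.2.le⟩).const_mul (p t))
      refine h5.trans_eq ?_
      congr 1; ring
  have h4 := (h1.add (h2.const_mul (1 / 4))).add h3
  refine (h4.congr' (hreg.mono fun k hk => ?_)).trans_eq ?_
  · exact (secondRem_eq hL p hg hk.1).symm
  · congr 1
    rw [intervalIntegral.integral_const_mul, integral_mul_integral_self]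
    simp
    ring

/-- The normalised derivative of the cosine solution at the end of the edge is `-k` times this. -/
def edgeTau (k : ℂ) : ℂ := expSin k L - k⁻¹ * cosRem hL p 1 0 k L

theorem expk_mul_cosDeriv {k : ℂ} (hk : k ≠ 0) :
    expk k L * solDeriv hL (p - k ^ 2 • 1) 1 0 L = -k * edgeTau hL p k := by
  have h := expk_mul_solDeriv hL p 1 0 k (x := L) ⟨hL, le_rfl⟩
  rw [mul_zero] at h
  rw [h, edgeTau]
  field_simp
  ring

theorem expk_mul_cos {k : ℂ} (hk : k ≠ 0) :
    expk k L * sol hL (p - k ^ 2 • 1) 1 0 L = expCos k L + k⁻¹ * sinRem hL p 1 0 k L := by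
  have h := nsol_eq hL p 1 0 hk (x := L) ⟨hL, le_rfl⟩
  rw [nsol, mul_zero] at h
  rw [h]
  ring

theorem expk_mul_sinDeriv {k : ℂ} (hk : k ≠ 0) :
    expk k L * solDeriv hL (p - k ^ 2 • 1) 0 1 L = expCos k L + k⁻¹ * cosRem hL p 0 1 k L := by
  have h := expk_mul_solDeriv hL p 0 1 k (x := L) ⟨hL, le_rfl⟩
  -- The remainders belong to the initial slope `k b`; linearity passes to the solution with slope
  -- `1`.
  have h2 := solDeriv_smul hL (p - k ^ 2 • 1) k 0 1
  rw [mul_zero] at h2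
  rw [h2] at h
  simp only [BoundedContinuousFunction.coe_smul, smul_eq_mul] at h
  field_simp
  linear_combination h

theorem eventually_edgeTau (hinf : Tendsto (fun k : ℂ => ‖k‖) l atTop)
    (him : ∀ᶠ k in l, 0 ≤ k.im) {c : ℝ} (hc : 0 < c) (hs : ∀ᶠ k in l, c ≤ ‖expSin k L‖) :
    ∀ᶠ k in l, c / 2 ≤ ‖edgeTau hL p k‖ := by
  have h1 := tendsto_inv_mul_of_isBigO_one hinf (isBigO_cosRem hL p hinf him 1 0)
  rw [tendsto_zero_iff_norm_tendsto_zero] at h1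
  filter_upwards [h1.eventually (gt_mem_nhds (half_pos hc)), hs] with k hk1 hk2
  have h2 := norm_sub_norm_le (expSin k L) (k⁻¹ * cosRem hL p 1 0 k L)
  rw [edgeTau]
  linarith

theorem isBigO_inv_of_le {f : ℂ → ℂ} {c : ℝ} (hc : 0 < c) (h : ∀ᶠ k in l, c ≤ ‖f k‖) :
    (fun k => (f k)⁻¹) =O[l] (1 : ℂ → ℂ) :=
  isBigO_one_of_le (C := c⁻¹) <| h.mono fun k hk => by
    rw [norm_inv]
    exact inv_anti₀ hc hk

end Bounds

end QuantumGraph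

end

/-! ### The Neumann-to-Dirichlet matrix and the logarithm of a single edge -/

noncomputable section

namespace QuantumGraph

open scoped BoundedContinuousFunction
open Asymptotics

section Edge

variable {L : ℝ} (hL : 0 ≤ L) (p : ℝ →ᵇ ℂ) {l : Filter ℂ}

theorem edgeTau_zero (k : ℂ) : edgeTau hL 0 k = expSin k L := by
  simp [edgeTau, cosRem]

/-- The derivative at the end of the edge of the solution with `y 0 = 1`, `y' 0 = 0`, at energy
`z`. -/
def edgeDeriv (z : ℂ) : ℂ := solDeriv hL (p - z • 1) 1 0 L

theorem edgeDeriv_sq {k : ℂ} (hk : k ≠ 0) :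
    edgeDeriv hL p (k ^ 2) = -k * edgeTau hL p k * (expk k L)⁻¹ := by
  rw [← expk_mul_cosDeriv hL p hk, edgeDeriv]
  have := expk_ne_zero k L
  field_simp

theorem edgeDeriv_zero_sq {k : ℂ} (hk : k ≠ 0) :
    edgeDeriv hL 0 (k ^ 2) = -k * Complex.sin (k * L) := by
  rw [edgeDeriv_sq hL 0 hk, edgeTau_zero, expSin]
  have := expk_ne_zero k L
  field_simp

theorem edgeDeriv_div {k : ℂ} (hk : k ≠ 0) (hs : expSin k L ≠ 0) :
    edgeDeriv hL p (k ^ 2) / edgeDeriv hL 0 (k ^ 2) =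
      1 + -(k⁻¹ * (cosRem hL p 1 0 k L * (expSin k L)⁻¹)) := by
  rw [edgeDeriv_sq hL p hk, edgeDeriv_sq hL 0 hk, edgeTau_zero, edgeTau]
  have := expk_ne_zero k L
  field_simp
  ring

/-- The correction of the Neumann-to-Dirichlet entries; see `edgeM_sq`. -/
def edgeX (L : ℝ) (k : ℂ) (i j : Fin 2) : ℂ := if i = j then expCos k L else expk k L

/-- The correction of the Neumann-to-Dirichlet entries; see `edgeM_sq`. -/
def edgeY (k : ℂ) (i j : Fin 2) : ℂ :=
  if i = j then (if i = 0 then cosRem hL p 0 1 k L else sinRem hL p 1 0 k L) else 0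

/-- The Neumann-to-Dirichlet matrix of an edge at energy `z`. -/
def edgeM (z : ℂ) (i j : Fin 2) : ℂ :=
  -((if i = j then (if i = 0 then solDeriv hL (p - z • 1) 0 1 L else sol hL (p - z • 1) 1 0 L)
    else 1) / edgeDeriv hL p z)

theorem edgeM_sq {k : ℂ} (hk : k ≠ 0) (i j : Fin 2) :
    edgeM hL p (k ^ 2) i j =
      k⁻¹ * ((edgeX L k i j + k⁻¹ * edgeY hL p k i j) * (edgeTau hL p k)⁻¹) := by
  have he := expk_ne_zero k L
  have h : expk k L * (if i = j then (if i = 0 then solDeriv hL (p - k ^ 2 • 1) 0 1 L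
      else sol hL (p - k ^ 2 • 1) 1 0 L) else 1) = edgeX L k i j + k⁻¹ * edgeY hL p k i j := by
    unfold edgeX edgeY
    split_ifs
    · exact expk_mul_sinDeriv hL p hk
    · exact expk_mul_cos hL p hk
    · simp
  rw [edgeM, edgeDeriv_sq hL p hk, ← h]
  set S := (if i = j then (if i = 0 then solDeriv hL (p - k ^ 2 • 1) 0 1 L
      else sol hL (p - k ^ 2 • 1) 1 0 L) else 1)
  simp only [div_eq_mul_inv, mul_inv, inv_inv, inv_neg]
  ring

/-- The terms of order `k⁻¹` differ only through their denominators `edgeTau` and `expSin`, which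
differ by `k⁻¹ cosRem`. Hence the potential enters first at order `k⁻²`, with the coefficient
displayed here. -/
theorem edgeM_sub {k : ℂ} (hk : k ≠ 0) (hs : expSin k L ≠ 0) (ht : edgeTau hL p k ≠ 0)
    (i j : Fin 2) :
    k ^ 2 * (edgeM hL p (k ^ 2) i j - edgeM hL 0 (k ^ 2) i j) =
      (edgeY hL p k i j * expSin k L + edgeX L k i j * cosRem hL p 1 0 k L) *
        ((edgeTau hL p k)⁻¹ * (expSin k L)⁻¹) := by
  have h0 : edgeY hL 0 k i j = 0 := by simp [edgeY, cosRem, sinRem]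
  rw [edgeM_sq hL p hk, edgeM_sq hL 0 hk, edgeTau_zero, h0]
  have h1 : cosRem hL p 1 0 k L = k * (expSin k L - edgeTau hL p k) := by
    rw [edgeTau]; field_simp; ring
  rw [h1]
  field_simp
  ring

theorem isBigO_edgeX (hL : 0 ≤ L) (him : ∀ᶠ k in l, 0 ≤ k.im) (i j : Fin 2) :
    (fun k => edgeX L k i j) =O[l] (1 : ℂ → ℂ) := by
  unfold edgeX
  split_ifs
  · exact isBigO_expCos hL him
  · exact isBigO_expk hL him

theorem isBigO_edgeY (hinf : Tendsto (fun k : ℂ => ‖k‖) l atTop) (him : ∀ᶠ k in l, 0 ≤ k.im)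
    (i j : Fin 2) : (fun k => edgeY hL p k i j) =O[l] (1 : ℂ → ℂ) := by
  unfold edgeY
  split_ifs
  · exact isBigO_cosRem hL p hinf him 0 1
  · exact isBigO_sinRem hL p hinf him 1 0
  · exact isBigO_zero _ _

theorem eventually_edge (hinf : Tendsto (fun k : ℂ => ‖k‖) l atTop)
    (him : ∀ᶠ k in l, 0 ≤ k.im) {c : ℝ} (hc : 0 < c) (hs : ∀ᶠ k in l, c ≤ ‖expSin k L‖) :
    ∀ᶠ k in l, k ≠ 0 ∧ expSin k L ≠ 0 ∧ edgeTau hL p k ≠ 0 := by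
  filter_upwards [eventually_regular hinf him 0, hs, eventually_edgeTau hL p hinf him hc hs]
    with k h1 h2 h3
  exact ⟨h1.1, norm_pos_iff.1 (hc.trans_le h2), norm_pos_iff.1 ((half_pos hc).trans_le h3)⟩

theorem tendsto_edgeM (hinf : Tendsto (fun k : ℂ => ‖k‖) l atTop)
    (him : ∀ᶠ k in l, 0 ≤ k.im) {c : ℝ} (hc : 0 < c) (hs : ∀ᶠ k in l, c ≤ ‖expSin k L‖)
    (i j : Fin 2) : Tendsto (fun k => edgeM hL p (k ^ 2) i j) l (𝓝 0) := by
  have h1 := ((tendsto_inv_mul_of_isBigO_one hinf (isBigO_edgeY hL p hinf him i j)).isBigO_one ℂ)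
  have h2 := isBigO_one_mul ((isBigO_edgeX hL him i j).add h1)
    (isBigO_inv_of_le (half_pos hc) (eventually_edgeTau hL p hinf him hc hs))
  refine (tendsto_inv_mul_of_isBigO_one hinf h2).congr' ?_
  filter_upwards [eventually_edge hL p hinf him hc hs] with k hk
  exact (edgeM_sq hL p hk.1 i j).symm

theorem isBigO_edgeM_sub (hinf : Tendsto (fun k : ℂ => ‖k‖) l atTop)
    (him : ∀ᶠ k in l, 0 ≤ k.im) {c : ℝ} (hc : 0 < c) (hs : ∀ᶠ k in l, c ≤ ‖expSin k L‖)
    (i j : Fin 2) :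
    (fun k => k ^ 2 * (edgeM hL p (k ^ 2) i j - edgeM hL 0 (k ^ 2) i j)) =O[l] (1 : ℂ → ℂ) := by
  have h1 := isBigO_one_mul (isBigO_edgeY hL p hinf him i j) (isBigO_expSin hL him)
  have h2 := isBigO_one_mul (isBigO_edgeX hL him i j) (isBigO_cosRem hL p hinf him 1 0)
  have h3 := isBigO_one_mul
    (isBigO_inv_of_le (half_pos hc) (eventually_edgeTau hL p hinf him hc hs))
    (isBigO_inv_of_le hc hs)
  refine (isBigO_one_mul (h1.add h2) h3).congr' ?_ EventuallyEq.rfl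
  filter_upwards [eventually_edge hL p hinf him hc hs] with k hk
  exact (edgeM_sub hL p hk.1 hk.2.1 hk.2.2 i j).symm

theorem tendsto_norm_of_im (hl : Tendsto Complex.im l atTop) :
    Tendsto (fun k : ℂ => ‖k‖) l atTop :=
  tendsto_atTop_mono (fun k => (le_abs_self _).trans (Complex.abs_im_le_norm k)) hl

theorem eventually_expSin (hL' : 0 < L) (hl : Tendsto Complex.im l atTop) :
    ∀ᶠ k in l, 1 / 4 ≤ ‖expSin k L‖ := by
  have h1 := (tendsto_expSin hl hL').norm
  have h2 : ‖Complex.I / 2‖ = 1 / 2 := by simp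
  rw [h2] at h1
  exact h1.eventually (le_mem_nhds (by norm_num))

theorem tendsto_edgeTau (hL' : 0 < L) (hl : Tendsto Complex.im l atTop) :
    Tendsto (edgeTau hL p) l (𝓝 (Complex.I / 2)) := by
  have h1 := tendsto_inv_mul_of_isBigO_one (tendsto_norm_of_im hl)
    (isBigO_cosRem hL p (tendsto_norm_of_im hl) (hl.eventually_ge_atTop 0) 1 0)
  have h2 := (tendsto_expSin hl hL').sub h1
  rwa [sub_zero] at h2

/-- Exact cancellation on the diagonal: with `Q = ∫ p`, the remainder times `i/2` tends to `-Q/8`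
and `cosRem` times `1/2` to `Q/8`. Off the diagonal the decaying factor `expk` suffices. This is why
the vertex conditions are invisible in the trace formula. -/
theorem tendsto_edgeM_sub [l.IsCountablyGenerated] (hL' : 0 < L)
    (hl : Tendsto Complex.im l atTop) (i j : Fin 2) :
    Tendsto (fun k => k ^ 2 * (edgeM hL p (k ^ 2) i j - edgeM hL 0 (k ^ 2) i j)) l (𝓝 0) := by
  have hinf := tendsto_norm_of_im hl
  have him : ∀ᶠ k in l, 0 ≤ k.im := hl.eventually_ge_atTop 0
  have hI : Complex.I / 2 ≠ 0 := by simp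
  have hB := tendsto_cosRem hL p 1 0 hl (x := L) ⟨hL, le_rfl⟩
  have hC := tendsto_cosRem hL p 0 1 hl (x := L) ⟨hL, le_rfl⟩
  have hA := tendsto_sinRem hL p 1 0 hl (x := L) ⟨hL, le_rfl⟩
  have hσ := tendsto_expSin hl hL'
  have hκ := tendsto_expCos hl hL'
  have he := tendsto_expk hl hL'
  have h3 := ((tendsto_edgeTau hL p hL' hl).inv₀ hI).mul (hσ.inv₀ hI)
  have h4 : Tendsto (fun k => edgeY hL p k i j * expSin k L +
      edgeX L k i j * cosRem hL p 1 0 k L) l (𝓝 0) := by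
    unfold edgeX edgeY
    split_ifs
    · refine ((hC.mul hσ).add (hκ.mul hB)).trans_eq ?_
      congr 1
      linear_combination (1 / 8 * ∫ t in (0 : ℝ)..L, p t) * Complex.I_sq
    · refine ((hA.mul hσ).add (hκ.mul hB)).trans_eq ?_
      congr 1
      linear_combination (1 / 8 * ∫ t in (0 : ℝ)..L, p t) * Complex.I_sq
    · simpa using he.mul hB
  have h5 := h4.mul h3
  rw [zero_mul] at h5
  refine h5.congr' ?_
  filter_upwards [eventually_edge hL p hinf him (by norm_num : (0 : ℝ) < 1 / 4)
    (eventually_expSin hL' hl)] with k hk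
  exact (edgeM_sub hL p hk.1 hk.2.1 hk.2.2 i j).symm

theorem isBigO_cosRem_div (hinf : Tendsto (fun k : ℂ => ‖k‖) l atTop)
    (him : ∀ᶠ k in l, 0 ≤ k.im) {c : ℝ} (hc : 0 < c) (hs : ∀ᶠ k in l, c ≤ ‖expSin k L‖) :
    (fun k => cosRem hL p 1 0 k L * (expSin k L)⁻¹) =O[l] (1 : ℂ → ℂ) :=
  isBigO_one_mul (isBigO_cosRem hL p hinf him 1 0) (isBigO_inv_of_le hc hs)

theorem tendsto_edgeDeriv_div (hinf : Tendsto (fun k : ℂ => ‖k‖) l atTop)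
    (him : ∀ᶠ k in l, 0 ≤ k.im) {c : ℝ} (hc : 0 < c) (hs : ∀ᶠ k in l, c ≤ ‖expSin k L‖) :
    Tendsto (fun k => edgeDeriv hL p (k ^ 2) / edgeDeriv hL 0 (k ^ 2)) l (𝓝 1) := by
  have h1 := (tendsto_inv_mul_of_isBigO_one hinf
    (isBigO_cosRem_div hL p hinf him hc hs)).neg.const_add 1
  rw [neg_zero, add_zero] at h1
  refine h1.congr' ?_
  filter_upwards [eventually_edge hL p hinf him hc hs] with k hk
  exact (edgeDeriv_div hL p hk.1 hk.2.1).symm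

/-- Second order expansion of `k² log (1 - b / k)` for bounded `b`. -/
theorem tendsto_sq_mul_log_sub (hinf : Tendsto (fun k : ℂ => ‖k‖) l atTop) {b : ℂ → ℂ}
    (hb : b =O[l] (1 : ℂ → ℂ)) :
    Tendsto (fun k => k ^ 2 * Complex.log (1 + -(k⁻¹ * b k)) + k * b k + b k ^ 2 / 2) l
      (𝓝 0) := by
  have h0 := (tendsto_inv_mul_of_isBigO_one hinf hb).neg
  rw [neg_zero] at h0
  have h1 := (Complex.log_sub_logTaylor_isBigO 2).comp_tendsto h0
  have hk0 : ∀ᶠ k in l, k ≠ 0 :=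
    (hinf.eventually_gt_atTop 0).mono fun k hk => norm_pos_iff.1 hk
  -- The Taylor error is cubic in `k⁻¹ b`, so after multiplication by `k²` one factor `k⁻¹` is left.
  have h2 : (fun k => k ^ 2 * (Complex.log (1 + -(k⁻¹ * b k)) -
      Complex.logTaylor 3 (-(k⁻¹ * b k)))) =O[l] fun k => k⁻¹ * (b k * (b k * b k)) := by
    have h3 := (isBigO_refl (fun k : ℂ => k ^ 2) l).mul h1
    refine h3.trans (IsBigO.of_bound 1 ?_)
    filter_upwards [hk0] with k hk
    rw [one_mul]
    refine le_of_eq ?_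
    have hk' : ‖k‖ ≠ 0 := norm_ne_zero_iff.2 hk
    simp only [Function.comp, norm_mul, norm_pow, norm_neg, norm_inv, Nat.reduceAdd, mul_pow,
      inv_pow]
    field_simp
  have h4 := tendsto_inv_mul_of_isBigO_one hinf (isBigO_one_mul hb (isBigO_one_mul hb hb))
  refine (h2.trans_tendsto h4).congr' ?_
  filter_upwards [hk0] with k hk
  have h5 : Complex.logTaylor 3 (-(k⁻¹ * b k)) = -(k⁻¹ * b k) - (k⁻¹ * b k) ^ 2 / 2 := by
    simp [Complex.logTaylor, Finset.sum_range_succ]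
    ring
  rw [h5]
  field_simp
  ring

/-- By definition of `secondRem`, `cosRem` is `(∫ p / 2) expCos` plus `k⁻¹ secondRem`. The added
cotangent therefore cancels the only unbounded part of the logarithm. -/
theorem edge_log_eq {k : ℂ} (hk : k ≠ 0) (hs : expSin k L ≠ 0) :
    k ^ 2 * Complex.log (edgeDeriv hL p (k ^ 2) / edgeDeriv hL 0 (k ^ 2)) +
      (∫ t in (0 : ℝ)..L, p t) / 2 * (k * (expCos k L * (expSin k L)⁻¹)) =
    (k ^ 2 * Complex.log (1 + -(k⁻¹ * (cosRem hL p 1 0 k L * (expSin k L)⁻¹))) +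
      k * (cosRem hL p 1 0 k L * (expSin k L)⁻¹) +
      (cosRem hL p 1 0 k L * (expSin k L)⁻¹) ^ 2 / 2) -
    (cosRem hL p 1 0 k L * (expSin k L)⁻¹) ^ 2 / 2 - secondRem hL p k * (expSin k L)⁻¹ := by
  rw [edgeDeriv_div hL p hk hs, secondRem]
  ring

theorem isBigO_edge_log (hinf : Tendsto (fun k : ℂ => ‖k‖) l atTop)
    (him : ∀ᶠ k in l, 0 ≤ k.im) {c : ℝ} (hc : 0 < c) (hs : ∀ᶠ k in l, c ≤ ‖expSin k L‖)
    {g : ℝ → ℂ} (hg : HasWeakDeriv L p g) :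
    (fun k => k ^ 2 * Complex.log (edgeDeriv hL p (k ^ 2) / edgeDeriv hL 0 (k ^ 2)) +
      (∫ t in (0 : ℝ)..L, p t) / 2 * (k * (expCos k L * (expSin k L)⁻¹)))
      =O[l] (1 : ℂ → ℂ) := by
  have hb := isBigO_cosRem_div hL p hinf him hc hs
  have h1 := (tendsto_sq_mul_log_sub hinf hb).isBigO_one ℂ
  have h2 := (isBigO_one_mul hb hb).const_mul_left (1 / 2)
  have h3 := isBigO_one_mul (isBigO_secondRem hL p hinf him hg) (isBigO_inv_of_le hc hs)
  refine ((h1.sub h2).sub h3).congr' ?_ EventuallyEq.rfl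
  filter_upwards [eventually_edge hL p hinf him hc hs] with k hk
  rw [edge_log_eq hL p hk.1 hk.2.1]
  ring

/-- The quadratic term of the logarithm contributes `(∫ p)² / 8`, and `secondRem` contributes `-(∫
p)² / 8`; only the endpoint values survive. -/
theorem tendsto_edge_log [l.IsCountablyGenerated] (hL' : 0 < L)
    (hl : Tendsto Complex.im l atTop) {g : ℝ → ℂ} (hg : HasWeakDeriv L p g) :
    Tendsto (fun k => k ^ 2 * Complex.log (edgeDeriv hL p (k ^ 2) / edgeDeriv hL 0 (k ^ 2)) +
      (∫ t in (0 : ℝ)..L, p t) / 2 * (k * (expCos k L * (expSin k L)⁻¹))) l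
      (𝓝 (-(p L + p 0) / 4)) := by
  have hinf := tendsto_norm_of_im hl
  have him : ∀ᶠ k in l, 0 ≤ k.im := hl.eventually_ge_atTop 0
  have hI : Complex.I / 2 ≠ 0 := by simp
  have hc : (0 : ℝ) < 1 / 4 := by norm_num
  have hs := eventually_expSin hL' hl
  have hb := isBigO_cosRem_div hL p hinf him hc hs
  have hσ := (tendsto_expSin hl hL').inv₀ hI
  have h1 := tendsto_sq_mul_log_sub hinf hb
  have h2 := (((tendsto_cosRem hL p 1 0 hl (x := L) ⟨hL, le_rfl⟩).mul hσ).pow 2).div_const 2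
  have h3 := (tendsto_secondRem hL p hL' hl hg).mul hσ
  refine (((h1.sub h2).sub h3).congr' ?_).trans_eq ?_
  · filter_upwards [eventually_edge hL p hinf him hc hs] with k hk
    exact (edge_log_eq hL p hk.1 hk.2.1).symm
  · congr 1
    rw [inv_div]
    field_simp
    rw [Complex.I_sq]
    ring

end Edge

end QuantumGraph

end

noncomputable section

namespace QuantumGraph

/-! ### The order of vanishing of a determinant -/

/-- A basis of `n → ℂ` adapted to a subspace, indexed by `n`. -/
theorem exists_adapted_basis {n : Type*} [Fintype n] [DecidableEq n] (K : Submodule ℂ (n → ℂ)) :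
    ∃ (b : Module.Basis n ℂ (n → ℂ)) (J : Finset n), J.card = Module.finrank ℂ K ∧
      (∀ j ∈ J, b j ∈ K) ∧ ∀ x : n → ℂ, (∀ j ∈ J, x j = 0) → (∑ j, x j • b j) ∈ K → x = 0 := by
  obtain ⟨K', hK'⟩ := K.exists_isCompl
  let b₁ := Module.finBasis ℂ K
  let b₂ := Module.finBasis ℂ K'
  let b₀ := (b₁.prod b₂).map (Submodule.prodEquivOfIsCompl K K' hK')
  have hcard : Fintype.card (Fin (Module.finrank ℂ K) ⊕ Fin (Module.finrank ℂ K')) =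
      Fintype.card n := by
    rw [← Module.finrank_eq_card_basis b₀, Module.finrank_fintype_fun_eq_card]
  let e := Fintype.equivOfCardEq hcard
  let b := b₀.reindex e
  have hl : ∀ j, b (e (Sum.inl j)) = b₁ j := fun j => by simp [b, b₀]
  have hr : ∀ j, b (e (Sum.inr j)) = b₂ j := fun j => by simp [b, b₀]
  refine ⟨b, Finset.univ.map (Function.Embedding.inl.trans e.toEmbedding), by simp, ?_, ?_⟩
  · intro j hj
    simp only [Finset.mem_map, Finset.mem_univ, true_and] at hj
    obtain ⟨i, rfl⟩ := hj
    have := hl i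
    simp only [Function.Embedding.trans_apply, Function.Embedding.inl_apply,
      Equiv.coe_toEmbedding]
    rw [this]
    exact (b₁ i).2
  · intro x hx hmem
    have hx1 : ∀ i, x (e (Sum.inl i)) = 0 := fun i => hx _ (by simp)
    have hsum : ∑ j, x j • b j = ∑ i, x (e (Sum.inr i)) • (b₂ i : n → ℂ) := by
      rw [← e.sum_comp, Fintype.sum_sum_type]
      simp [hx1, hr]
    have h0 : ∑ j, x j • b j = 0 := by
      have h2 : (∑ j, x j • b j) ∈ K' := by
        rw [hsum]
        exact K'.sum_mem fun i _ => K'.smul_mem _ (b₂ i).2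
      exact (Submodule.disjoint_def.1 hK'.disjoint) _ hmem h2
    funext j
    exact Fintype.linearIndependent_iff.1 b.linearIndependent x h0 j

theorem differentiable_det {n : Type*} [Fintype n] [DecidableEq n] {B : ℂ → Matrix n n ℂ}
    (hB : ∀ i j, Differentiable ℂ fun z => B z i j) : Differentiable ℂ fun z => (B z).det := by
  simp only [Matrix.det_apply]
  refine Differentiable.fun_sum fun τ _ => ?_
  refine Differentiable.const_smul ?_ _
  exact Differentiable.fun_finsetProd fun i _ => hB _ _

/-- If no nonzero vector of `ker B(z₀)` is mapped by `B'(z₀)` into the range of `B(z₀)`, then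
`det B` vanishes at `z₀` exactly to the order `dim ker B(z₀)`. -/
theorem analyticOrderAt_det {n : Type*} [Fintype n] [DecidableEq n] {B : ℂ → Matrix n n ℂ}
    (hB : ∀ i j, Differentiable ℂ fun z => B z i j) (z₀ : ℂ)
    (hker : ∀ v u : n → ℂ, B z₀ *ᵥ v = 0 →
      (fun i => deriv (fun z => (B z *ᵥ v) i) z₀) = B z₀ *ᵥ u → v = 0) :
    analyticOrderAt (fun z => (B z).det) z₀ =
      Module.finrank ℂ (LinearMap.ker (Matrix.toLin' (B z₀))) := by
  obtain ⟨b, J, hJ, hbK, hb⟩ := exists_adapted_basis (LinearMap.ker (Matrix.toLin' (B z₀)))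
  have hbK' : ∀ j ∈ J, B z₀ *ᵥ b j = 0 := fun j hj => by
    simpa [Matrix.toLin'_apply] using hbK j hj
  let F : n → n → ℂ → ℂ := fun i j z => (B z *ᵥ b j) i
  have hF : ∀ i j, Differentiable ℂ (F i j) := fun i j => by
    simp only [F, Matrix.mulVec, dotProduct]
    exact Differentiable.fun_sum fun m _ => (hB i m).mul_const _
  -- In the adapted basis the columns belonging to the kernel vanish at `z₀`, and a factor `z - z₀`
  -- is taken out of each. At `z₀` such a column of `C` becomes `B'(z₀) b j`.
  let C : ℂ → Matrix n n ℂ := fun z => Matrix.of fun i j =>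
    if j ∈ J then dslope (F i j) z₀ z else F i j z
  have hC : ∀ i j, Differentiable ℂ fun z => C z i j := fun i j => by
    simp only [C, Matrix.of_apply]
    split_ifs
    · rw [← differentiableOn_univ, Complex.differentiableOn_dslope univ_mem]
      exact (hF i j).differentiableOn
    · exact hF i j
  let P : Matrix n n ℂ := Matrix.of fun i j => b j i
  have hBP : ∀ z, B z * P = Matrix.of fun i j => (if j ∈ J then z - z₀ else 1) * C z i j := by
    intro z
    ext i j
    have h1 : (B z * P) i j = F i j z := rfl
    rw [h1]
    simp only [C, Matrix.of_apply]
    split_ifs with hj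
    · have h2 := sub_smul_dslope (F i j) z₀ z
      have h3 : F i j z₀ = 0 := congrFun (hbK' j hj) i
      rw [h3, sub_zero, smul_eq_mul] at h2
      exact h2.symm
    · simp
  have hdet : ∀ z, (B z).det * P.det = (z - z₀) ^ J.card * (C z).det := by
    intro z
    rw [← Matrix.det_mul, hBP, Matrix.det_mul_row, Finset.prod_ite_mem, Finset.univ_inter,
      Finset.prod_const]
  have hPdet : P.det ≠ 0 := by
    intro h0
    obtain ⟨x, hx, hPx⟩ := Matrix.exists_mulVec_eq_zero_iff.2 h0
    refine hx (funext fun j => ?_)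
    refine Fintype.linearIndependent_iff.1 b.linearIndependent x ?_ j
    funext i
    have h2 := congrFun hPx i
    simp only [Matrix.mulVec, dotProduct, P, Matrix.of_apply] at h2
    simpa [Finset.sum_apply, mul_comm] using h2
  -- A null vector of `C z₀` has a kernel part `v` and a complementary part `u` with `B'(z₀) v =
  -- -B(z₀) u`. The hypothesis gives `v = 0`; then `u` lies in both the kernel and its complement,
  -- so it vanishes too.
  have hCdet : (C z₀).det ≠ 0 := by
    intro h0
    obtain ⟨x, hx, hCx⟩ := Matrix.exists_mulVec_eq_zero_iff.2 h0
    set v : n → ℂ := ∑ j, (if j ∈ J then x j else 0) • b j with hv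
    set u : n → ℂ := ∑ j, (if j ∈ J then 0 else x j) • b j with hu
    have hBv : B z₀ *ᵥ v = 0 := by
      rw [hv, Matrix.mulVec_sum]
      refine Finset.sum_eq_zero fun j _ => ?_
      rw [Matrix.mulVec_smul]
      split_ifs with hj
      · rw [hbK' j hj, smul_zero]
      · rw [zero_smul]
    have hder : (fun i => deriv (fun z => (B z *ᵥ v) i) z₀) = B z₀ *ᵥ (-u) := by
      funext i
      have h1 : (fun z => (B z *ᵥ v) i) = fun z => ∑ j, (if j ∈ J then x j else 0) * F i j z := by
        funext z
        rw [hv, Matrix.mulVec_sum]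
        simp only [F, Finset.sum_apply, Matrix.mulVec_smul, Pi.smul_apply, smul_eq_mul]
      have h2 : (B z₀ *ᵥ u) i = ∑ j, (if j ∈ J then 0 else x j) * F i j z₀ := by
        rw [hu, Matrix.mulVec_sum]
        simp only [F, Finset.sum_apply, Matrix.mulVec_smul, Pi.smul_apply, smul_eq_mul]
      have h3 := congrFun hCx i
      simp only [Matrix.mulVec, dotProduct, C, Matrix.of_apply, Pi.zero_apply] at h3
      rw [h1, deriv_fun_sum fun j _ => ((hF i j) z₀).const_mul _, Matrix.mulVec_neg, Pi.neg_apply,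
        h2, eq_neg_iff_add_eq_zero, ← Finset.sum_add_distrib]
      refine Eq.trans ?_ h3
      refine Finset.sum_congr rfl fun j _ => ?_
      rw [deriv_const_mul _ ((hF i j) z₀)]
      split_ifs
      · rw [dslope_same]; ring
      · ring
    have hv0 := hker v (-u) hBv hder
    have hx1 : ∀ j ∈ J, x j = 0 := by
      intro j hj
      have := Fintype.linearIndependent_iff.1 b.linearIndependent _ (hv.symm.trans hv0) j
      simpa [hj] using this
    have hBu : B z₀ *ᵥ u = 0 := by
      have h5 : (fun i => deriv (fun z => (B z *ᵥ v) i) z₀) = 0 := by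
        rw [hv0]
        funext i
        simp
      rw [h5, Matrix.mulVec_neg] at hder
      exact neg_eq_zero.1 hder.symm
    refine hx (hb x hx1 ?_)
    have h6 : ∑ j, x j • b j = u := by
      rw [hu]
      refine Finset.sum_congr rfl fun j _ => ?_
      split_ifs with hj
      · rw [hx1 j hj]
      · rfl
    rw [h6, LinearMap.mem_ker, Matrix.toLin'_apply, hBu]
  rw [← hJ]
  have hA : AnalyticAt ℂ (fun z => (B z).det) z₀ := (differentiable_det hB).analyticAt z₀
  rw [hA.analyticOrderAt_eq_natCast]
  refine ⟨fun z => (C z).det / P.det, ?_, div_ne_zero hCdet hPdet, Eventually.of_forall fun z => ?_⟩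
  · exact ((differentiable_det hC).div_const _).analyticAt z₀
  · rw [smul_eq_mul, ← mul_div_assoc, ← hdet]
    field_simp

end QuantumGraph

end

noncomputable section

namespace QuantumGraph

open scoped BoundedContinuousFunction

/-! ### Block diagonal matrices over the edges and the secular matrix -/

/-- The block diagonal matrix with one `2 × 2` block for each edge. -/
def blk {d : ℕ} (F : Fin d → Matrix (Fin 2) (Fin 2) ℂ) : Matrix (Ends d) (Ends d) ℂ :=
  fun e e' => if e.1 = e'.1 then F e.1 e.2 e'.2 else 0

theorem blk_eq {d : ℕ} (F : Fin d → Matrix (Fin 2) (Fin 2) ℂ) :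
    blk F = (Matrix.blockDiagonal F).submatrix Prod.swap Prod.swap := by
  ext e e'
  simp [blk, Matrix.blockDiagonal_apply]

theorem det_blk {d : ℕ} (F : Fin d → Matrix (Fin 2) (Fin 2) ℂ) :
    (blk F).det = ∏ i, (F i).det := by
  rw [blk_eq, ← Matrix.det_blockDiagonal]
  exact Matrix.det_submatrix_equiv_self (Equiv.prodComm (Fin d) (Fin 2)) _

theorem blk_mul {d : ℕ} (F G : Fin d → Matrix (Fin 2) (Fin 2) ℂ) :
    blk F * blk G = blk fun i => F i * G i := by
  ext e e'
  simp only [Matrix.mul_apply, blk, Fintype.sum_prod_type]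
  rw [Finset.sum_eq_single e.1]
  · by_cases h : e.1 = e'.1 <;> simp [h]
  · intro i _ hi
    simp [hi.symm]
  · simp

theorem blk_mulVec {d : ℕ} (F : Fin d → Matrix (Fin 2) (Fin 2) ℂ) (v : Ends d → ℂ) (e : Ends d) :
    (blk F *ᵥ v) e = F e.1 e.2 0 * v (e.1, 0) + F e.1 e.2 1 * v (e.1, 1) := by
  simp only [Matrix.mulVec, dotProduct, blk, Fintype.sum_prod_type]
  rw [Finset.sum_eq_single e.1]
  · simp [Fin.sum_univ_two]
  · intro i _ hi
    simp [hi.symm]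
  · simp

section Graph

variable {d : ℕ} {ℓ : Fin d → ℝ} (hℓ : ∀ i, 0 < ℓ i) (p : Fin d → ℝ →ᵇ ℂ)

/-- The edgewise solution at energy `z` with initial data `v`. -/
def graphSol (z : ℂ) (v : Ends d → ℂ) (i : Fin d) : ℝ →ᵇ ℂ :=
  sol (hℓ i).le (p i - z • 1) (v (i, 0)) (v (i, 1))

/-- The derivative of the edgewise solution at energy `z` with initial data `v`. -/
def graphDeriv (z : ℂ) (v : Ends d → ℂ) (i : Fin d) : ℝ →ᵇ ℂ :=
  solDeriv (hℓ i).le (p i - z • 1) (v (i, 0)) (v (i, 1))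

/-- The boundary values of the fundamental solutions on the edge `i`. -/
def edgeVal (z : ℂ) (i : Fin d) : Matrix (Fin 2) (Fin 2) ℂ :=
  !![1, 0; sol (hℓ i).le (p i - z • 1) 1 0 (ℓ i), sol (hℓ i).le (p i - z • 1) 0 1 (ℓ i)]

/-- The inward boundary derivatives of the fundamental solutions on the edge `i`. -/
def edgeDer (z : ℂ) (i : Fin d) : Matrix (Fin 2) (Fin 2) ℂ :=
  !![0, 1; -solDeriv (hℓ i).le (p i - z • 1) 1 0 (ℓ i),
    -solDeriv (hℓ i).le (p i - z • 1) 0 1 (ℓ i)]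

theorem sol_decomp {L : ℝ} (hL : 0 ≤ L) (w : ℝ →ᵇ ℂ) (a b : ℂ) (x : ℝ) :
    sol hL w a b x = sol hL w 1 0 x * a + sol hL w 0 1 x * b := by
  have h1 := sol_add hL w (a * 1) (a * 0) (b * 0) (b * 1)
  rw [sol_smul, sol_smul] at h1
  simp only [mul_one, mul_zero, add_zero, zero_add] at h1
  rw [h1]
  simp [mul_comm]

theorem solDeriv_decomp {L : ℝ} (hL : 0 ≤ L) (w : ℝ →ᵇ ℂ) (a b : ℂ) (x : ℝ) :
    solDeriv hL w a b x = solDeriv hL w 1 0 x * a + solDeriv hL w 0 1 x * b := by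
  have h1 := solDeriv_add hL w (a * 1) (a * 0) (b * 0) (b * 1)
  rw [solDeriv_smul, solDeriv_smul] at h1
  simp only [mul_one, mul_zero, add_zero, zero_add] at h1
  rw [h1]
  simp [mul_comm]

theorem boundaryValues_graphSol (z : ℂ) (v : Ends d → ℂ) :
    boundaryValues ℓ (fun i => graphSol hℓ p z v i) = blk (edgeVal hℓ p z) *ᵥ v := by
  funext ⟨i, a⟩
  rw [blk_mulVec]
  fin_cases a
  · simp [boundaryValues, graphSol, edgeVal, sol_zero_right]
  · simp only [boundaryValues, graphSol, edgeVal]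
    simp
    exact sol_decomp _ _ _ _ _

theorem boundaryDerivs_graphDeriv (z : ℂ) (v : Ends d → ℂ) :
    boundaryDerivs ℓ (fun i => graphDeriv hℓ p z v i) = blk (edgeDer hℓ p z) *ᵥ v := by
  funext ⟨i, a⟩
  rw [blk_mulVec]
  fin_cases a
  · simp [boundaryDerivs, graphDeriv, edgeDer, solDeriv_zero_right]
  · simp only [boundaryDerivs, graphDeriv, edgeDer]
    simp
    rw [solDeriv_decomp]
    ring

/-- The secular matrix: its kernel consists of the initial data of the eigenfunctions for the
coupling `Ψ' = A Ψ`. -/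
def secMatrix (A : Matrix (Ends d) (Ends d) ℂ) (z : ℂ) : Matrix (Ends d) (Ends d) ℂ :=
  blk (edgeDer hℓ p z) - A * blk (edgeVal hℓ p z)

theorem secMatrix_mulVec (A : Matrix (Ends d) (Ends d) ℂ) (z : ℂ) (v : Ends d → ℂ) :
    secMatrix hℓ p A z *ᵥ v = boundaryDerivs ℓ (fun i => graphDeriv hℓ p z v i) -
      A *ᵥ boundaryValues ℓ (fun i => graphSol hℓ p z v i) := by
  rw [boundaryValues_graphSol, boundaryDerivs_graphDeriv, secMatrix, Matrix.sub_mulVec,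
    Matrix.mulVec_mulVec]

theorem differentiable_edgeVal (i : Fin d) (a b : Fin 2) :
    Differentiable ℂ fun z => edgeVal hℓ p z i a b := by
  fin_cases a <;> fin_cases b <;>
    simp [edgeVal, differentiable_sol_apply]

theorem differentiable_edgeDer (i : Fin d) (a b : Fin 2) :
    Differentiable ℂ fun z => edgeDer hℓ p z i a b := by
  fin_cases a <;> fin_cases b <;> simp [edgeDer, differentiable_solDeriv_apply]

theorem differentiable_secMatrix (A : Matrix (Ends d) (Ends d) ℂ) (e e' : Ends d) :
    Differentiable ℂ fun z => secMatrix hℓ p A z e e' := by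
  have hb : ∀ {F : ℂ → Fin d → Matrix (Fin 2) (Fin 2) ℂ},
      (∀ i a b, Differentiable ℂ fun z => F z i a b) →
      ∀ e e', Differentiable ℂ fun z => blk (F z) e e' := by
    intro F hF e e'
    by_cases h : e.1 = e'.1
    · simpa [blk, h] using hF e'.1 e.2 e'.2
    · simp [blk, h]
  simp only [secMatrix, Matrix.sub_apply, Matrix.mul_apply]
  refine (hb (differentiable_edgeDer hℓ p) e e').sub (Differentiable.fun_sum fun e'' _ => ?_)
  exact (hb (differentiable_edgeVal hℓ p) e'' e').const_mul _

/-- The secular function. -/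
def secFun (A : Matrix (Ends d) (Ends d) ℂ) (z : ℂ) : ℂ := (secMatrix hℓ p A z).det

theorem differentiable_secFun (A : Matrix (Ends d) (Ends d) ℂ) :
    Differentiable ℂ (secFun hℓ p A) :=
  differentiable_det (differentiable_secMatrix hℓ p A)

theorem wronskian {L : ℝ} (hL : 0 ≤ L) (w : ℝ →ᵇ ℂ) :
    sol hL w 1 0 L * solDeriv hL w 0 1 L - solDeriv hL w 1 0 L * sol hL w 0 1 L = 1 := by
  have h := (isSol_sol hL w 1 0).green hL (isSol_sol hL w 0 1)
  simp only [sub_self, zero_mul, intervalIntegral.integral_zero, sol_zero_right,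
    solDeriv_zero_right] at h
  linear_combination h

/-- The Neumann-to-Dirichlet matrix of the decoupled edges. -/
def ndMatrix (z : ℂ) : Matrix (Ends d) (Ends d) ℂ :=
  blk fun i => Matrix.of (edgeM (hℓ i).le (p i) z)

/-- The Wronskian identity shows that `ndMatrix` carries inward derivatives to values, so the
secular matrix is `(1 - A M)` times the block matrix of derivatives. The block of an edge has
determinant `edgeDeriv`. -/
theorem secFun_eq (A : Matrix (Ends d) (Ends d) ℂ) {z : ℂ}
    (hz : ∀ i, edgeDeriv (hℓ i).le (p i) z ≠ 0) :
    secFun hℓ p A z = (1 - A * ndMatrix hℓ p z).det * ∏ i, edgeDeriv (hℓ i).le (p i) z := by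
  have h1 : ∀ i, Matrix.of (edgeM (hℓ i).le (p i) z) * edgeDer hℓ p z i = edgeVal hℓ p z i := by
    intro i
    have hw := wronskian (hℓ i).le (p i - z • 1)
    have hi := hz i
    ext a b
    fin_cases a <;> fin_cases b <;>
      simp [Matrix.mul_apply, Fin.sum_univ_two, edgeM, edgeDer, edgeVal, edgeDeriv]
        at hi hw ⊢ <;>
      field_simp <;> first | ring1 | linear_combination hw
  have h2 : ndMatrix hℓ p z * blk (edgeDer hℓ p z) = blk (edgeVal hℓ p z) := by
    rw [ndMatrix, blk_mul]
    congr 1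
    funext i
    exact h1 i
  have h3 : secMatrix hℓ p A z = (1 - A * ndMatrix hℓ p z) * blk (edgeDer hℓ p z) := by
    rw [secMatrix, Matrix.sub_mul, Matrix.one_mul, Matrix.mul_assoc, h2]
  rw [secFun, h3, Matrix.det_mul, det_blk]
  congr 1
  refine Finset.prod_congr rfl fun i _ => ?_
  simp [edgeDer, Matrix.det_fin_two, edgeDeriv]

end Graph

end QuantumGraph

end

noncomputable section

namespace QuantumGraph

open scoped BoundedContinuousFunction

/-! ### Multiplicities -/

theorem sol_eq_zero_of_ae {L : ℝ} (hL : 0 < L) {w : ℝ →ᵇ ℂ} {a b : ℂ}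
    (h : sol hL.le w a b =ᵐ[volume.restrict (Set.Ioo 0 L)] 0) : a = 0 ∧ b = 0 := by
  have h1 : Set.EqOn (sol hL.le w a b) 0 (Set.Ioo 0 L) :=
    Measure.eqOn_open_of_ae_eq h isOpen_Ioo (BoundedContinuousFunction.continuous _).continuousOn
      continuousOn_const
  have h2 : Set.EqOn (solDeriv hL.le w a b) 0 (Set.Ioo 0 L) := by
    intro x hx
    have h3 := (isSol_sol hL.le w a b).deriv_one x hx
    have h4 : HasDerivAt (sol hL.le w a b) 0 x := by
      refine (hasDerivAt_const x (0 : ℂ)).congr_of_eventuallyEq ?_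
      filter_upwards [isOpen_Ioo.mem_nhds hx] with t ht using h1 ht
    exact h3.unique h4
  have h0 : (0 : ℝ) ∈ closure (Set.Ioo 0 L) := by
    rw [closure_Ioo hL.ne]
    exact ⟨le_rfl, hL.le⟩
  have h5 := h1.closure (BoundedContinuousFunction.continuous _) continuous_const h0
  have h6 := h2.closure (BoundedContinuousFunction.continuous _) continuous_const h0
  rw [sol_zero_right] at h5
  rw [solDeriv_zero_right] at h6
  exact ⟨h5, h6⟩

section Graph

variable {d : ℕ} {ℓ : Fin d → ℝ} (hℓ : ∀ i, 0 < ℓ i) (p : Fin d → ℝ →ᵇ ℂ)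

/-- The `L²` pairing of two edgewise solutions. -/
def solPairing (z₀ : ℂ) (v : Ends d → ℂ) (z : ℂ) (u : Ends d → ℂ) : ℂ :=
  ∑ i, ∫ x in (0 : ℝ)..ℓ i, starRingEnd ℂ (graphSol hℓ p z₀ v i x) * graphSol hℓ p z u i x

/-- For a real potential, conjugation turns a solution at `z₀` into one at the conjugate energy.
Derivatives directed into the edge absorb the signs at the two ends in Green's identity. -/
theorem green_graph (hp : ∀ i x, starRingEnd ℂ (p i x) = p i x) (z₀ z : ℂ) (v u : Ends d → ℂ) :
    star (boundaryValues ℓ fun i => graphSol hℓ p z₀ v i) ⬝ᵥ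
        (boundaryDerivs ℓ fun i => graphDeriv hℓ p z u i) -
      star (boundaryDerivs ℓ fun i => graphDeriv hℓ p z₀ v i) ⬝ᵥ
        (boundaryValues ℓ fun i => graphSol hℓ p z u i) =
    (z - starRingEnd ℂ z₀) * solPairing hℓ p z₀ v z u := by
  rw [solPairing, Finset.mul_sum]
  simp only [dotProduct, Fintype.sum_prod_type, Fin.sum_univ_two]
  rw [← Finset.sum_sub_distrib]
  refine Finset.sum_congr rfl fun i _ => ?_
  have h := (isSol_sol (hℓ i).le (p i - z₀ • 1) (v (i, 0)) (v (i, 1))).conj.green (hℓ i).le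
    (isSol_sol (hℓ i).le (p i - z • 1) (u (i, 0)) (u (i, 1)))
  rw [eq_comm]
  refine Eq.trans ?_ (h.trans ?_)
  · rw [← intervalIntegral.integral_const_mul]
    refine intervalIntegral.integral_congr fun x _ => ?_
    simp [graphSol, hp]
  · simp [boundaryValues, boundaryDerivs, graphSol, graphDeriv]
    ring

theorem eq_zero_of_solPairing_self (z : ℂ) (v : Ends d → ℂ) (h : solPairing hℓ p z v z v = 0) :
    v = 0 := by
  have h1 : ∀ i, (∫ x in (0 : ℝ)..ℓ i,
      starRingEnd ℂ (graphSol hℓ p z v i x) * graphSol hℓ p z v i x) =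
      ((∫ x in (0 : ℝ)..ℓ i, ‖graphSol hℓ p z v i x‖ ^ 2 : ℝ) : ℂ) := by
    intro i
    rw [← intervalIntegral.integral_ofReal]
    refine intervalIntegral.integral_congr fun x _ => ?_
    simp only [Complex.conj_mul', Complex.ofReal_pow]
  rw [solPairing, Finset.sum_congr rfl fun i _ => h1 i, ← Complex.ofReal_sum,
    Complex.ofReal_eq_zero, Finset.sum_eq_zero_iff_of_nonneg fun i _ =>
      intervalIntegral.integral_nonneg (hℓ i).le fun x _ => by positivity] at h
  have h2 : ∀ i, v (i, 0) = 0 ∧ v (i, 1) = 0 := by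
    intro i
    refine sol_eq_zero_of_ae (hℓ i) (w := p i - z • 1) ?_
    have h3 := h i (Finset.mem_univ i)
    rw [intervalIntegral.integral_of_le (hℓ i).le, integral_Ioc_eq_integral_Ioo,
      integral_eq_zero_iff_of_nonneg (fun x => by positivity)] at h3
    · filter_upwards [h3] with x hx
      simpa [graphSol] using hx
    · have hc : Continuous fun x => ‖graphSol hℓ p z v i x‖ ^ 2 :=
        (BoundedContinuousFunction.continuous _).norm.pow 2
      exact (hc.integrableOn_Icc (a := 0) (b := ℓ i)).mono_set Set.Ioo_subset_Icc_self
  funext ⟨i, a⟩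
  fin_cases a
  · exact (h2 i).1
  · exact (h2 i).2

theorem star_mulVec_dotProduct {A : Matrix (Ends d) (Ends d) ℂ} (hA : A.IsHermitian)
    (x y : Ends d → ℂ) : star (A *ᵥ x) ⬝ᵥ y = star x ⬝ᵥ (A *ᵥ y) := by
  rw [Matrix.star_mulVec, hA.eq, Matrix.dotProduct_mulVec]

/-- Since `A` is Hermitian and `v` satisfies the coupling, the terms with `A` cancel in Green's
identity. Taking `z = z₀` gives the reality of the eigenvalues; differentiating in `z` gives the
order of the zeros. -/
theorem star_dotProduct_secMatrix (hp : ∀ i x, starRingEnd ℂ (p i x) = p i x)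
    {A : Matrix (Ends d) (Ends d) ℂ} (hA : A.IsHermitian) {z₀ : ℂ} {v : Ends d → ℂ}
    (hv : secMatrix hℓ p A z₀ *ᵥ v = 0) (z : ℂ) (u : Ends d → ℂ) :
    star (boundaryValues ℓ fun i => graphSol hℓ p z₀ v i) ⬝ᵥ (secMatrix hℓ p A z *ᵥ u) =
      (z - starRingEnd ℂ z₀) * solPairing hℓ p z₀ v z u := by
  rw [← green_graph hℓ p hp, secMatrix_mulVec, dotProduct_sub]
  rw [secMatrix_mulVec, sub_eq_zero] at hv
  rw [hv, star_mulVec_dotProduct hA]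

theorem secMatrix_injective (hp : ∀ i x, starRingEnd ℂ (p i x) = p i x)
    {A : Matrix (Ends d) (Ends d) ℂ} (hA : A.IsHermitian) {z : ℂ} (hz : z.im ≠ 0)
    {v : Ends d → ℂ} (hv : secMatrix hℓ p A z *ᵥ v = 0) : v = 0 := by
  have h := star_dotProduct_secMatrix hℓ p hp hA hv z v
  rw [hv, dotProduct_zero] at h
  rcases mul_eq_zero.1 h.symm with h | h
  · exact absurd (Complex.conj_eq_iff_im.1 (sub_eq_zero.1 h).symm) hz
  · exact eq_zero_of_solPairing_self hℓ p z v h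

theorem continuous_solPairing (z₀ : ℂ) (v u : Ends d → ℂ) :
    Continuous fun z => solPairing hℓ p z₀ v z u := by
  unfold solPairing
  refine continuous_finsetSum _ fun i _ => ?_
  have h1 : ∀ z, (∫ x in (0 : ℝ)..ℓ i,
      starRingEnd ℂ (graphSol hℓ p z₀ v i x) * graphSol hℓ p z u i x) =
      volterra (hℓ i).le (star (graphSol hℓ p z₀ v i) * graphSol hℓ p z u i) (ℓ i) := by
    intro z
    rw [volterra_apply_of_mem _ _ ⟨(hℓ i).le, le_rfl⟩]
    rfl
  simp only [h1]
  have h2 : Continuous fun z => graphSol hℓ p z u i :=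
    (differentiable_sol (hℓ i).le (p i) (u (i, 0)) (u (i, 1))).continuous
  exact Continuous.comp (g := fun y : ℝ →ᵇ ℂ => y (ℓ i))
    (BoundedContinuousFunction.evalCLM ℂ (ℓ i) : (ℝ →ᵇ ℂ) →L[ℂ] ℂ).continuous
    ((volterra (hℓ i).le).continuous.comp (continuous_const.mul h2))

/-- The order of the zeros of the secular function is the dimension of the kernel of the secular
matrix. -/
theorem analyticOrderAt_secFun (hp : ∀ i x, starRingEnd ℂ (p i x) = p i x)
    {A : Matrix (Ends d) (Ends d) ℂ} (hA : A.IsHermitian) (z : ℂ) :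
    analyticOrderAt (secFun hℓ p A) z =
      Module.finrank ℂ (LinearMap.ker (Matrix.toLin' (secMatrix hℓ p A z))) := by
  refine analyticOrderAt_det (differentiable_secMatrix hℓ p A) z fun v u hv hu => ?_
  by_cases hz : z.im = 0
  swap
  · exact secMatrix_injective hℓ p hp hA hz hv
  have hzr : starRingEnd ℂ z = z := Complex.conj_eq_iff_im.2 hz
  set Ψ := boundaryValues ℓ fun i => graphSol hℓ p z v i with hΨ
  have hdiff : ∀ e, DifferentiableAt ℂ (fun z => (secMatrix hℓ p A z *ᵥ v) e) z := fun e => by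
    simp only [Matrix.mulVec, dotProduct]
    exact DifferentiableAt.fun_sum fun e' _ =>
      ((differentiable_secMatrix hℓ p A e e') z).mul_const _
  -- The pairing of `Ψ` with `B(w) v` is differentiated twice over. By Green's identity the
  -- derivative at the real point `z` is the squared norm of the eigenfunction; if `B'(z) v = B(z)
  -- u`, it equals the pairing of `Ψ` with `B(z) u`, which is zero. Hence `v = 0`.
  have h1 : HasDerivAt (fun w => star Ψ ⬝ᵥ (secMatrix hℓ p A w *ᵥ v))
      (star Ψ ⬝ᵥ fun e => deriv (fun w => (secMatrix hℓ p A w *ᵥ v) e) z) z := by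
    simp only [dotProduct]
    exact HasDerivAt.fun_sum fun e _ => (hdiff e).hasDerivAt.const_mul _
  have h2 : HasDerivAt (fun w => star Ψ ⬝ᵥ (secMatrix hℓ p A w *ᵥ v))
      (solPairing hℓ p z v z v) z := by
    rw [hasDerivAt_iff_tendsto_slope]
    have h3 := ((continuous_solPairing hℓ p z v v).tendsto z).mono_left
      (nhdsWithin_le_nhds (s := {z}ᶜ))
    refine h3.congr' ?_
    filter_upwards [self_mem_nhdsWithin] with w hw
    have hne : w - z ≠ 0 := sub_ne_zero.2 hw
    rw [slope_def_field, star_dotProduct_secMatrix hℓ p hp hA hv, hv, dotProduct_zero, hzr,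
      sub_zero]
    field_simp
  have h4 := h1.unique h2
  rw [hu, star_dotProduct_secMatrix hℓ p hp hA hv, hzr, sub_self, zero_mul] at h4
  exact eq_zero_of_solPairing_self hℓ p z v h4.symm

end Graph

end QuantumGraph

end

noncomputable section

namespace QuantumGraph

open scoped BoundedContinuousFunction

/-! ### Eigenspaces -/

/-- The Hermitian matrix `A` for which the coupling condition reads `Ψ' = A Ψ`. -/
def couplingMatrix {d : ℕ} (U : Matrix (Ends d) (Ends d) ℂ) : Matrix (Ends d) (Ends d) ℂ :=
  Complex.I • ((U + 1)⁻¹ * (U - 1))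

theorem isUnit_det_add_one {d : ℕ} {U : Matrix (Ends d) (Ends d) ℂ}
    (hU' : (-1 : ℂ) ∉ spectrum ℂ U) : IsUnit (U + 1).det := by
  rw [spectrum.notMem_iff] at hU'
  have h1 : (algebraMap ℂ (Matrix (Ends d) (Ends d) ℂ)) (-1) - U = -(U + 1) := by
    rw [map_neg, map_one]; abel
  rw [h1, IsUnit.neg_iff] at hU'
  exact (Matrix.isUnit_iff_isUnit_det _).1 hU'

theorem isHermitian_couplingMatrix {d : ℕ} {U : Matrix (Ends d) (Ends d) ℂ}
    (hU : U ∈ Matrix.unitaryGroup (Ends d) ℂ) (hU' : (-1 : ℂ) ∉ spectrum ℂ U) :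
    (couplingMatrix U).IsHermitian := by
  have hdet := isUnit_det_add_one hU'
  have hUU : Uᴴ * U = 1 := Matrix.mem_unitaryGroup_iff'.1 hU
  have hUU' : U * Uᴴ = 1 := Matrix.mem_unitaryGroup_iff.1 hU
  have hdet' : IsUnit (Uᴴ + 1).det := by
    have h1 : Uᴴ + 1 = (U + 1)ᴴ := by simp
    rw [h1, Matrix.det_conjTranspose]
    exact hdet.star
  have h1 : (couplingMatrix U)ᴴ = -Complex.I • ((Uᴴ - 1) * (Uᴴ + 1)⁻¹) := by
    rw [couplingMatrix, Matrix.conjTranspose_smul, Matrix.conjTranspose_mul,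
      Matrix.conjTranspose_nonsing_inv]
    simp
  rw [Matrix.IsHermitian, h1, couplingMatrix, neg_smul, ← smul_neg]
  congr 1
  -- Multiplying by `U + 1` on the left and `Uᴴ + 1` on the right clears both inverses; by unitarity
  -- each side then reduces to `U - Uᴴ`.
  have h2 : (U + 1) * (-((Uᴴ - 1) * (Uᴴ + 1)⁻¹)) * (Uᴴ + 1) =
      (U + 1) * ((U + 1)⁻¹ * (U - 1)) * (Uᴴ + 1) := by
    rw [← Matrix.mul_assoc (U + 1), Matrix.mul_nonsing_inv _ hdet, Matrix.one_mul,
      Matrix.mul_assoc, Matrix.neg_mul, Matrix.mul_assoc, Matrix.nonsing_inv_mul _ hdet',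
      Matrix.mul_one]
    noncomm_ring
    rw [hUU']
    abel
  have h3 := congrArg (fun M => (U + 1)⁻¹ * (M * (Uᴴ + 1)⁻¹)) h2
  simp only [Matrix.mul_assoc, Matrix.mul_nonsing_inv _ hdet', Matrix.mul_one] at h3
  rwa [← Matrix.mul_assoc (U + 1)⁻¹ (U + 1), ← Matrix.mul_assoc (U + 1)⁻¹ (U + 1),
    Matrix.nonsing_inv_mul _ hdet, Matrix.one_mul, Matrix.one_mul] at h3

theorem coupling_iff {d : ℕ} (ℓ : Fin d → ℝ) {U : Matrix (Ends d) (Ends d) ℂ}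
    (hU' : (-1 : ℂ) ∉ spectrum ℂ U) (f f' : Fin d → ℝ → ℂ) :
    Coupling ℓ U f f' ↔ boundaryDerivs ℓ f' - couplingMatrix U *ᵥ boundaryValues ℓ f = 0 := by
  have hdet := isUnit_det_add_one hU'
  have h1 : (U - 1) *ᵥ boundaryValues ℓ f + Complex.I • ((U + 1) *ᵥ boundaryDerivs ℓ f') =
      (Complex.I • (U + 1)) *ᵥ
        (boundaryDerivs ℓ f' - couplingMatrix U *ᵥ boundaryValues ℓ f) := by
    rw [Matrix.mulVec_sub, Matrix.mulVec_mulVec, couplingMatrix, Matrix.smul_mul,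
      Matrix.mul_smul, smul_smul, Complex.I_mul_I, ← Matrix.mul_assoc,
      Matrix.mul_nonsing_inv _ hdet, Matrix.one_mul, Matrix.smul_mulVec, Matrix.smul_mulVec]
    simp [add_comm]
  rw [Coupling, h1]
  constructor
  · intro h
    have hd : ((Complex.I • (U + 1)) : Matrix (Ends d) (Ends d) ℂ).det ≠ 0 := by
      rw [Matrix.det_smul]
      exact mul_ne_zero (pow_ne_zero _ Complex.I_ne_zero) hdet.ne_zero
    exact Matrix.eq_zero_of_mulVec_eq_zero hd h
  · intro h
    rw [h, Matrix.mulVec_zero]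

theorem memLp_boundedContinuous (L : ℝ) (y : ℝ →ᵇ ℂ) :
    MemLp y 2 (volume.restrict (Set.Ioo 0 L)) :=
  MemLp.of_bound y.continuous.aestronglyMeasurable ‖y‖
    (Eventually.of_forall fun x => y.norm_coe_le_norm x)

theorem HasWeakDeriv.continuousOn {L : ℝ} (hL : 0 ≤ L) {f g : ℝ → ℂ} (h : HasWeakDeriv L f g) :
    ContinuousOn f (Set.Icc 0 L) := by
  have hprim : ContinuousOn (fun t => ∫ u in (0 : ℝ)..t, g u) (Set.uIcc 0 L) :=
    intervalIntegral.continuousOn_primitive_interval (by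
      rw [Set.uIcc_of_le hL, integrableOn_Icc_iff_integrableOn_Ioc]
      exact (intervalIntegrable_iff_integrableOn_Ioc_of_le hL).1 h.1)
  rw [Set.uIcc_of_le hL] at hprim
  exact (continuousOn_const.add hprim).congr fun x hx => h.2 x hx

/-- The bounded continuous extension of a continuous function on `[0, L]`. -/
theorem exists_extension {L : ℝ} (hL : 0 ≤ L) {f : ℝ → ℂ} (hf : ContinuousOn f (Set.Icc 0 L)) :
    ∃ y : ℝ →ᵇ ℂ, ∀ x, y x = f (clamp L x) := by
  obtain ⟨C, hC⟩ := isCompact_Icc.exists_bound_of_continuousOn hf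
  refine ⟨BoundedContinuousFunction.ofNormedAddCommGroup (fun x => f (clamp L x)) ?_ C
    (fun x => hC _ (clamp_mem hL x)), fun x => rfl⟩
  exact hf.comp_continuous (continuous_clamp L) (clamp_mem hL)

/-- A `W^{2,2}` function with `f'' = w f` almost everywhere is the solution with its initial
data. -/
theorem IsW22.eq_sol {L : ℝ} (hL : 0 ≤ L) {f f' f'' : ℝ → ℂ} (h : IsW22 L f f' f'')
    {w : ℝ →ᵇ ℂ}
    (hw : ∀ᵐ x ∂(volume.restrict (Set.Ioo 0 L)), f'' x = w x * f x) :
    (∀ x ∈ Set.Icc 0 L, f x = sol hL w (f 0) (f' 0) x) ∧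
      ∀ x ∈ Set.Icc 0 L, f' x = solDeriv hL w (f 0) (f' 0) x := by
  -- Extended by constants, `f` satisfies the integral equation on all of `ℝ`, so uniqueness of its
  -- bounded continuous solution applies.
  obtain ⟨y, hy⟩ := exists_extension hL (h.deriv_one.continuousOn hL)
  have hyf : ∀ x ∈ Set.Icc 0 L, y x = f x := fun x hx => by rw [hy, clamp_of_mem hx]
  have h0 : (0 : ℝ) ∈ Set.Icc 0 L := ⟨le_rfl, hL⟩
  have hw' : ∀ᵐ x, x ∈ Set.Ioo 0 L → f'' x = w x * f x :=
    (ae_restrict_iff' measurableSet_Ioo).1 hw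
  have hne : ∀ᵐ t : ℝ, t ≠ L := by simp [ae_iff]
  have hf' : ∀ x ∈ Set.Icc 0 L, f' x = f' 0 + volterra hL (w * y) x := by
    intro x hx
    rw [h.deriv_two.2 x hx, volterra_apply_of_mem hL _ hx]
    congr 1
    refine intervalIntegral.integral_congr_ae ?_
    filter_upwards [hw', hne] with t ht htL htx
    rw [Set.uIoc_of_le hx.1] at htx
    have h1 : t ∈ Set.Ioo 0 L := ⟨htx.1, lt_of_le_of_ne (htx.2.trans hx.2) htL⟩
    rw [ht h1, BoundedContinuousFunction.coe_mul, Pi.mul_apply, hyf t ⟨h1.1.le, h1.2.le⟩]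
  have hsol : y = sol hL w (f 0) (f' 0) := by
    refine sol_unique hL ?_
    ext x
    have hx := clamp_mem hL x
    have h2 : f (clamp L x) = f 0 + ∫ t in (0 : ℝ)..clamp L x, (f' 0 * (1 : ℝ →ᵇ ℂ) t +
        volterra hL (w * y) t) := by
      rw [h.deriv_one.2 _ hx]
      congr 1
      refine intervalIntegral.integral_congr fun t ht => ?_
      rw [Set.uIcc_of_le hx.1] at ht
      simp [hf' t ⟨ht.1, ht.2.trans hx.2⟩]
    rw [hy, h2, intervalIntegral.integral_add, intervalIntegral.integral_const_mul]
    · simp only [BoundedContinuousFunction.coe_add, BoundedContinuousFunction.coe_smul,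
        Pi.add_apply, solOp_apply, volterra_apply]
      simp [add_assoc]
    · exact Continuous.intervalIntegrable (by fun_prop) _ _
    · exact Continuous.intervalIntegrable (by fun_prop) _ _
  refine ⟨fun x hx => by rw [← hsol, hyf x hx], fun x hx => ?_⟩
  rw [hf' x hx, solDeriv, ← hsol]
  simp

theorem isW22_sol {L : ℝ} (hL : 0 ≤ L) (w : ℝ →ᵇ ℂ) (a b : ℂ) :
    IsW22 L (sol hL w a b) (solDeriv hL w a b) (w * sol hL w a b : ℝ →ᵇ ℂ) where
  deriv_one := by
    refine ⟨(BoundedContinuousFunction.continuous _).intervalIntegrable _ _, fun x hx => ?_⟩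
    rw [sol_zero_right]
    conv_lhs => rw [sol_eq]
    rw [BoundedContinuousFunction.coe_add, Pi.add_apply, volterra_apply_of_mem hL _ hx]
    simp
  deriv_two := by
    refine ⟨(BoundedContinuousFunction.continuous _).intervalIntegrable _ _, fun x hx => ?_⟩
    rw [solDeriv_zero_right, solDeriv]
    rw [BoundedContinuousFunction.coe_add, Pi.add_apply, volterra_apply_of_mem hL _ hx]
    simp
  memLp := memLp_boundedContinuous L _

section Graph

variable {d : ℕ} {ℓ : Fin d → ℝ} (hℓ : ∀ i, 0 < ℓ i) (p : Fin d → ℝ →ᵇ ℂ)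

/-- The edgewise solution with initial data `v`, as an element of `L²`. -/
def solLp (z : ℂ) : (Ends d → ℂ) →ₗ[ℂ] GraphL2 ℓ where
  toFun v := WithLp.toLp 2 fun i => (memLp_boundedContinuous (ℓ i) (graphSol hℓ p z v i)).toLp _
  map_add' v u := by
    ext1 i
    refine Eq.trans ?_ (MemLp.toLp_add (memLp_boundedContinuous (ℓ i) (graphSol hℓ p z v i))
      (memLp_boundedContinuous (ℓ i) (graphSol hℓ p z u i)))
    refine MemLp.toLp_congr (memLp_boundedContinuous (ℓ i) (graphSol hℓ p z (v + u) i))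
      ((memLp_boundedContinuous (ℓ i) (graphSol hℓ p z v i)).add
        (memLp_boundedContinuous (ℓ i) (graphSol hℓ p z u i))) (Eventually.of_forall fun x => ?_)
    simp [graphSol, sol_add]
  map_smul' c v := by
    ext1 i
    refine Eq.trans ?_ (MemLp.toLp_const_smul c
      (memLp_boundedContinuous (ℓ i) (graphSol hℓ p z v i)))
    refine MemLp.toLp_congr (memLp_boundedContinuous (ℓ i) (graphSol hℓ p z (c • v) i))
      ((memLp_boundedContinuous (ℓ i) (graphSol hℓ p z v i)).const_smul c)
      (Eventually.of_forall fun x => ?_)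
    simp [graphSol, sol_smul]

theorem solLp_coeFn (z : ℂ) (v : Ends d → ℂ) (i : Fin d) :
    ⇑(solLp hℓ p z v i) =ᵐ[volume.restrict (Set.Ioo 0 (ℓ i))] graphSol hℓ p z v i :=
  MemLp.coeFn_toLp (memLp_boundedContinuous (ℓ i) (graphSol hℓ p z v i))

theorem solLp_injective (z : ℂ) : Function.Injective (solLp hℓ p z) := by
  rw [← LinearMap.ker_eq_bot, LinearMap.ker_eq_bot']
  intro v hv
  have h : ∀ i, v (i, 0) = 0 ∧ v (i, 1) = 0 := by
    intro i
    refine sol_eq_zero_of_ae (hℓ i) (w := p i - z • 1) ?_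
    have h1 := solLp_coeFn hℓ p z v i
    rw [hv] at h1
    exact h1.symm.trans (Lp.coeFn_zero _ _ _)
  funext ⟨i, a⟩
  fin_cases a
  · exact (h i).1
  · exact (h i).2

/-- An eigenfunction solves the edge equation almost everywhere, so it is determined by its initial
data at the edge beginnings. The secular matrix annihilates exactly the data for which the coupling
holds. -/
theorem eigenspace_eq {U : Matrix (Ends d) (Ends d) ℂ} (hU' : (-1 : ℂ) ∉ spectrum ℂ U)
    {q : Fin d → ℝ → ℝ} (hpq : ∀ i, ∀ x ∈ Set.Icc 0 (ℓ i), p i x = q i x) (z : ℂ) :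
    eigenspace ℓ U q z = (LinearMap.ker (Matrix.toLin'
      (secMatrix hℓ p (couplingMatrix U) z))).map (solLp hℓ p z) := by
  ext ψ
  rw [Submodule.mem_map]
  have hmem : ψ ∈ eigenspace ℓ U q z ↔ IsHamiltonianPair ℓ U q ψ (z • ψ) := Iff.rfl
  rw [hmem]
  have hIoo : ∀ i, ∀ᵐ x ∂(volume.restrict (Set.Ioo 0 (ℓ i))), x ∈ Set.Ioo 0 (ℓ i) := fun i =>
    ae_restrict_mem measurableSet_Ioo
  constructor
  · rintro ⟨f, f', f'', hf, hc, hψ, hχ⟩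
    have hw : ∀ i, ∀ᵐ x ∂(volume.restrict (Set.Ioo 0 (ℓ i))),
        f'' i x = (p i - z • 1 : ℝ →ᵇ ℂ) x * f i x := by
      intro i
      filter_upwards [hψ i, hχ i, Lp.coeFn_smul z (ψ i), hIoo i] with x h1 h2 h3 h4
      have h5 : (z • ψ i : Lp ℂ 2 (volume.restrict (Set.Ioo 0 (ℓ i)))) x = z * f i x := by
        rw [h3, Pi.smul_apply, h1, smul_eq_mul]
      have h6 : z * f i x = -f'' i x + q i x * f i x := h5.symm.trans h2
      simp only [BoundedContinuousFunction.coe_sub, Pi.sub_apply,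
        hpq i x (Set.Ioo_subset_Icc_self h4), BoundedContinuousFunction.coe_smul,
        BoundedContinuousFunction.coe_one, Pi.one_apply, smul_eq_mul, mul_one]
      linear_combination h6
    have hsol := fun i => (hf i).eq_sol (hℓ i).le (hw i)
    let v : Ends d → ℂ := fun e => if e.2 = 0 then f e.1 0 else f' e.1 0
    have hend : ∀ i, ℓ i ∈ Set.Icc 0 (ℓ i) := fun i => ⟨(hℓ i).le, le_rfl⟩
    have hval : boundaryValues ℓ f = boundaryValues ℓ fun i => graphSol hℓ p z v i := by
      funext e
      by_cases he : e.2 = 0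
      · simp [boundaryValues, graphSol, v, he, sol_zero_right]
      · simpa [boundaryValues, graphSol, v, he] using (hsol e.1).1 _ (hend e.1)
    have hder : boundaryDerivs ℓ f' = boundaryDerivs ℓ fun i => graphDeriv hℓ p z v i := by
      funext e
      by_cases he : e.2 = 0
      · simp [boundaryDerivs, graphDeriv, v, he, solDeriv_zero_right]
      · simpa [boundaryDerivs, graphDeriv, v, he] using (hsol e.1).2 _ (hend e.1)
    refine ⟨v, ?_, ?_⟩
    · rw [LinearMap.mem_ker, Matrix.toLin'_apply, secMatrix_mulVec, ← hval, ← hder]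
      exact (coupling_iff ℓ hU' f f').1 hc
    · ext1 i
      refine Lp.ext ?_
      filter_upwards [solLp_coeFn hℓ p z v i, hψ i, hIoo i] with x h1 h2 h3
      rw [h1, h2, (hsol i).1 x (Set.Ioo_subset_Icc_self h3)]
      simp [graphSol, v]
  · rintro ⟨v, hv, rfl⟩
    rw [LinearMap.mem_ker, Matrix.toLin'_apply, secMatrix_mulVec] at hv
    refine ⟨fun i => graphSol hℓ p z v i, fun i => graphDeriv hℓ p z v i,
      fun i => ((p i - z • 1) * graphSol hℓ p z v i : ℝ →ᵇ ℂ), fun i => isW22_sol _ _ _ _,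
      (coupling_iff ℓ hU' _ _).2 hv, fun i => solLp_coeFn hℓ p z v i, fun i => ?_⟩
    filter_upwards [solLp_coeFn hℓ p z v i, Lp.coeFn_smul z (solLp hℓ p z v i), hIoo i]
      with x h1 h2 h3
    refine Eq.trans (b := z * graphSol hℓ p z v i x) (h2.trans ?_) ?_
    · rw [Pi.smul_apply, h1, smul_eq_mul]
    · simp only [BoundedContinuousFunction.coe_mul, Pi.mul_apply,
        BoundedContinuousFunction.coe_sub, Pi.sub_apply,
        hpq i x (Set.Ioo_subset_Icc_self h3), BoundedContinuousFunction.coe_smul,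
        BoundedContinuousFunction.coe_one, Pi.one_apply, smul_eq_mul, mul_one]
      ring

theorem toENat_rank_eigenspace {U : Matrix (Ends d) (Ends d) ℂ}
    (hU : U ∈ Matrix.unitaryGroup (Ends d) ℂ) (hU' : (-1 : ℂ) ∉ spectrum ℂ U)
    {q : Fin d → ℝ → ℝ} (hpq : ∀ i, ∀ x ∈ Set.Icc 0 (ℓ i), p i x = q i x)
    (hp : ∀ i x, starRingEnd ℂ (p i x) = p i x) (z : ℂ) :
    Cardinal.toENat (Module.rank ℂ (eigenspace ℓ U q z)) =
      analyticOrderAt (secFun hℓ p (couplingMatrix U)) z := by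
  rw [analyticOrderAt_secFun hℓ p hp (isHermitian_couplingMatrix hU hU'),
    eigenspace_eq hℓ p hU' hpq,
    ← (Submodule.equivMapOfInjective (solLp hℓ p z) (solLp_injective hℓ p z) _).rank_eq,
    ← Module.finrank_eq_rank, Cardinal.toENat_nat]

end Graph

end QuantumGraph

end

noncomputable section

namespace QuantumGraph

/-! ### The sine away from its zeros -/

theorem le_norm_expSin_of_im {k : ℂ} {L y : ℝ} (hy : y ≤ k.im * L) :
    (1 - Real.exp (-(2 * y))) / 2 ≤ ‖expSin k L‖ := by
  have h1 : ‖expk k L ^ 2‖ ≤ Real.exp (-(2 * y)) := by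
    rw [norm_pow, norm_expk, ← Real.exp_nat_mul]
    exact Real.exp_le_exp.2 (by push_cast; linarith)
  have h2 := norm_sub_norm_le (1 : ℂ) (expk k L ^ 2)
  rw [norm_one, norm_sub_rev] at h2
  rw [expSin_eq, norm_div]
  simp only [norm_mul, Complex.norm_I, Complex.norm_ofNat, mul_one]
  linarith

theorem abs_sin_re_le_norm_sin (w : ℂ) : |Real.sin w.re| ≤ ‖Complex.sin w‖ := by
  refine le_trans ?_ (Complex.abs_re_le_norm _)
  have h1 : (Complex.sin w).re = Real.sin w.re * Real.cosh w.im := by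
    conv_lhs => rw [Complex.sin_eq w]
    simp [← Complex.ofReal_sin, ← Complex.ofReal_cosh, ← Complex.ofReal_cos,
      ← Complex.ofReal_sinh]
  rw [h1, abs_mul, abs_of_pos (Real.cosh_pos _)]
  exact le_mul_of_one_le_right (abs_nonneg _) (Real.one_le_cosh _)

/-- Jordan's inequality, after subtracting the nearest multiple of `π`. -/
theorem exists_int_mul_abs_le_abs_sin (x : ℝ) :
    ∃ n : ℤ, 2 / Real.pi * |x - n * Real.pi| ≤ |Real.sin x| := by
  refine ⟨round (x / Real.pi), ?_⟩
  set n := round (x / Real.pi)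
  have hpi := Real.pi_pos
  have h1 : |x - n * Real.pi| ≤ Real.pi / 2 := by
    have h2 := abs_sub_round (x / Real.pi)
    have h3 : x - n * Real.pi = (x / Real.pi - n) * Real.pi := by field_simp
    rw [h3, abs_mul, abs_of_pos hpi]
    nlinarith
  have h2 : |Real.sin x| = |Real.sin (x - n * Real.pi)| := by
    rw [Real.sin_sub_int_mul_pi, abs_mul, abs_zpow]
    simp
  have h3 := Real.mul_le_sin (abs_nonneg _) h1
  rw [h2]
  refine h3.trans ?_
  rcases abs_cases (x - n * Real.pi) with h | h <;> rw [h.1]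
  · exact le_abs_self _
  · rw [Real.sin_neg]; exact neg_le_abs _

/-- If `Im (k L)` is at least `ε / 2`, the decaying exponential in `expSin_eq` is bounded away from
`1`. Otherwise `Re (k L)` has distance at least `ε / 2` from the multiples of `π`, and the real sine
already gives the bound. -/
theorem exists_le_norm_expSin {ε : ℝ} (hε : 0 < ε) :
    ∃ c : ℝ, 0 < c ∧ ∀ (k : ℂ) (L : ℝ), 0 ≤ L → 0 ≤ k.im →
      (∀ n : ℤ, ε ≤ ‖k * L - n * Real.pi‖) → c ≤ ‖expSin k L‖ := by
  have hpi := Real.pi_pos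
  have h1 : Real.exp (-(2 * (ε / 2))) < 1 := Real.exp_lt_one_iff.2 (by linarith)
  refine ⟨min ((1 - Real.exp (-(2 * (ε / 2)))) / 2) (Real.exp (-(ε / 2)) * (2 / Real.pi * (ε / 2))),
    lt_min (by linarith) (by positivity), fun k L hL hk h => ?_⟩
  by_cases hy : ε / 2 ≤ k.im * L
  · exact (min_le_left _ _).trans (le_norm_expSin_of_im hy)
  · push Not at hy
    refine (min_le_right _ _).trans ?_
    obtain ⟨n, hn⟩ := exists_int_mul_abs_le_abs_sin (k * L).re
    have h2 := abs_sin_re_le_norm_sin (k * L)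
    have h3 := (h n).trans (Complex.norm_le_abs_re_add_abs_im _)
    have hre : (k * L - n * Real.pi).re = (k * L).re - n * Real.pi := by simp
    have him : (k * L - n * Real.pi).im = k.im * L := by simp
    rw [hre, him, abs_of_nonneg (mul_nonneg hk hL)] at h3
    rw [expSin, norm_mul, norm_expk]
    refine mul_le_mul (Real.exp_le_exp.2 (by linarith)) ?_ (by positivity) (by positivity)
    refine le_trans (mul_le_mul_of_nonneg_left ?_ (by positivity)) (hn.trans h2)
    linarith

/-- By the reverse triangle inequality only `N ℓᵢ` and `|n| π` need to be compared. The radius `ε /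
ℓᵢ` in the cut-offs becomes the uniform distance `ε` after scaling by `ℓᵢ`. -/
theorem le_norm_sub_of_mem_admissibleCutoffs {d : ℕ} {ℓ : Fin d → ℝ} (hℓ : ∀ i, 0 < ℓ i)
    {ε N : ℝ} (hN : N ∈ admissibleCutoffs ℓ ε) {k : ℂ} (hk : ‖k‖ = N) (i : Fin d) (n : ℤ) :
    ε ≤ ‖k * ℓ i - n * Real.pi‖ := by
  have h1 := hN i n.natAbs
  have hi := hℓ i
  have h2 : sineZero ℓ (i, n.natAbs) * ℓ i = |(n : ℝ)| * Real.pi := by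
    simp only [sineZero, Nat.cast_natAbs, Int.cast_abs]
    field_simp
  have h3 := abs_norm_sub_norm_le (k * ℓ i) (n * Real.pi)
  have h4 : ‖k * (ℓ i : ℂ)‖ = N * ℓ i := by
    rw [norm_mul, hk, Complex.norm_real, Real.norm_of_nonneg hi.le]
  have h5 : ‖(n : ℂ) * (Real.pi : ℂ)‖ = |(n : ℝ)| * Real.pi := by
    rw [norm_mul, Complex.norm_real, Real.norm_of_nonneg Real.pi_pos.le, Complex.norm_intCast]
  rw [h4, h5, ← h2, ← sub_mul, abs_mul, abs_of_pos hi] at h3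
  refine le_trans ?_ h3
  rwa [← div_le_iff₀ hi]

/-- The filter of all `k → ∞` in the closed upper half plane for which `sin (k ℓᵢ)` is bounded
away from zero after normalisation. -/
def sectorFilter {d : ℕ} (ℓ : Fin d → ℝ) (c : ℝ) : Filter ℂ :=
  comap (fun k : ℂ => ‖k‖) atTop ⊓ 𝓟 {k | 0 ≤ k.im ∧ ∀ i, c ≤ ‖expSin k (ℓ i)‖}

theorem tendsto_norm_sectorFilter {d : ℕ} (ℓ : Fin d → ℝ) (c : ℝ) :
    Tendsto (fun k : ℂ => ‖k‖) (sectorFilter ℓ c) atTop :=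
  tendsto_comap.mono_left inf_le_left

theorem eventually_sectorFilter {d : ℕ} (ℓ : Fin d → ℝ) (c : ℝ) :
    ∀ᶠ k in sectorFilter ℓ c, 0 ≤ k.im ∧ ∀ i, c ≤ ‖expSin k (ℓ i)‖ :=
  Eventually.filter_mono inf_le_right (mem_principal_self _)

theorem exists_of_eventually_sectorFilter {d : ℕ} {ℓ : Fin d → ℝ} {c : ℝ} {P : ℂ → Prop}
    (h : ∀ᶠ k in sectorFilter ℓ c, P k) :
    ∃ R : ℝ, ∀ k : ℂ, R ≤ ‖k‖ → 0 ≤ k.im → (∀ i, c ≤ ‖expSin k (ℓ i)‖) → P k := by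
  rw [sectorFilter, eventually_inf_principal, eventually_comap] at h
  obtain ⟨R, hR⟩ := eventually_atTop.1 h
  exact ⟨R, fun k hk h1 h2 => hR _ hk k rfl ⟨h1, h2⟩⟩

end QuantumGraph

end

noncomputable section

namespace QuantumGraph

open scoped BoundedContinuousFunction
open Asymptotics

/-! ### Asymptotics of the secular function -/

/-- The logarithm of `det (1 - A M)`, as a function of the entries of `M`. -/
def logDetSub {d : ℕ} (A : Matrix (Ends d) (Ends d) ℂ) (M : Ends d → Ends d → ℂ) : ℂ :=
  Complex.log (1 - A * Matrix.of M).det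

theorem contDiff_det_sub {d : ℕ} (A : Matrix (Ends d) (Ends d) ℂ) :
    ContDiff ℂ 1 fun M : Ends d → Ends d → ℂ => (1 - A * Matrix.of M).det := by
  simp only [Matrix.det_apply, Matrix.sub_apply, Matrix.mul_apply, Matrix.of_apply]
  fun_prop

/-- At `M = 0` the determinant is `1`, so its logarithm is continuously differentiable nearby. The
effect of the potential on this logarithm is thus controlled by the difference of the
Neumann-to-Dirichlet matrices alone. -/
theorem exists_lipschitzOnWith_logDetSub {d : ℕ} (A : Matrix (Ends d) (Ends d) ℂ) :
    ∃ K, ∃ s ∈ 𝓝 (0 : Ends d → Ends d → ℂ), LipschitzOnWith K (logDetSub A) s := by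
  have h0 : (1 - A * Matrix.of (0 : Ends d → Ends d → ℂ)).det = 1 := by
    rw [Matrix.of_zero, Matrix.mul_zero, sub_zero, Matrix.det_one]
  refine ContDiffAt.exists_lipschitzOnWith (𝕂 := ℂ) ?_
  refine ContDiffAt.comp 0 (Complex.contDiffAt_log ?_) (contDiff_det_sub A).contDiffAt
  rw [h0]
  exact Complex.one_mem_slitPlane

section Graph

variable {d : ℕ} {ℓ : Fin d → ℝ} (hℓ : ∀ i, 0 < ℓ i) (p : Fin d → ℝ →ᵇ ℂ)
  (A : Matrix (Ends d) (Ends d) ℂ) {l : Filter ℂ}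

/-- The entries of the Neumann-to-Dirichlet matrix at energy `k ^ 2`. -/
def ndFun (k : ℂ) : Ends d → Ends d → ℂ := fun e e' => ndMatrix hℓ p (k ^ 2) e e'

theorem of_ndFun (k : ℂ) : Matrix.of (ndFun hℓ p k) = ndMatrix hℓ p (k ^ 2) := rfl

theorem tendsto_ndFun (hinf : Tendsto (fun k : ℂ => ‖k‖) l atTop)
    (him : ∀ᶠ k in l, 0 ≤ k.im) {c : ℝ} (hc : 0 < c)
    (hs : ∀ i, ∀ᶠ k in l, c ≤ ‖expSin k (ℓ i)‖) :
    Tendsto (ndFun hℓ p) l (𝓝 0) := by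
  refine tendsto_pi_nhds.2 fun e => tendsto_pi_nhds.2 fun e' => ?_
  by_cases h : e.1 = e'.1
  · simpa [ndFun, ndMatrix, blk, h] using
      tendsto_edgeM (hℓ e'.1).le (p e'.1) hinf him hc (hs e'.1) e.2 e'.2
  · simp [ndFun, ndMatrix, blk, h, tendsto_const_nhds]

/-- The difference of the Neumann-to-Dirichlet matrices with and without potential, scaled by the
energy. -/
def ndDiff (k : ℂ) : Ends d → Ends d → ℂ :=
  k ^ 2 • (ndFun hℓ p k - ndFun hℓ 0 k)

theorem ndDiff_apply (k : ℂ) (e e' : Ends d) :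
    ndDiff hℓ p k e e' = if e.1 = e'.1 then
      k ^ 2 * (edgeM (hℓ e.1).le (p e.1) (k ^ 2) e.2 e'.2 -
        edgeM (hℓ e.1).le 0 (k ^ 2) e.2 e'.2) else 0 := by
  by_cases h : e.1 = e'.1 <;> simp [ndDiff, ndFun, ndMatrix, blk, h]

theorem isBigO_ndDiff (hinf : Tendsto (fun k : ℂ => ‖k‖) l atTop)
    (him : ∀ᶠ k in l, 0 ≤ k.im) {c : ℝ} (hc : 0 < c)
    (hs : ∀ i, ∀ᶠ k in l, c ≤ ‖expSin k (ℓ i)‖) :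
    ndDiff hℓ p =O[l] (1 : ℂ → ℂ) := by
  refine isBigO_pi.2 fun e => isBigO_pi.2 fun e' => ?_
  simp only [ndDiff_apply]
  split_ifs
  · exact isBigO_edgeM_sub (hℓ e.1).le (p e.1) hinf him hc (hs e.1) e.2 e'.2
  · exact isBigO_zero _ _

theorem tendsto_ndDiff [l.IsCountablyGenerated] (hl : Tendsto Complex.im l atTop) :
    Tendsto (ndDiff hℓ p) l (𝓝 0) := by
  refine tendsto_pi_nhds.2 fun e => tendsto_pi_nhds.2 fun e' => ?_
  simp only [ndDiff_apply]
  split_ifs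
  · exact tendsto_edgeM_sub (hℓ e.1).le (p e.1) (hℓ e.1) hl e.2 e'.2
  · exact tendsto_const_nhds

theorem isBigO_logDetSub (hinf : Tendsto (fun k : ℂ => ‖k‖) l atTop)
    (him : ∀ᶠ k in l, 0 ≤ k.im) {c : ℝ} (hc : 0 < c)
    (hs : ∀ i, ∀ᶠ k in l, c ≤ ‖expSin k (ℓ i)‖) :
    (fun k => k ^ 2 * (logDetSub A (ndFun hℓ p k) -
      logDetSub A (ndFun hℓ 0 k))) =O[l] ndDiff hℓ p := by
  obtain ⟨K, s, hs0, hK⟩ := exists_lipschitzOnWith_logDetSub A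
  refine IsBigO.of_bound K ?_
  filter_upwards [tendsto_ndFun hℓ p hinf him hc hs hs0,
    tendsto_ndFun hℓ 0 hinf him hc hs hs0] with k h1 h2
  have h3 := hK.norm_sub_le h1 h2
  rw [norm_mul, ndDiff, norm_smul]
  calc ‖k ^ 2‖ * _ ≤ ‖k ^ 2‖ * (K * _) := mul_le_mul_of_nonneg_left h3 (norm_nonneg _)
    _ = _ := by ring

theorem tendsto_det_sub (hinf : Tendsto (fun k : ℂ => ‖k‖) l atTop)
    (him : ∀ᶠ k in l, 0 ≤ k.im) {c : ℝ} (hc : 0 < c)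
    (hs : ∀ i, ∀ᶠ k in l, c ≤ ‖expSin k (ℓ i)‖) :
    Tendsto (fun k => (1 - A * ndMatrix hℓ p (k ^ 2)).det) l (𝓝 1) := by
  have h0 : (1 - A * Matrix.of (0 : Ends d → Ends d → ℂ)).det = 1 := by
    rw [Matrix.of_zero, Matrix.mul_zero, sub_zero, Matrix.det_one]
  have h1 := ((contDiff_det_sub A).continuous.tendsto 0).comp
    (tendsto_ndFun hℓ p hinf him hc hs)
  rw [h0] at h1
  exact h1

theorem eventually_edgeDeriv_ne_zero (hinf : Tendsto (fun k : ℂ => ‖k‖) l atTop)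
    (him : ∀ᶠ k in l, 0 ≤ k.im) {c : ℝ} (hc : 0 < c)
    (hs : ∀ i, ∀ᶠ k in l, c ≤ ‖expSin k (ℓ i)‖) :
    ∀ᶠ k in l, ∀ i, edgeDeriv (hℓ i).le (p i) (k ^ 2) ≠ 0 := by
  refine eventually_all.2 fun i => ?_
  filter_upwards [eventually_edge (hℓ i).le (p i) hinf him hc (hs i)] with k hk
  rw [edgeDeriv_sq _ _ hk.1]
  exact mul_ne_zero (mul_ne_zero (neg_ne_zero.2 hk.1) hk.2.2) (inv_ne_zero (expk_ne_zero _ _))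

theorem tendsto_secFun_div_prod (hinf : Tendsto (fun k : ℂ => ‖k‖) l atTop)
    (him : ∀ᶠ k in l, 0 ≤ k.im) {c : ℝ} (hc : 0 < c)
    (hs : ∀ i, ∀ᶠ k in l, c ≤ ‖expSin k (ℓ i)‖) :
    Tendsto (fun k => secFun hℓ p A (k ^ 2) / ∏ i, edgeDeriv (hℓ i).le 0 (k ^ 2)) l (𝓝 1) := by
  have h1 := (tendsto_det_sub hℓ p A hinf him hc hs).mul (tendsto_finsetProd Finset.univ
    fun i _ => tendsto_edgeDeriv_div (hℓ i).le (p i) hinf him hc (hs i))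
  rw [Finset.prod_const_one, mul_one] at h1
  refine h1.congr' ?_
  filter_upwards [eventually_edgeDeriv_ne_zero hℓ p hinf him hc hs] with k hk
  rw [secFun_eq hℓ p A hk, Finset.prod_div_distrib, mul_div_assoc]

/-- The principal logarithm is additive once the sum of the logarithms has imaginary part in `(-π,
π]`. All factors tend to `1`, so this sum eventually has norm below `π`. -/
theorem eventually_log_secFun_div (hinf : Tendsto (fun k : ℂ => ‖k‖) l atTop)
    (him : ∀ᶠ k in l, 0 ≤ k.im) {c : ℝ} (hc : 0 < c)
    (hs : ∀ i, ∀ᶠ k in l, c ≤ ‖expSin k (ℓ i)‖) :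
    ∀ᶠ k in l, Complex.log (secFun hℓ p A (k ^ 2) / secFun hℓ 0 A (k ^ 2)) =
      (∑ i, Complex.log (edgeDeriv (hℓ i).le (p i) (k ^ 2) / edgeDeriv (hℓ i).le 0 (k ^ 2))) +
        (logDetSub A (ndFun hℓ p k) - logDetSub A (ndFun hℓ 0 k)) := by
  have hcont : Tendsto Complex.log (𝓝 1) (𝓝 0) := by
    have := (continuousAt_clog Complex.one_mem_slitPlane).tendsto
    rwa [Complex.log_one] at this
  have hD := tendsto_det_sub hℓ p A hinf him hc hs
  have hD0 := tendsto_det_sub hℓ 0 A hinf him hc hs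
  have hE := tendsto_finsetSum Finset.univ fun i _ =>
    hcont.comp (tendsto_edgeDeriv_div (hℓ i).le (p i) hinf him hc (hs i))
  have hT := (hE.add ((hcont.comp hD).sub (hcont.comp hD0))).norm
  rw [Finset.sum_const_zero, sub_zero, add_zero, norm_zero] at hT
  filter_upwards [hT.eventually (gt_mem_nhds Real.pi_pos), hD.eventually_ne one_ne_zero,
    hD0.eventually_ne one_ne_zero, eventually_edgeDeriv_ne_zero hℓ p hinf him hc hs,
    eventually_edgeDeriv_ne_zero hℓ 0 hinf him hc hs] with k h1 h2 h3 h4 h5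
  have h6 := abs_lt.1 ((Complex.abs_im_le_norm _).trans_lt h1)
  refine Eq.trans ?_ (Complex.log_exp h6.1 h6.2.le)
  congr 1
  rw [Complex.exp_add, Complex.exp_sub, Complex.exp_sum, logDetSub, logDetSub, of_ndFun,
    of_ndFun, Complex.exp_log h2, Complex.exp_log h3,
    secFun_eq hℓ p A h4, secFun_eq hℓ 0 A h5, mul_div_mul_comm, mul_comm,
    ← Finset.prod_div_distrib]
  congr 1
  refine Finset.prod_congr rfl fun i _ => ?_
  exact (Complex.exp_log (div_ne_zero (h4 i) (h5 i))).symm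

/-- The logarithm of the quotient of the secular functions, scaled by the energy, without its
leading term. -/
def graphLog (k : ℂ) : ℂ :=
  k ^ 2 * Complex.log (secFun hℓ p A (k ^ 2) / secFun hℓ 0 A (k ^ 2)) +
    ∑ i, (∫ t in (0 : ℝ)..ℓ i, p i t) / 2 * (k * (expCos k (ℓ i) * (expSin k (ℓ i))⁻¹))

theorem graphLog_eventuallyEq (hinf : Tendsto (fun k : ℂ => ‖k‖) l atTop)
    (him : ∀ᶠ k in l, 0 ≤ k.im) {c : ℝ} (hc : 0 < c)
    (hs : ∀ i, ∀ᶠ k in l, c ≤ ‖expSin k (ℓ i)‖) :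
    graphLog hℓ p A =ᶠ[l] fun k =>
      (∑ i, (k ^ 2 * Complex.log
          (edgeDeriv (hℓ i).le (p i) (k ^ 2) / edgeDeriv (hℓ i).le 0 (k ^ 2)) +
        (∫ t in (0 : ℝ)..ℓ i, p i t) / 2 * (k * (expCos k (ℓ i) * (expSin k (ℓ i))⁻¹)))) +
      k ^ 2 * (logDetSub A (ndFun hℓ p k) - logDetSub A (ndFun hℓ 0 k)) := by
  filter_upwards [eventually_log_secFun_div hℓ p A hinf him hc hs] with k hk
  rw [graphLog, hk, Finset.sum_add_distrib, mul_add, Finset.mul_sum]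
  ring

theorem isBigO_graphLog (hinf : Tendsto (fun k : ℂ => ‖k‖) l atTop)
    (him : ∀ᶠ k in l, 0 ≤ k.im) {c : ℝ} (hc : 0 < c)
    (hs : ∀ i, ∀ᶠ k in l, c ≤ ‖expSin k (ℓ i)‖)
    {g : Fin d → ℝ → ℂ} (hg : ∀ i, HasWeakDeriv (ℓ i) (p i) (g i)) :
    graphLog hℓ p A =O[l] (1 : ℂ → ℂ) := by
  refine IsBigO.congr' ?_ (graphLog_eventuallyEq hℓ p A hinf him hc hs).symm EventuallyEq.rfl
  refine IsBigO.add (IsBigO.fun_sum fun i _ => ?_)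
    ((isBigO_logDetSub hℓ p A hinf him hc hs).trans (isBigO_ndDiff hℓ p hinf him hc hs))
  exact isBigO_edge_log (hℓ i).le (p i) hinf him hc (hs i) (hg i)

theorem tendsto_graphLog [l.IsCountablyGenerated] (hl : Tendsto Complex.im l atTop)
    {g : Fin d → ℝ → ℂ} (hg : ∀ i, HasWeakDeriv (ℓ i) (p i) (g i)) :
    Tendsto (graphLog hℓ p A) l (𝓝 (∑ i, -(p i (ℓ i) + p i 0) / 4)) := by
  have hinf := tendsto_norm_of_im hl
  have him : ∀ᶠ k in l, 0 ≤ k.im := hl.eventually_ge_atTop 0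
  have hc : (0 : ℝ) < 1 / 4 := by norm_num
  have hs := fun i => eventually_expSin (hℓ i) hl
  refine Tendsto.congr' (graphLog_eventuallyEq hℓ p A hinf him hc hs).symm ?_
  have h1 := (isBigO_logDetSub hℓ p A hinf him hc hs).trans_tendsto (tendsto_ndDiff hℓ p hl)
  have h2 := (tendsto_finsetSum Finset.univ fun i _ =>
    tendsto_edge_log (hℓ i).le (p i) (hℓ i) hl (hg i)).add h1
  rwa [add_zero] at h2

end Graph

end QuantumGraph

end

noncomputable section

namespace QuantumGraph

open scoped BoundedContinuousFunction

/-! ### The zeros for decoupled edges without potential -/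

section Edge

variable {L : ℝ} (hL : 0 ≤ L)

theorem differentiable_edgeDeriv (p : ℝ →ᵇ ℂ) : Differentiable ℂ (edgeDeriv hL p) :=
  differentiable_solDeriv_apply hL p 1 0 L

theorem edgeDeriv_free_zero : edgeDeriv hL 0 0 = 0 := by
  have h1 : Tendsto (fun k : ℂ => edgeDeriv hL 0 (k ^ 2)) (𝓝[≠] 0) (𝓝 (edgeDeriv hL 0 0)) := by
    have : Continuous fun k : ℂ => edgeDeriv hL 0 (k ^ 2) :=
      (differentiable_edgeDeriv hL 0).continuous.comp (continuous_pow 2)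
    simpa using this.continuousWithinAt.tendsto (x := 0) (s := {0}ᶜ)
  have h2 : Tendsto (fun k : ℂ => -k * Complex.sin (k * L)) (𝓝[≠] 0) (𝓝 0) := by
    have : Continuous fun k : ℂ => -k * Complex.sin (k * L) := by fun_prop
    simpa using this.continuousWithinAt.tendsto (x := 0) (s := {0}ᶜ)
  refine tendsto_nhds_unique h1 (h2.congr' ?_)
  filter_upwards [self_mem_nhdsWithin] with k hk
  exact (edgeDeriv_zero_sq hL hk).symm

theorem edgeDeriv_free_sq (k : ℂ) : edgeDeriv hL 0 (k ^ 2) = -k * Complex.sin (k * L) := by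
  by_cases hk : k = 0
  · simp [hk, edgeDeriv_free_zero]
  · exact edgeDeriv_zero_sq hL hk

theorem deriv_edgeDeriv_free_sq (k : ℂ) :
    deriv (edgeDeriv hL 0) (k ^ 2) * (2 * k) =
      -Complex.sin (k * L) - k * L * Complex.cos (k * L) := by
  have h1 : HasDerivAt (fun k : ℂ => edgeDeriv hL 0 (k ^ 2))
      (deriv (edgeDeriv hL 0) (k ^ 2) * (2 * k)) k := by
    have h2 := HasDerivAt.comp k ((differentiable_edgeDeriv hL 0) (k ^ 2)).hasDerivAt
      (hasDerivAt_pow 2 k)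
    simpa using! h2
  have h3 : HasDerivAt (fun k : ℂ => -k * Complex.sin (k * L))
      (-Complex.sin (k * L) - k * L * Complex.cos (k * L)) k := by
    have h4 : HasDerivAt (fun k : ℂ => k * L) (L : ℂ) k := by
      simpa using (hasDerivAt_id k).mul_const (L : ℂ)
    refine ((hasDerivAt_id k).neg.mul h4.csin).congr_deriv ?_
    simp only [Pi.neg_apply, id_eq]
    ring
  refine h1.unique (h3.congr_of_eventuallyEq (Eventually.of_forall fun k => ?_))
  exact edgeDeriv_free_sq hL k

/-- The chain rule through `z = k²` degenerates at `k = 0`, so the difference quotient is taken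
along `k²`, where it equals `-sin (k L) / k`. -/
theorem deriv_edgeDeriv_free_zero : deriv (edgeDeriv hL 0) 0 = -L := by
  have hsq : Tendsto (fun k : ℂ => k ^ 2) (𝓝[≠] 0) (𝓝[≠] 0) := by
    refine tendsto_nhdsWithin_iff.2 ⟨?_, ?_⟩
    · have : Continuous fun k : ℂ => k ^ 2 := continuous_pow 2
      simpa using this.continuousWithinAt.tendsto (x := 0) (s := {0}ᶜ)
    · filter_upwards [self_mem_nhdsWithin] with k hk
      exact pow_ne_zero 2 hk
  have h1 := (hasDerivAt_iff_tendsto_slope.1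
    ((differentiable_edgeDeriv hL 0) 0).hasDerivAt).comp hsq
  have h4 : HasDerivAt (fun k : ℂ => Complex.sin (k * L)) (L : ℂ) 0 := by
    have h5 : HasDerivAt (fun k : ℂ => k * L) (L : ℂ) 0 := by
      simpa using (hasDerivAt_id (0 : ℂ)).mul_const (L : ℂ)
    simpa using h5.csin
  have h2 := (hasDerivAt_iff_tendsto_slope.1 h4).neg
  refine tendsto_nhds_unique h1 (h2.congr' ?_)
  filter_upwards [self_mem_nhdsWithin] with k hk
  have hk0 : k ≠ 0 := hk
  simp only [Function.comp_apply, slope_def_field, edgeDeriv_free_sq, edgeDeriv_free_zero,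
    zero_mul, Complex.sin_zero, sub_zero]
  field_simp

theorem exists_nat_of_edgeDeriv_free_eq_zero (hL' : 0 < L) {z : ℂ} (hz : edgeDeriv hL 0 z = 0) :
    ∃ n : ℕ, z = (((n * Real.pi / L) ^ 2 : ℝ) : ℂ) := by
  obtain ⟨k, rfl⟩ := IsAlgClosed.exists_pow_nat_eq z (n := 2) (by norm_num)
  have hLc : (L : ℂ) ≠ 0 := by exact_mod_cast hL'.ne'
  rw [edgeDeriv_free_sq] at hz
  have hsin : Complex.sin (k * L) = 0 := by
    rcases mul_eq_zero.1 hz with h | h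
    · rw [neg_eq_zero.1 h]; simp
    · exact h
  obtain ⟨n, hn⟩ := Complex.sin_eq_zero_iff.1 hsin
  refine ⟨n.natAbs, ?_⟩
  have h1 : k = n * Real.pi / L := by rw [← hn]; field_simp
  have h2 : ((n.natAbs : ℝ)) ^ 2 = (n : ℝ) ^ 2 := by
    rw [Nat.cast_natAbs, Int.cast_abs, sq_abs]
  have h3 : ((n.natAbs * Real.pi / L : ℝ)) ^ 2 = (n * Real.pi / L) ^ 2 := by
    rw [div_pow, mul_pow, h2, div_pow, mul_pow]
  rw [h1, h3]
  push_cast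
  rfl

theorem edgeDeriv_free_sq_eq_zero (hL' : 0 < L) (n : ℕ) :
    edgeDeriv hL 0 (((n * Real.pi / L) ^ 2 : ℝ) : ℂ) = 0 := by
  have hLc : (L : ℂ) ≠ 0 := by exact_mod_cast hL'.ne'
  rw [Complex.ofReal_pow, edgeDeriv_free_sq]
  push_cast
  rw [div_mul_cancel₀ _ hLc, Complex.sin_nat_mul_pi, mul_zero]

open Classical in
-- For `k ≠ 0` a double zero would force sine and cosine to vanish together. At the origin `k sin (k
-- L)` has a double zero in `k`, but a simple one in `z = k²`; this makes `n = 0` count once.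
theorem analyticOrderAt_edgeDeriv_free (hL' : 0 < L) (z : ℂ) :
    analyticOrderAt (edgeDeriv hL 0) z = (if edgeDeriv hL 0 z = 0 then 1 else 0 : ℕ) := by
  have han := (differentiable_edgeDeriv hL 0).analyticAt z
  have hLc : (L : ℂ) ≠ 0 := by exact_mod_cast hL'.ne'
  split_ifs with hz
  · have hd : deriv (edgeDeriv hL 0) z ≠ 0 := by
      obtain ⟨k, rfl⟩ := IsAlgClosed.exists_pow_nat_eq z (n := 2) (by norm_num)
      by_cases hk : k = 0
      · simpa [hk, deriv_edgeDeriv_free_zero] using hL'.ne'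
      · intro h
        have h1 := deriv_edgeDeriv_free_sq hL k
        rw [edgeDeriv_free_sq, mul_eq_zero, neg_eq_zero, or_iff_right hk] at hz
        rw [h, hz, zero_mul, neg_zero, zero_sub, eq_comm, neg_eq_zero] at h1
        have h2 := Complex.sin_sq_add_cos_sq (k * L)
        rw [hz, (mul_eq_zero.1 h1).resolve_left (mul_ne_zero hk hLc)] at h2
        simp at h2
    have h1 := han.analyticOrderAt_sub_eq_one_of_deriv_ne_zero hd
    simpa [hz] using h1
  · simpa using han.analyticOrderAt_eq_zero.2 hz

/-- The zeros `(n π / L) ^ 2` below `N ^ 2`. -/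
def freeZeros (L N : ℝ) : Finset ℂ :=
  (Finset.range (⌊N * L / Real.pi⌋₊ + 1)).image fun n : ℕ => (((n * Real.pi / L) ^ 2 : ℝ) : ℂ)

theorem card_freeZeros (hL' : 0 < L) (N : ℝ) :
    (freeZeros L N).card = ⌊N * L / Real.pi⌋₊ + 1 := by
  have hpi := Real.pi_pos
  rw [freeZeros, Finset.card_image_of_injective, Finset.card_range]
  intro a b h
  have h1 := Complex.ofReal_injective h
  have h2 := (sq_eq_sq₀ (by positivity) (by positivity)).1 h1
  field_simp at h2
  exact_mod_cast h2

theorem mem_freeZeros (hL' : 0 < L) {N : ℝ} (hN : 0 < N)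
    (h0 : ∀ z ∈ Metric.sphere (0 : ℂ) (N ^ 2), edgeDeriv hL 0 z ≠ 0) (z : ℂ) :
    z ∈ freeZeros L N ↔ z ∈ Metric.ball 0 (N ^ 2) ∧ edgeDeriv hL 0 z = 0 := by
  have hpi := Real.pi_pos
  have hnorm : ∀ n : ℕ, ‖(((n * Real.pi / L) ^ 2 : ℝ) : ℂ)‖ = (n * Real.pi / L) ^ 2 := fun n => by
    rw [Complex.norm_real, Real.norm_of_nonneg (by positivity)]
  constructor
  · intro h
    obtain ⟨n, hn, rfl⟩ := Finset.mem_image.1 h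
    have hz := edgeDeriv_free_sq_eq_zero hL hL' n
    refine ⟨?_, hz⟩
    have hn1 : (n : ℝ) ≤ N * L / Real.pi := (Nat.le_floor_iff (by positivity)).1
      (Nat.lt_succ_iff.1 (Finset.mem_range.1 hn))
    have h1 : n * Real.pi / L ≤ N := by
      rw [div_le_iff₀ hL']
      rwa [le_div_iff₀ hpi] at hn1
    have h2 : (n * Real.pi / L) ^ 2 ≤ N ^ 2 := pow_le_pow_left₀ (by positivity) h1 2
    rw [mem_ball_zero_iff, hnorm]
    -- The floor admits `n π / L = N`; such a zero would lie on the circle, where none is allowed.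
    refine lt_of_le_of_ne h2 fun h3 => h0 _ ?_ hz
    rw [mem_sphere_zero_iff_norm, hnorm, h3]
  · rintro ⟨h1, h2⟩
    obtain ⟨n, rfl⟩ := exists_nat_of_edgeDeriv_free_eq_zero hL hL' h2
    refine Finset.mem_image.2 ⟨n, Finset.mem_range.2 (Nat.lt_succ_iff.2 (Nat.le_floor ?_)), rfl⟩
    rw [mem_ball_zero_iff, hnorm] at h1
    have h3 := lt_of_pow_lt_pow_left₀ 2 hN.le h1
    rw [div_lt_iff₀ hL'] at h3
    rw [le_div_iff₀ hpi]
    exact h3.le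

theorem circleIntegral_logDeriv_edgeDeriv (hL' : 0 < L) {N : ℝ} (hN : 0 < N)
    (h0 : ∀ z ∈ Metric.sphere (0 : ℂ) (N ^ 2), edgeDeriv hL 0 z ≠ 0) :
    (∮ z in C(0, N ^ 2), logDeriv (edgeDeriv hL 0) z) =
      2 * Real.pi * Complex.I * (⌊N * L / Real.pi⌋₊ + 1 : ℕ) := by
  classical
  have h := circleIntegral_mul_logDeriv (differentiable_edgeDeriv hL 0)
    (analyticOrderAt_edgeDeriv_free hL hL') (by positivity : 0 < N ^ 2) h0 (freeZeros L N)
    (mem_freeZeros hL hL' hN h0) (φ := fun _ => 1) (differentiable_const 1)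
  simp only [one_mul, mul_one] at h
  rw [h, ← card_freeZeros hL' N, ← Nat.cast_sum]
  congr 2
  rw [Finset.card_eq_sum_ones]
  refine Finset.sum_congr rfl fun a ha => ?_
  rw [if_pos ((mem_freeZeros hL hL' hN h0 a).1 ha).2]

/-- This identifies the unbounded cotangent in the edge asymptotics with a logarithmic derivative,
whose contour integral is a zero count, up to the term `1 / (2 z)`. -/
theorem logDeriv_edgeDeriv_free_sq {k : ℂ} (hk : k ≠ 0) (hs : expSin k L ≠ 0) :
    logDeriv (edgeDeriv hL 0) (k ^ 2) =
      (k ^ 2)⁻¹ * (1 / 2 + L / 2 * (k * (expCos k L * (expSin k L)⁻¹))) := by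
  have h1 := deriv_edgeDeriv_free_sq hL k
  have he := expk_ne_zero k L
  have hs' : Complex.sin (k * L) ≠ 0 := right_ne_zero_of_mul hs
  rw [logDeriv_apply, edgeDeriv_free_sq, expCos, expSin]
  have h2 : deriv (edgeDeriv hL 0) (k ^ 2) =
      (-Complex.sin (k * L) - k * L * Complex.cos (k * L)) / (2 * k) := by
    rw [← h1]; field_simp
  rw [h2]
  field_simp
  ring

end Edge

section Graph

variable {d : ℕ} {ℓ : Fin d → ℝ} (hℓ : ∀ i, 0 < ℓ i)

/-- The secular function of the decoupled edges without potential. -/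
def freeFun (z : ℂ) : ℂ := ∏ i, edgeDeriv (hℓ i).le 0 z

theorem differentiable_freeFun : Differentiable ℂ (freeFun hℓ) := by
  unfold freeFun
  have := fun i => differentiable_edgeDeriv (hℓ i).le 0
  fun_prop

open Classical in
/-- The order of `freeFun` at `z`. -/
def freeOrder (z : ℂ) : ℕ := ∑ i, if edgeDeriv (hℓ i).le 0 z = 0 then 1 else 0

open Classical in
theorem analyticOrderAt_freeFun (z : ℂ) : analyticOrderAt (freeFun hℓ) z = freeOrder hℓ z := by
  have h : ∀ s : Finset (Fin d), analyticOrderAt (fun z => ∏ i ∈ s, edgeDeriv (hℓ i).le 0 z) z =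
      (∑ i ∈ s, if edgeDeriv (hℓ i).le 0 z = 0 then 1 else 0 : ℕ) := by
    intro s
    induction s using Finset.induction_on with
    | empty =>
      simp only [Finset.prod_empty, Finset.sum_empty]
      exact (analyticAt_const.analyticOrderAt_eq_zero).2 one_ne_zero
    | insert i s hi ih =>
      have h1 : (fun z => ∏ j ∈ insert i s, edgeDeriv (hℓ j).le 0 z) =
          edgeDeriv (hℓ i).le 0 * fun z => ∏ j ∈ s, edgeDeriv (hℓ j).le 0 z := by
        funext w
        rw [Finset.prod_insert hi]
        rfl
      have h2 : Differentiable ℂ fun z => ∏ j ∈ s, edgeDeriv (hℓ j).le 0 z := by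
        have := fun i => differentiable_edgeDeriv (hℓ i).le 0
        fun_prop
      rw [h1, analyticOrderAt_mul ((differentiable_edgeDeriv (hℓ i).le 0).analyticAt z)
        (h2.analyticAt z), ih, analyticOrderAt_edgeDeriv_free (hℓ i).le (hℓ i),
        Finset.sum_insert hi, Nat.cast_add]
  exact h Finset.univ

/-- The number of zeros `n π / ℓᵢ` up to `N`. -/
def zeroCount (ℓ : Fin d → ℝ) (N : ℝ) : ℕ := ∑ i, (⌊N * ℓ i / Real.pi⌋₊ + 1)

theorem sum_freeOrder {N : ℝ} (hN : 0 < N)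
    (h0 : ∀ i, ∀ z ∈ Metric.sphere (0 : ℂ) (N ^ 2), edgeDeriv (hℓ i).le 0 z ≠ 0) (Z : Finset ℂ)
    (hZ : ∀ z, z ∈ Z ↔ z ∈ Metric.ball 0 (N ^ 2) ∧ freeFun hℓ z = 0) :
    ∑ a ∈ Z, freeOrder hℓ a = zeroCount ℓ N := by
  classical
  simp only [freeOrder, zeroCount]
  rw [Finset.sum_comm]
  refine Finset.sum_congr rfl fun i _ => ?_
  rw [← Finset.sum_filter, ← Finset.card_eq_sum_ones, ← card_freeZeros (hℓ i) N]
  congr 1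
  ext z
  rw [Finset.mem_filter, hZ, mem_freeZeros (hℓ i).le (hℓ i) hN (h0 i)]
  constructor
  · rintro ⟨⟨h1, -⟩, h2⟩
    exact ⟨h1, h2⟩
  · rintro ⟨h1, h2⟩
    exact ⟨⟨h1, Finset.prod_eq_zero (Finset.mem_univ i) h2⟩, h2⟩

end Graph

end QuantumGraph

end

noncomputable section

namespace QuantumGraph

open scoped BoundedContinuousFunction
open Asymptotics

/-! ### Contour integrals over the circles of radius `N ^ 2` -/

/-- The square root in the closed upper half plane. -/
def upperSqrt (z : ℂ) : ℂ :=
  if 0 ≤ (z ^ ((2 : ℕ) : ℂ)⁻¹).im then z ^ ((2 : ℕ) : ℂ)⁻¹ else -z ^ ((2 : ℕ) : ℂ)⁻¹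

theorem upperSqrt_sq (z : ℂ) : upperSqrt z ^ 2 = z := by
  have h : (z ^ ((2 : ℕ) : ℂ)⁻¹) ^ 2 = z := Complex.cpow_nat_inv_pow z two_ne_zero
  rw [upperSqrt]
  split_ifs
  · exact h
  · rw [neg_sq, h]

theorem upperSqrt_im_nonneg (z : ℂ) : 0 ≤ (upperSqrt z).im := by
  rw [upperSqrt]
  split_ifs with h
  · exact h
  · rw [Complex.neg_im]
    linarith

theorem norm_upperSqrt_sq (z : ℂ) : ‖upperSqrt z‖ ^ 2 = ‖z‖ := by
  rw [← norm_pow, upperSqrt_sq]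

theorem upperSqrt_im (z : ℂ) : (upperSqrt z).im = Real.sqrt ((‖z‖ - z.re) / 2) := by
  rw [eq_comm, ← Real.sqrt_sq (upperSqrt_im_nonneg z)]
  congr 1
  have h1 := norm_upperSqrt_sq z
  have h2 : z.re = (upperSqrt z ^ 2).re := by rw [upperSqrt_sq]
  rw [← Complex.normSq_eq_norm_sq, Complex.normSq_apply] at h1
  rw [sq, Complex.mul_re] at h2
  rw [← h1, h2]
  ring

/-- The imaginary part is `N` times the square root of `(1 - cos θ) / 2`, so only the positive axis
is exceptional. -/
theorem tendsto_upperSqrt_im {θ : ℝ} (hθ : Real.cos θ < 1) :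
    Tendsto (fun N : ℝ => (upperSqrt (circleMap 0 (N ^ 2) θ)).im) atTop atTop := by
  have hpos : 0 < Real.sqrt ((1 - Real.cos θ) / 2) := Real.sqrt_pos.2 (by linarith)
  have h : ∀ᶠ N : ℝ in atTop, N * Real.sqrt ((1 - Real.cos θ) / 2) =
      (upperSqrt (circleMap 0 (N ^ 2) θ)).im := by
    filter_upwards [eventually_ge_atTop 0] with N hN
    rw [upperSqrt_im]
    have h1 : ‖circleMap 0 (N ^ 2) θ‖ = N ^ 2 := by
      rw [norm_circleMap_zero, abs_of_nonneg (sq_nonneg N)]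
    have h2 : (circleMap 0 (N ^ 2) θ).re = N ^ 2 * Real.cos θ := by
      rw [circleMap_zero, Complex.re_ofReal_mul, Complex.exp_ofReal_mul_I_re]
    rw [h1, h2, show (N ^ 2 - N ^ 2 * Real.cos θ) / 2 = N ^ 2 * ((1 - Real.cos θ) / 2) by ring,
      Real.sqrt_mul (sq_nonneg N), Real.sqrt_sq hN]
  exact (tendsto_id.atTop_mul_const hpos).congr' h

/-- This transfers asymptotics in `k` to entire circles in `z`: a point with `|z| = N²` has a root
with `|k| = N`, at which admissibility of `N` bounds the normalised sines from below. -/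
theorem exists_eventually_of_sectorFilter {d : ℕ} {ℓ : Fin d → ℝ} (hℓ : ∀ i, 0 < ℓ i) {ε : ℝ}
    (hε : 0 < ε) : ∃ c > 0, ∀ P : ℂ → Prop, (∀ᶠ k in sectorFilter ℓ c, P k) →
      ∀ᶠ N in atTop ⊓ 𝓟 (admissibleCutoffs ℓ ε), 0 < N ∧
        ∀ z ∈ Metric.sphere (0 : ℂ) (N ^ 2), P (upperSqrt z) := by
  obtain ⟨c, hc, h⟩ := exists_le_norm_expSin hε
  refine ⟨c, hc, fun P hP => ?_⟩
  obtain ⟨R, hR⟩ := exists_of_eventually_sectorFilter hP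
  rw [eventually_inf_principal]
  filter_upwards [eventually_ge_atTop R, eventually_gt_atTop 0] with N hN hN0 hadm
  refine ⟨hN0, fun z hz => ?_⟩
  have hnorm : ‖upperSqrt z‖ = N := by
    have h1 := norm_upperSqrt_sq z
    rw [mem_sphere_zero_iff_norm.1 hz] at h1
    exact (sq_eq_sq₀ (norm_nonneg _) hN0.le).1 h1
  exact hR _ (by rw [hnorm]; exact hN) (upperSqrt_im_nonneg z) fun i =>
    h _ _ (hℓ i).le (upperSqrt_im_nonneg z)
      (le_norm_sub_of_mem_admissibleCutoffs hℓ hadm hnorm i)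

section Graph

variable {d : ℕ} {ℓ : Fin d → ℝ} (hℓ : ∀ i, 0 < ℓ i) (p : Fin d → ℝ →ᵇ ℂ)
  (A : Matrix (Ends d) (Ends d) ℂ)

theorem eventually_sphere_free {ε : ℝ} (hε : 0 < ε) :
    ∀ᶠ N in atTop ⊓ 𝓟 (admissibleCutoffs ℓ ε), 0 < N ∧
      ∀ z ∈ Metric.sphere (0 : ℂ) (N ^ 2), upperSqrt z ≠ 0 ∧
        (∀ i, expSin (upperSqrt z) (ℓ i) ≠ 0) ∧ (∀ i, edgeDeriv (hℓ i).le 0 z ≠ 0) ∧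
        secFun hℓ p A z / freeFun hℓ z ∈ Complex.slitPlane ∧
        secFun hℓ p A z / secFun hℓ 0 A z ∈ Complex.slitPlane := by
  obtain ⟨c, hc, h⟩ := exists_eventually_of_sectorFilter hℓ hε
  have hinf := tendsto_norm_sectorFilter ℓ c
  have hsec := eventually_sectorFilter ℓ c
  have him := hsec.mono fun _ hk => hk.1
  have hs : ∀ i, ∀ᶠ k in sectorFilter ℓ c, c ≤ ‖expSin k (ℓ i)‖ := fun i =>
    hsec.mono fun _ hk => hk.2 i
  have h1 := tendsto_secFun_div_prod hℓ p A hinf him hc hs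
  have h2 := h1.div (tendsto_secFun_div_prod hℓ 0 A hinf him hc hs) one_ne_zero
  rw [div_one] at h2
  have hslit := Complex.isOpen_slitPlane.mem_nhds Complex.one_mem_slitPlane
  refine (h _ ((eventually_regular hinf him 0).and (hsec.and
    ((eventually_edgeDeriv_ne_zero hℓ 0 hinf him hc hs).and
      ((h1.eventually hslit).and (h2.eventually hslit)))))).mono fun N hN => ⟨hN.1, fun z hz => ?_⟩
  obtain ⟨⟨hk, -⟩, ⟨-, hS⟩, hD, hq1, hq2⟩ := hN.2 z hz
  simp only [Pi.div_apply, upperSqrt_sq] at hD hq1 hq2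
  refine ⟨hk, fun i => norm_pos_iff.1 (hc.trans_le (hS i)), hD, hq1, ?_⟩
  have hne : (∏ i, edgeDeriv (hℓ i).le 0 z) ≠ 0 := Finset.prod_ne_zero_iff.2 fun i _ => hD i
  rwa [div_div_div_cancel_right₀ hne] at hq2

/-- Rouché's theorem against the decoupled free edges, as the weighted formula with `φ = 1`, whose
right-hand side vanishes. The count is the same for every potential, which justifies pairing
eigenvalues with sine zeros. -/
theorem eventually_sum_order_eq_zeroCount {ε : ℝ} (hε : 0 < ε) {m : ℂ → ℕ}
    (hm : ∀ a, analyticOrderAt (secFun hℓ p A) a = m a) :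
    ∀ᶠ N in atTop ⊓ 𝓟 (admissibleCutoffs ℓ ε), ∀ Z : Finset ℂ,
      (∀ z, z ∈ Z ↔ z ∈ Metric.ball 0 (N ^ 2) ∧ secFun hℓ p A z = 0) →
      ∑ a ∈ Z, m a = zeroCount ℓ N := by
  filter_upwards [eventually_sphere_free hℓ p A hε] with N ⟨hN, h⟩ Z hZ
  have hfin := finite_zeros_inter_closedBall (differentiable_freeFun hℓ)
    (fun a => by rw [analyticOrderAt_freeFun]; exact ENat.natCast_ne_top _) (N ^ 2)
  have hfin' : {z | z ∈ Metric.ball (0 : ℂ) (N ^ 2) ∧ freeFun hℓ z = 0}.Finite :=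
    hfin.subset fun z hz => ⟨Metric.ball_subset_closedBall hz.1, hz.2⟩
  have hZ₂ : ∀ z, z ∈ hfin'.toFinset ↔ z ∈ Metric.ball 0 (N ^ 2) ∧ freeFun hℓ z = 0 := fun z => by
    simp
  have h1 := sum_zeros_sub_sum_zeros (differentiable_secFun hℓ p A) (differentiable_freeFun hℓ)
    hm (analyticOrderAt_freeFun hℓ) (by positivity : 0 < N ^ 2) (fun z hz => (h z hz).2.2.2.1)
    Z hfin'.toFinset hZ hZ₂ (φ := fun _ => 1) (differentiable_const 1)
  simp only [mul_one, deriv_const', zero_mul, circleIntegral, smul_zero,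
    intervalIntegral.integral_zero, neg_zero] at h1
  have h2 := sub_eq_zero.1 ((mul_eq_zero.1 h1).resolve_left (by simp [Real.pi_ne_zero]))
  rw [← sum_freeOrder hℓ hN (fun i z hz => (h z hz).2.2.1 i) _ hZ₂]
  exact_mod_cast h2

/-- The mean of the remainder `graphLog` over the circle of radius `N ^ 2`, up to a factor. -/
def circleLog (N : ℝ) : ℂ :=
  ∫ θ in (0 : ℝ)..2 * Real.pi, graphLog hℓ p A (upperSqrt (circleMap 0 (N ^ 2) θ))

/-- The function whose values, multiplied by the energy, are those of `graphLog`. -/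
def graphLogDiv (z : ℂ) : ℂ :=
  Complex.log (secFun hℓ p A z / secFun hℓ 0 A z) +
    ∑ i, (∫ t in (0 : ℝ)..ℓ i, p i t) / ℓ i *
      (logDeriv (edgeDeriv (hℓ i).le 0) z - 1 / 2 * (z - 0)⁻¹)

theorem graphLog_upperSqrt {z : ℂ} (hk : upperSqrt z ≠ 0)
    (hs : ∀ i, expSin (upperSqrt z) (ℓ i) ≠ 0) :
    graphLog hℓ p A (upperSqrt z) = z * graphLogDiv hℓ p A z := by
  have hz : z ≠ 0 := by
    rw [← upperSqrt_sq z]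
    exact pow_ne_zero 2 hk
  rw [graphLog, graphLogDiv, upperSqrt_sq, mul_add, Finset.mul_sum]
  congr 1
  refine Finset.sum_congr rfl fun i _ => ?_
  have hi : (ℓ i : ℂ) ≠ 0 := by exact_mod_cast (hℓ i).ne'
  have h := logDeriv_edgeDeriv_free_sq (hℓ i).le hk (hs i)
  rw [upperSqrt_sq] at h
  rw [h, sub_zero]
  generalize upperSqrt z * (expCos (upperSqrt z) (ℓ i) * (expSin (upperSqrt z) (ℓ i))⁻¹) = w
  field_simp
  ring

theorem continuousAt_logDeriv_edgeDeriv {z : ℂ} {i : Fin d}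
    (h : edgeDeriv (hℓ i).le 0 z ≠ 0) :
    ContinuousAt (logDeriv (edgeDeriv (hℓ i).le 0)) z := by
  have han := (differentiable_edgeDeriv (hℓ i).le 0).analyticAt z
  exact han.deriv.continuousAt.div han.continuousAt h

theorem continuousAt_log_secFun_div {z : ℂ}
    (hq : secFun hℓ p A z / secFun hℓ 0 A z ∈ Complex.slitPlane) :
    ContinuousAt (fun z => Complex.log (secFun hℓ p A z / secFun hℓ 0 A z)) z := by
  have h0 : secFun hℓ 0 A z ≠ 0 := fun h => Complex.slitPlane_ne_zero hq (by rw [h, div_zero])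
  exact (((differentiable_secFun hℓ p A) z).continuousAt.div
    ((differentiable_secFun hℓ 0 A) z).continuousAt h0).clog hq

/-- As `dz = i z dθ`, dividing `graphLog` by `z` turns the angular mean into a contour integral;
each logarithmic derivative then yields the number of zeros and `1 / (2 z)` yields the `1/2`.
Continuity needs an argument because `upperSqrt` jumps across the positive axis, whereas
`graphLogDiv` depends on `z` only. -/
theorem eventually_circleLog_eq {ε : ℝ} (hε : 0 < ε) :
    ∀ᶠ N in atTop ⊓ 𝓟 (admissibleCutoffs ℓ ε),
      Continuous (fun θ => graphLog hℓ p A (upperSqrt (circleMap 0 (N ^ 2) θ))) ∧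
      Complex.I * circleLog hℓ p A N =
        (∮ z in C(0, N ^ 2), Complex.log (secFun hℓ p A z / secFun hℓ 0 A z)) +
        ∑ i, (∫ t in (0 : ℝ)..ℓ i, p i t) / ℓ i *
          (2 * Real.pi * Complex.I * ((⌊N * ℓ i / Real.pi⌋₊ + 1 : ℕ) - 1 / 2)) := by
  filter_upwards [eventually_sphere_free hℓ p A hε] with N ⟨hN, h⟩
  have hN2 : 0 < N ^ 2 := by positivity
  have hmem : ∀ θ, circleMap 0 (N ^ 2) θ ∈ Metric.sphere (0 : ℂ) (N ^ 2) := fun θ =>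
    circleMap_mem_sphere 0 hN2.le θ
  have hz0 : ∀ z ∈ Metric.sphere (0 : ℂ) (N ^ 2), z - 0 ≠ 0 := fun z hz hz' => by
    rw [sub_zero] at hz'
    rw [hz', mem_sphere_zero_iff_norm, norm_zero] at hz
    exact hN2.ne hz
  have hclog : ∀ z ∈ Metric.sphere (0 : ℂ) (N ^ 2),
      ContinuousAt (fun z => Complex.log (secFun hℓ p A z / secFun hℓ 0 A z)) z := fun z hz =>
    continuousAt_log_secFun_div hℓ p A (h z hz).2.2.2.2
  have hcinv : ∀ z ∈ Metric.sphere (0 : ℂ) (N ^ 2),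
      ContinuousAt (fun z : ℂ => 1 / 2 * (z - 0)⁻¹) z := fun z hz =>
    continuousAt_const.mul ((continuousAt_id.sub continuousAt_const).inv₀ (hz0 z hz))
  have hcld : ∀ i, ∀ z ∈ Metric.sphere (0 : ℂ) (N ^ 2),
      ContinuousAt (logDeriv (edgeDeriv (hℓ i).le 0)) z := fun i z hz =>
    continuousAt_logDeriv_edgeDeriv hℓ ((h z hz).2.2.1 i)
  have hint : ∀ {f : ℂ → ℂ}, (∀ z ∈ Metric.sphere (0 : ℂ) (N ^ 2), ContinuousAt f z) →
      CircleIntegrable f 0 (N ^ 2) := fun hf =>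
    ContinuousOn.circleIntegrable hN2.le fun z hz => (hf z hz).continuousWithinAt
  have hterm : ∀ i, ∀ z ∈ Metric.sphere (0 : ℂ) (N ^ 2), ContinuousAt (fun z =>
      (∫ t in (0 : ℝ)..ℓ i, p i t) / ℓ i *
        (logDeriv (edgeDeriv (hℓ i).le 0) z - 1 / 2 * (z - 0)⁻¹)) z := fun i z hz =>
    continuousAt_const.mul ((hcld i z hz).sub (hcinv z hz))
  have hsum : ∀ z ∈ Metric.sphere (0 : ℂ) (N ^ 2), ContinuousAt (fun z =>
      ∑ i, (∫ t in (0 : ℝ)..ℓ i, p i t) / ℓ i *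
        (logDeriv (edgeDeriv (hℓ i).le 0) z - 1 / 2 * (z - 0)⁻¹)) z := fun z hz =>
    tendsto_finsetSum _ fun i _ => hterm i z hz
  have hcB : ∀ z ∈ Metric.sphere (0 : ℂ) (N ^ 2), ContinuousAt (graphLogDiv hℓ p A) z :=
    fun z hz => (hclog z hz).add (hsum z hz)
  have hpt : ∀ θ, graphLog hℓ p A (upperSqrt (circleMap 0 (N ^ 2) θ)) =
      circleMap 0 (N ^ 2) θ * graphLogDiv hℓ p A (circleMap 0 (N ^ 2) θ) := fun θ =>
    graphLog_upperSqrt hℓ p A (h _ (hmem θ)).1 (h _ (hmem θ)).2.1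
  constructor
  · simp only [hpt]
    refine (continuous_circleMap 0 _).mul (continuous_iff_continuousAt.2 fun θ => ?_)
    exact ContinuousAt.comp (f := circleMap 0 (N ^ 2)) (hcB _ (hmem θ))
      (continuous_circleMap 0 _).continuousAt
  · have h1 : Complex.I * circleLog hℓ p A N = ∮ z in C(0, N ^ 2), graphLogDiv hℓ p A z := by
      rw [circleLog, circleIntegral, ← intervalIntegral.integral_const_mul]
      refine intervalIntegral.integral_congr fun θ _ => ?_
      simp only [hpt, deriv_circleMap, smul_eq_mul]
      ring
    rw [h1]
    simp only [graphLogDiv]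
    rw [circleIntegral.integral_add (hint hclog) (hint hsum),
      circleIntegral.integral_fun_sum fun i _ => hint (hterm i)]
    congr 1
    refine Finset.sum_congr rfl fun i _ => ?_
    rw [circleIntegral.integral_const_mul,
      circleIntegral.integral_sub (hint (hcld i)) (hint hcinv),
      circleIntegral_logDeriv_edgeDeriv (hℓ i).le (hℓ i) hN fun z hz => (h z hz).2.2.1 i,
      circleIntegral.integral_const_mul, circleIntegral.integral_sub_center_inv _ hN2.ne']
    ring

/-- Dominated convergence in the angle. The uniform bound holds up to the positive axis because the
cut-offs are admissible; the limit is needed only for almost every angle and comes from `Im k → ∞`.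
-/
theorem tendsto_circleLog {ε : ℝ} (hε : 0 < ε)
    {g : Fin d → ℝ → ℂ} (hg : ∀ i, HasWeakDeriv (ℓ i) (p i) (g i)) :
    Tendsto (circleLog hℓ p A) (atTop ⊓ 𝓟 (admissibleCutoffs ℓ ε))
      (𝓝 (2 * Real.pi * ∑ i, -(p i (ℓ i) + p i 0) / 4)) := by
  obtain ⟨c, hc, h⟩ := exists_eventually_of_sectorFilter hℓ hε
  have hsec := eventually_sectorFilter ℓ c
  obtain ⟨C, hC⟩ := (isBigO_graphLog hℓ p A (tendsto_norm_sectorFilter ℓ c)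
    (hsec.mono fun _ hk => hk.1) hc (fun i => hsec.mono fun _ hk => hk.2 i) hg).bound
  have hlim : (2 * Real.pi * ∑ i, -(p i (ℓ i) + p i 0) / 4 : ℂ) =
      ∫ _ in (0 : ℝ)..2 * Real.pi, ∑ i, -(p i (ℓ i) + p i 0) / 4 := by
    rw [intervalIntegral.integral_const, sub_zero, Complex.real_smul]
    push_cast
    ring
  rw [hlim]
  refine intervalIntegral.tendsto_integral_filter_of_dominated_convergence (fun _ => C) ?_ ?_
    intervalIntegrable_const ?_
  · filter_upwards [eventually_circleLog_eq hℓ p A hε] with N hN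
    exact hN.1.aestronglyMeasurable
  · filter_upwards [h _ hC] with N hN
    refine Eventually.of_forall fun θ _ => ?_
    simpa using hN.2 _ (circleMap_mem_sphere 0 (sq_nonneg N) θ)
  · have hne : ∀ᵐ θ : ℝ, θ ≠ 2 * Real.pi := by simp [ae_iff]
    filter_upwards [hne] with θ hθ hmem
    rw [Set.uIoc_of_le (by positivity)] at hmem
    have hcos : Real.cos θ < 1 := by
      refine lt_of_le_of_ne (Real.cos_le_one θ) fun h1 => ?_
      have h2 := (Real.cos_eq_one_iff_of_lt_of_lt (by linarith [hmem.1, Real.pi_pos])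
        (lt_of_le_of_ne hmem.2 hθ)).1 h1
      exact hmem.1.ne' h2
    have h3 : Tendsto Complex.im (map (fun N : ℝ => upperSqrt (circleMap 0 (N ^ 2) θ))
        (atTop ⊓ 𝓟 (admissibleCutoffs ℓ ε))) atTop :=
      tendsto_map'_iff.2 ((tendsto_upperSqrt_im hcos).mono_left inf_le_left)
    exact tendsto_map'_iff.1 (tendsto_graphLog hℓ p A h3 hg)

end Graph

end QuantumGraph

end

noncomputable section

namespace QuantumGraph

open scoped BoundedContinuousFunction

/-! ### The eigenvalues in increasing order -/

section Graph

variable {d : ℕ} {ℓ : Fin d → ℝ} (hℓ : ∀ i, 0 < ℓ i) (p : Fin d → ℝ →ᵇ ℂ)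

theorem im_eq_zero_of_secFun_eq_zero (hp : ∀ i x, starRingEnd ℂ (p i x) = p i x)
    {A : Matrix (Ends d) (Ends d) ℂ} (hA : A.IsHermitian) {z : ℂ} (hz : secFun hℓ p A z = 0) :
    z.im = 0 := by
  by_contra him
  obtain ⟨v, hv, hv'⟩ := Matrix.exists_mulVec_eq_zero_iff.2 hz
  exact hv (secMatrix_injective hℓ p hp hA him hv')

/-- Along `k = i t` the secular function is asymptotic to a product of free edge functions, so it
has no zeros `-t²` with `t` large; all its zeros are real. -/
theorem exists_le_re_of_secFun_eq_zero (hp : ∀ i x, starRingEnd ℂ (p i x) = p i x)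
    {A : Matrix (Ends d) (Ends d) ℂ} (hA : A.IsHermitian) :
    ∃ K : ℝ, ∀ z, secFun hℓ p A z = 0 → -K ≤ z.re := by
  have hl : Tendsto Complex.im (map (fun t : ℝ => (t : ℂ) * Complex.I) atTop) atTop := by
    refine tendsto_map'_iff.2 ?_
    simpa [Function.comp_def] using! tendsto_id
  have h1 := (tendsto_secFun_div_prod hℓ p A (tendsto_norm_of_im hl) (hl.eventually_ge_atTop 0)
    (by norm_num : (0 : ℝ) < 1 / 4) fun i => eventually_expSin (hℓ i) hl).eventually_ne one_ne_zero
  obtain ⟨R, hR⟩ := eventually_atTop.1 (eventually_map.1 h1)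
  refine ⟨R ^ 2, fun z hz => ?_⟩
  by_contra! hlt
  have him := im_eq_zero_of_secFun_eq_zero hℓ p hp hA hz
  refine hR (Real.sqrt (-z.re)) (Real.le_sqrt_of_sq_le (by linarith)) ?_
  have hsq : ((Real.sqrt (-z.re) : ℂ) * Complex.I) ^ 2 = z := by
    rw [mul_pow, Complex.I_sq, ← Complex.ofReal_pow,
      Real.sq_sqrt (by nlinarith [sq_nonneg R])]
    apply Complex.ext <;> simp [him]
  rw [hsq, hz, zero_div]

theorem tendsto_zeroCount (hd : 0 < d) (hℓ : ∀ i, 0 < ℓ i) :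
    Tendsto (zeroCount ℓ) atTop atTop := by
  have h1 : Tendsto (fun N : ℝ => ⌊N * ℓ ⟨0, hd⟩ / Real.pi⌋₊) atTop atTop :=
    tendsto_nat_floor_atTop.comp
      ((tendsto_id.atTop_mul_const (hℓ ⟨0, hd⟩)).atTop_div_const Real.pi_pos)
  refine tendsto_atTop_mono (fun N => ?_) h1
  exact (Nat.le_succ _).trans (Finset.single_le_sum
    (f := fun i => ⌊N * ℓ i / Real.pi⌋₊ + 1) (fun i _ => Nat.zero_le _)
    (Finset.mem_univ (⟨0, hd⟩ : Fin d)))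

theorem secFun_eq_zero_iff {A : Matrix (Ends d) (Ends d) ℂ} {m : ℂ → ℕ}
    (hm : ∀ a, analyticOrderAt (secFun hℓ p A) a = m a) (z : ℂ) :
    secFun hℓ p A z = 0 ↔ m z ≠ 0 := by
  have h := ((differentiable_secFun hℓ p A).analyticAt z).analyticOrderAt_eq_zero
  rw [hm, Nat.cast_eq_zero] at h
  rw [Ne, h, not_not]

theorem exists_zeros_finset {A : Matrix (Ends d) (Ends d) ℂ} {m : ℂ → ℕ}
    (hm : ∀ a, analyticOrderAt (secFun hℓ p A) a = m a) (R : ℝ) :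
    ∃ Z : Finset ℂ, ∀ z, z ∈ Z ↔ z ∈ Metric.ball 0 R ∧ secFun hℓ p A z = 0 := by
  have hfin := finite_zeros_inter_closedBall (differentiable_secFun hℓ p A)
    (fun a => by rw [hm]; exact ENat.natCast_ne_top _) R
  have hfin' : {z | z ∈ Metric.ball (0 : ℂ) R ∧ secFun hℓ p A z = 0}.Finite :=
    hfin.subset fun z hz => ⟨Metric.ball_subset_closedBall hz.1, hz.2⟩
  exact ⟨hfin'.toFinset, fun z => by simp⟩

/-- With finitely many zeros the sums of their orders would be bounded, but at admissible cut-offs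
these sums equal the unbounded `zeroCount`. -/
theorem infinite_zeros (hd : 0 < d) {A : Matrix (Ends d) (Ends d) ℂ} {m : ℂ → ℕ}
    (hm : ∀ a, analyticOrderAt (secFun hℓ p A) a = m a) : {z | secFun hℓ p A z = 0}.Infinite := by
  intro hfin
  obtain ⟨ε, hε, hfreq⟩ := exists_frequently_admissibleCutoffs hℓ
  have h1 := eventually_inf_principal.1 (eventually_sum_order_eq_zeroCount hℓ p A hε hm)
  have h2 := (tendsto_zeroCount hd hℓ).eventually_gt_atTop (∑ a ∈ hfin.toFinset, m a)
  obtain ⟨N, hN, hN1, hN2⟩ := (hfreq.and_eventually (h1.and h2)).exists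
  obtain ⟨Z, hZ⟩ := exists_zeros_finset hℓ p hm (N ^ 2)
  rw [← hN1 hN Z hZ] at hN2
  refine hN2.not_ge (Finset.sum_le_sum_of_subset fun z hz => ?_)
  simpa using ((hZ z).1 hz).2

theorem exists_monotone_zeros (hd : 0 < d) (hp : ∀ i x, starRingEnd ℂ (p i x) = p i x)
    {A : Matrix (Ends d) (Ends d) ℂ} (hA : A.IsHermitian) {m : ℂ → ℕ}
    (hm : ∀ a, analyticOrderAt (secFun hℓ p A) a = m a) :
    ∃ lam : ℕ → ℝ, Monotone lam ∧ ∀ z : ℂ, {n : ℕ | (lam n : ℂ) = z}.encard = m z := by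
  obtain ⟨K, hK⟩ := exists_le_re_of_secFun_eq_zero hℓ p hp hA
  have hreal : ∀ z, secFun hℓ p A z = 0 → (z.re : ℂ) = z := fun z hz =>
    Complex.ext (by simp) (by simp [im_eq_zero_of_secFun_eq_zero hℓ p hp hA hz])
  have hmne := secFun_eq_zero_iff hℓ p hm
  have hinf := infinite_zeros hℓ p hd hm
  -- Each zero is repeated according to its order, so the enumeration carries multiplicities.
  let X := Σ z : {z // secFun hℓ p A z = 0}, Fin (m z)
  have : Infinite {z // secFun hℓ p A z = 0} := hinf.to_subtype
  have : Infinite X := Infinite.of_injective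
    (fun z : {z // secFun hℓ p A z = 0} =>
      (⟨z, ⟨0, Nat.pos_of_ne_zero ((hmne z).1 z.2)⟩⟩ : X))
    fun z w h => congrArg Sigma.fst h
  obtain ⟨e, he⟩ := exists_monotone_enumeration (fun x : X => (x.1 : ℂ).re) fun a => by
    have hfin := finite_zeros_inter_closedBall (differentiable_secFun hℓ p A)
      (fun a => by rw [hm]; exact ENat.natCast_ne_top _) (max K a)
    have hfin2 : {z : {z // secFun hℓ p A z = 0} |
        (z : ℂ) ∈ Metric.closedBall (0 : ℂ) (max K a)}.Finite := by
      refine Set.Finite.of_finite_image (f := Subtype.val) (hfin.subset ?_)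
        Subtype.val_injective.injOn
      rintro _ ⟨z, hz, rfl⟩
      exact ⟨hz, z.2⟩
    refine (hfin2.biUnion fun z _ =>
      Set.finite_range (fun t : Fin (m z) => (⟨z, t⟩ : X))).subset ?_
    rintro ⟨z, t⟩ hx
    refine Set.mem_biUnion ?_ ⟨t, rfl⟩
    have hx' : (z : ℂ).re ≤ a := hx
    change (z : ℂ) ∈ Metric.closedBall (0 : ℂ) (max K a)
    rw [mem_closedBall_zero_iff, ← hreal z z.2, Complex.norm_real, Real.norm_eq_abs, abs_le]
    have := hK z z.2
    exact ⟨by linarith [le_max_left K a], hx'.trans (le_max_right K a)⟩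
  refine ⟨fun n => ((e n).1 : ℂ).re, he, fun z => ?_⟩
  have h1 : {n : ℕ | (((e n).1 : ℂ).re : ℂ) = z} = e ⁻¹' {x : X | (x.1 : ℂ) = z} := by
    ext n
    simp only [Set.mem_ofPred_eq, Set.mem_preimage, hreal _ (e n).1.2]
  rw [h1, Set.encard_preimage_of_bijective e.bijective]
  by_cases hz : secFun hℓ p A z = 0
  · have h2 : {x : X | (x.1 : ℂ) = z} = Set.range (fun t : Fin (m z) => (⟨⟨z, hz⟩, t⟩ : X)) := by
      ext ⟨⟨w, hw⟩, t⟩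
      constructor
      · intro h
        have h' : w = z := h
        subst h'
        exact ⟨t, rfl⟩
      · rintro ⟨t', h⟩
        have := congrArg (fun x : X => (x.1 : ℂ)) h
        exact this.symm
    rw [h2, ← Set.image_univ, Function.Injective.encard_image]
    · simp
    · intro a b h
      exact eq_of_heq (Sigma.mk.inj h).2
  · have h2 : {x : X | (x.1 : ℂ) = z} = ∅ := by
      ext x
      simp only [Set.mem_ofPred_eq, Set.mem_empty_iff_false, iff_false]
      rintro rfl
      exact hz x.1.2
    have h3 : m z = 0 := by
      by_contra h
      exact hz ((hmne z).2 h)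
    rw [h2, Set.encard_empty, h3, Nat.cast_zero]

end Graph

end QuantumGraph

end

noncomputable section

namespace QuantumGraph

open scoped BoundedContinuousFunction

/-! ### The trace formula -/

theorem HasWeakDeriv.ofReal {L : ℝ} {f g : ℝ → ℝ} (h : HasWeakDeriv L f g) :
    HasWeakDeriv L (fun x => (f x : ℂ)) fun x => (g x : ℂ) := by
  refine ⟨⟨h.1.1.ofReal, h.1.2.ofReal⟩, fun x hx => ?_⟩
  simp only [intervalIntegral.integral_ofReal]
  rw [h.2 x hx, Complex.ofReal_add]

theorem IsW11.exists_extension {L : ℝ} (hL : 0 ≤ L) {q : ℝ → ℝ} (hq : IsW11 L q) :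
    ∃ (y : ℝ →ᵇ ℂ) (g : ℝ → ℂ), (∀ x ∈ Set.Icc 0 L, y x = q x) ∧
      (∀ x, starRingEnd ℂ (y x) = y x) ∧ HasWeakDeriv L y g := by
  obtain ⟨g, hg⟩ := hq
  obtain ⟨y, hy⟩ := QuantumGraph.exists_extension hL (hg.ofReal.continuousOn hL)
  have hyq : ∀ x ∈ Set.Icc 0 L, y x = q x := fun x hx => by rw [hy, clamp_of_mem hx]
  refine ⟨y, fun x => (g x : ℂ), hyq, fun x => by rw [hy, Complex.conj_ofReal],
    hg.ofReal.1, fun x hx => ?_⟩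
  rw [hyq x hx, hyq 0 ⟨le_rfl, hL⟩]
  exact hg.ofReal.2 x hx

/-- The zeros `n π / ℓᵢ` up to `N`. -/
def zerosBelow {d : ℕ} (ℓ : Fin d → ℝ) (N : ℝ) : Finset (Fin d × ℕ) :=
  (Finset.univ.sigma fun i => Finset.range (⌊N * ℓ i / Real.pi⌋₊ + 1)).map
    (Equiv.sigmaEquivProd (Fin d) ℕ).toEmbedding

theorem mem_zerosBelow {d : ℕ} (ℓ : Fin d → ℝ) (N : ℝ) (x : Fin d × ℕ) :
    x ∈ zerosBelow ℓ N ↔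
      x.1 ∈ Finset.univ ∧ x.2 ∈ Finset.range (⌊N * ℓ x.1 / Real.pi⌋₊ + 1) := by
  rw [zerosBelow, Finset.mem_map_equiv, Finset.mem_sigma]
  rfl

theorem sum_zerosBelow {d : ℕ} (ℓ : Fin d → ℝ) (N : ℝ) {M : Type*} [AddCommMonoid M]
    (f : Fin d → ℕ → M) :
    ∑ x ∈ zerosBelow ℓ N, f x.1 x.2 =
      ∑ i, ∑ n ∈ Finset.range (⌊N * ℓ i / Real.pi⌋₊ + 1), f i n :=
  Finset.sum_finset_product (zerosBelow ℓ N) Finset.univ _ (mem_zerosBelow ℓ N)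
    (f := fun x => f x.1 x.2)

theorem card_zerosBelow {d : ℕ} (ℓ : Fin d → ℝ) (N : ℝ) :
    (zerosBelow ℓ N).card = zeroCount ℓ N := by
  rw [Finset.card_eq_sum_ones, sum_zerosBelow ℓ N fun _ _ => 1]
  simp [zeroCount]

theorem mem_zerosBelow_iff {d : ℕ} {ℓ : Fin d → ℝ} (hℓ : ∀ i, 0 < ℓ i) {ε N : ℝ} (hε : 0 < ε)
    (hN : 0 < N) (hadm : N ∈ admissibleCutoffs ℓ ε) (x : Fin d × ℕ) :
    x ∈ zerosBelow ℓ N ↔ sineZero ℓ x < N := by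
  have hi := hℓ x.1
  have hpi := Real.pi_pos
  rw [mem_zerosBelow, and_iff_right (Finset.mem_univ _), Finset.mem_range, Nat.lt_succ_iff,
    Nat.le_floor_iff (by positivity), le_div_iff₀ hpi, ← div_le_iff₀ hi]
  refine ⟨fun h => lt_of_le_of_ne h fun h' => ?_, fun h => h.le⟩
  have h1 := hadm x.1 x.2
  have h2 : sineZero ℓ (x.1, x.2) = N := h'
  rw [h2, sub_self, abs_zero] at h1
  exact absurd (div_pos hε hi) h1.not_gt

section Graph

variable {d : ℕ} {ℓ : Fin d → ℝ} (hℓ : ∀ i, 0 < ℓ i) (p : Fin d → ℝ →ᵇ ℂ)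

/-- Positions of the sine zeros below `N` and indices of the eigenvalues in the disc are both
initial segments, of equal length by the counting lemma. Hence the order chosen among coinciding
zeros does not matter. -/
theorem eventually_sum_eigenvalues {ε : ℝ} (hε : 0 < ε)
    (hp : ∀ i x, starRingEnd ℂ (p i x) = p i x)
    {A : Matrix (Ends d) (Ends d) ℂ} (hA : A.IsHermitian) {m : ℂ → ℕ}
    (hm : ∀ a, analyticOrderAt (secFun hℓ p A) a = m a) {lam : ℕ → ℝ} (hlam : Monotone lam)
    (hfib : ∀ z : ℂ, {n : ℕ | (lam n : ℂ) = z}.encard = m z) {σ : Fin d × ℕ ≃ ℕ}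
    (hσ : IsZeroNumbering ℓ σ) :
    ∀ᶠ N in atTop ⊓ 𝓟 (admissibleCutoffs ℓ ε), ∀ Z : Finset ℂ,
      (∀ z, z ∈ Z ↔ z ∈ Metric.ball 0 (N ^ 2) ∧ secFun hℓ p A z = 0) →
      ∑ x ∈ zerosBelow ℓ N, (lam (σ x) : ℂ) = ∑ a ∈ Z, m a * a := by
  obtain ⟨K, hK⟩ := exists_le_re_of_secFun_eq_zero hℓ p hp hA
  have hzero : ∀ n, secFun hℓ p A (lam n) = 0 := by
    intro n
    rw [secFun_eq_zero_iff hℓ p hm]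
    intro h
    have h1 := hfib (lam n)
    rw [h, Nat.cast_zero, Set.encard_eq_zero] at h1
    exact Set.eq_empty_iff_forall_notMem.1 h1 n rfl
  have hlarge : ∀ᶠ N : ℝ in atTop ⊓ 𝓟 (admissibleCutoffs ℓ ε), K < N ^ 2 ∧ 0 < N :=
    (((tendsto_pow_atTop two_ne_zero).eventually_gt_atTop K).and
      (eventually_gt_atTop 0)).filter_mono inf_le_left
  have hadm : ∀ᶠ N : ℝ in atTop ⊓ 𝓟 (admissibleCutoffs ℓ ε), N ∈ admissibleCutoffs ℓ ε :=
    Eventually.filter_mono inf_le_right (mem_principal_self _)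
  filter_upwards [eventually_sum_order_eq_zeroCount hℓ p A hε hm, hlarge, hadm]
    with N hcount hN hNadm Z hZ
  rw [sum_comp_numbering hσ (zerosBelow ℓ N) (mem_zerosBelow_iff hℓ hε hN.2 hNadm)
    fun n => (lam n : ℂ), card_zerosBelow, ← hcount Z hZ]
  -- The eigenvalues in the disc form a lower set because `N² > K` excludes eigenvalues at or below
  -- `-N²`.
  refine sum_range_eq_sum_fibers hfib Z fun n hn n' hn' => ?_
  rw [hZ, mem_ball_zero_iff, Complex.norm_real, Real.norm_eq_abs] at hn ⊢
  refine ⟨abs_lt.2 ⟨?_, (hlam hn').trans_lt (abs_lt.1 hn.1).2⟩, hzero n'⟩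
  have := hK _ (hzero n')
  rw [Complex.ofReal_re] at this
  linarith

theorem eventually_sum_traceTerm_eq {ε : ℝ} (hε : 0 < ε)
    (hp : ∀ i x, starRingEnd ℂ (p i x) = p i x)
    {A : Matrix (Ends d) (Ends d) ℂ} (hA : A.IsHermitian) {q : Fin d → ℝ → ℝ}
    (hpq : ∀ i, ∀ x ∈ Set.Icc 0 (ℓ i), p i x = q i x) {m m₀ : ℂ → ℕ}
    (hm : ∀ a, analyticOrderAt (secFun hℓ p A) a = m a)
    (hm₀ : ∀ a, analyticOrderAt (secFun hℓ 0 A) a = m₀ a) {lam lam₀ : ℕ → ℝ}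
    (hlam : Monotone lam) (hlam₀ : Monotone lam₀)
    (hfib : ∀ z : ℂ, {n : ℕ | (lam n : ℂ) = z}.encard = m z)
    (hfib₀ : ∀ z : ℂ, {n : ℕ | (lam₀ n : ℂ) = z}.encard = m₀ z) {σ σ₀ : Fin d × ℕ ≃ ℕ}
    (hσ : IsZeroNumbering ℓ σ) (hσ₀ : IsZeroNumbering ℓ σ₀) :
    ∀ᶠ N in atTop ⊓ 𝓟 (admissibleCutoffs ℓ ε),
      ((∑ i, ∑ n ∈ Finset.range (⌊N * ℓ i / Real.pi⌋₊ + 1),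
        traceTerm ℓ q lam lam₀ σ σ₀ i n : ℝ) : ℂ) =
      -circleLog hℓ p A N / (2 * Real.pi) - ∑ i, (∫ t in (0 : ℝ)..ℓ i, p i t) / (2 * ℓ i) := by
  have hQ : ∀ i, (∫ t in (0 : ℝ)..ℓ i, p i t) = ((∫ t in (0 : ℝ)..ℓ i, q i t : ℝ) : ℂ) := by
    intro i
    rw [← intervalIntegral.integral_ofReal]
    refine intervalIntegral.integral_congr fun t ht => ?_
    rw [Set.uIcc_of_le (hℓ i).le] at ht
    exact hpq i t ht
  filter_upwards [eventually_sphere_free hℓ p A hε, eventually_circleLog_eq hℓ p A hε,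
    eventually_sum_eigenvalues hℓ p hε hp hA hm hlam hfib hσ,
    eventually_sum_eigenvalues hℓ 0 hε (by simp) hA hm₀ hlam₀ hfib₀ hσ₀]
    with N ⟨hN, hsph⟩ ⟨_, hcirc⟩ h1 h2
  obtain ⟨Z, hZ⟩ := exists_zeros_finset hℓ p hm (N ^ 2)
  obtain ⟨Z₀, hZ₀⟩ := exists_zeros_finset hℓ 0 hm₀ (N ^ 2)
  -- The weight `φ z = z` turns the zero count into the sum of the eigenvalues.
  have h3 := sum_zeros_sub_sum_zeros (differentiable_secFun hℓ p A) (differentiable_secFun hℓ 0 A)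
    hm hm₀ (by positivity : 0 < N ^ 2) (fun z hz => (hsph z hz).2.2.2.2) Z Z₀ hZ hZ₀
    (φ := fun z => z) differentiable_id
  simp only [deriv_id'', one_mul] at h3
  rw [← h1 Z hZ, ← h2 Z₀ hZ₀] at h3
  have hsum : ((∑ i, ∑ n ∈ Finset.range (⌊N * ℓ i / Real.pi⌋₊ + 1),
      traceTerm ℓ q lam lam₀ σ σ₀ i n : ℝ) : ℂ) =
      ∑ x ∈ zerosBelow ℓ N, (lam (σ x) : ℂ) - ∑ x ∈ zerosBelow ℓ N, (lam₀ (σ₀ x) : ℂ) -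
        ∑ i, (∫ t in (0 : ℝ)..ℓ i, p i t) / ℓ i * (⌊N * ℓ i / Real.pi⌋₊ + 1 : ℕ) := by
    rw [sum_zerosBelow ℓ N fun i n => (lam (σ (i, n)) : ℂ),
      sum_zerosBelow ℓ N fun i n => (lam₀ (σ₀ (i, n)) : ℂ), ← Finset.sum_sub_distrib,
      ← Finset.sum_sub_distrib, Complex.ofReal_sum]
    refine Finset.sum_congr rfl fun i _ => ?_
    simp only [traceTerm, Finset.sum_sub_distrib, Finset.sum_const, Finset.card_range, hQ]
    push_cast
    simp only [nsmul_eq_mul]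
    push_cast
    ring
  -- The zero counts cancel the mean values subtracted in `traceTerm`; the halves remain and give
  -- the integral term of the trace formula.
  have hhalf : ∑ i, (∫ t in (0 : ℝ)..ℓ i, p i t) / ℓ i *
      (2 * Real.pi * Complex.I * ((⌊N * ℓ i / Real.pi⌋₊ + 1 : ℕ) - 1 / 2)) =
      2 * Real.pi * Complex.I *
        (∑ i, (∫ t in (0 : ℝ)..ℓ i, p i t) / ℓ i * (⌊N * ℓ i / Real.pi⌋₊ + 1 : ℕ) -
          ∑ i, (∫ t in (0 : ℝ)..ℓ i, p i t) / (2 * ℓ i)) := by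
    rw [← Finset.sum_sub_distrib, Finset.mul_sum]
    refine Finset.sum_congr rfl fun i _ => ?_
    have hi : (ℓ i : ℂ) ≠ 0 := by exact_mod_cast (hℓ i).ne'
    field_simp
  rw [hhalf] at hcirc
  have hpi : (Real.pi : ℂ) ≠ 0 := by exact_mod_cast Real.pi_ne_zero
  have hI := Complex.I_ne_zero
  rw [hsum]
  refine mul_left_cancel₀ (mul_ne_zero (mul_ne_zero two_ne_zero hpi) hI) ?_
  have h4 : 2 * (Real.pi : ℂ) * Complex.I * (-circleLog hℓ p A N / (2 * Real.pi)) =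
      -(Complex.I * circleLog hℓ p A N) := by field_simp
  rw [mul_sub _ (-circleLog hℓ p A N / (2 * Real.pi)), h4, mul_sub, h3, hcirc]
  ring

theorem tendsto_sum_traceTerm {ε : ℝ} (hε : 0 < ε)
    (hp : ∀ i x, starRingEnd ℂ (p i x) = p i x)
    {A : Matrix (Ends d) (Ends d) ℂ} (hA : A.IsHermitian) {q : Fin d → ℝ → ℝ}
    (hpq : ∀ i, ∀ x ∈ Set.Icc 0 (ℓ i), p i x = q i x)
    {g : Fin d → ℝ → ℂ} (hg : ∀ i, HasWeakDeriv (ℓ i) (p i) (g i)) {m m₀ : ℂ → ℕ}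
    (hm : ∀ a, analyticOrderAt (secFun hℓ p A) a = m a)
    (hm₀ : ∀ a, analyticOrderAt (secFun hℓ 0 A) a = m₀ a) {lam lam₀ : ℕ → ℝ}
    (hlam : Monotone lam) (hlam₀ : Monotone lam₀)
    (hfib : ∀ z : ℂ, {n : ℕ | (lam n : ℂ) = z}.encard = m z)
    (hfib₀ : ∀ z : ℂ, {n : ℕ | (lam₀ n : ℂ) = z}.encard = m₀ z) {σ σ₀ : Fin d × ℕ ≃ ℕ}
    (hσ : IsZeroNumbering ℓ σ) (hσ₀ : IsZeroNumbering ℓ σ₀) :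
    Tendsto (fun N : ℝ => ∑ i, ∑ n ∈ Finset.range (⌊N * ℓ i / Real.pi⌋₊ + 1),
      traceTerm ℓ q lam lam₀ σ σ₀ i n) (atTop ⊓ 𝓟 (admissibleCutoffs ℓ ε))
      (𝓝 (traceValue ℓ q)) := by
  have h1 := ((tendsto_circleLog hℓ p A hε hg).neg.div_const (2 * Real.pi : ℂ)).sub_const
    (∑ i, (∫ t in (0 : ℝ)..ℓ i, p i t) / (2 * ℓ i))
  have hpi : (Real.pi : ℂ) ≠ 0 := by exact_mod_cast Real.pi_ne_zero
  have h2 : -(2 * Real.pi * ∑ i, -(p i (ℓ i) + p i 0) / 4) / (2 * Real.pi : ℂ) -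
      ∑ i, (∫ t in (0 : ℝ)..ℓ i, p i t) / (2 * ℓ i) = (traceValue ℓ q : ℂ) := by
    rw [neg_div, mul_div_cancel_left₀ _ (mul_ne_zero two_ne_zero hpi), ← Finset.sum_neg_distrib,
      ← Finset.sum_sub_distrib, traceValue, Complex.ofReal_sum]
    refine Finset.sum_congr rfl fun i _ => ?_
    have hQ : (∫ t in (0 : ℝ)..ℓ i, p i t) = ((∫ t in (0 : ℝ)..ℓ i, q i t : ℝ) : ℂ) := by
      rw [← intervalIntegral.integral_ofReal]
      refine intervalIntegral.integral_congr fun t ht => ?_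
      rw [Set.uIcc_of_le (hℓ i).le] at ht
      exact hpq i t ht
    rw [hQ, hpq i (ℓ i) ⟨(hℓ i).le, le_rfl⟩, hpq i 0 ⟨le_rfl, (hℓ i).le⟩]
    push_cast
    ring
  rw [h2] at h1
  have h3 := (Complex.continuous_re.tendsto _).comp (h1.congr' ((eventually_sum_traceTerm_eq hℓ p
    hε hp hA hpq hm hm₀ hlam hlam₀ hfib hfib₀ hσ hσ₀).mono fun N hN => hN.symm))
  rw [Complex.ofReal_re] at h3
  exact h3.congr fun N => Complex.ofReal_re _

end Graph

theorem tendsto_sum_range_floor {d : ℕ} {ℓ : Fin d → ℝ} (hℓ : ∀ i, 0 < ℓ i)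
    {t : Fin d → ℕ → ℝ} {S : Fin d → ℝ}
    (hS : ∀ i, Tendsto (fun M : ℕ => ∑ n ∈ Finset.range M, t i n) atTop (𝓝 (S i))) :
    Tendsto (fun N : ℝ => ∑ i, ∑ n ∈ Finset.range (⌊N * ℓ i / Real.pi⌋₊ + 1), t i n) atTop
      (𝓝 (∑ i, S i)) := by
  refine tendsto_finsetSum _ fun i _ => ?_
  have h1 : Tendsto (fun N : ℝ => ⌊N * ℓ i / Real.pi⌋₊ + 1) atTop atTop :=
    tendsto_atTop_mono (fun N => Nat.le_succ _) (tendsto_nat_floor_atTop.comp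
      ((tendsto_id.atTop_mul_const (hℓ i)).atTop_div_const Real.pi_pos))
  exact (hS i).comp h1

end QuantumGraph

end

theorem theoremA {d : ℕ} (hd : 0 < d) (ℓ : Fin d → ℝ) (hℓ : ∀ i, 0 < ℓ i)
    (U : Matrix (QuantumGraph.Ends d) (QuantumGraph.Ends d) ℂ)
    (hU : U ∈ Matrix.unitaryGroup (QuantumGraph.Ends d) ℂ)
    (hU' : (-1 : ℂ) ∉ spectrum ℂ U)
    (q : Fin d → ℝ → ℝ) (hq : ∀ i, QuantumGraph.IsW11 (ℓ i) (q i)) :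
    -- the eigenvalue sequences, the pairing and arbitrarily large cut-offs exist
    (∃ lam : ℕ → ℝ, QuantumGraph.IsEigenvalueSequence ℓ U q lam) ∧
    (∃ lam₀ : ℕ → ℝ, QuantumGraph.IsEigenvalueSequence ℓ U 0 lam₀) ∧
    (∃ σ : Fin d × ℕ ≃ ℕ, QuantumGraph.IsZeroNumbering ℓ σ) ∧
    (∃ ε > 0, ∃ᶠ N in atTop, N ∈ QuantumGraph.admissibleCutoffs ℓ ε) ∧
    ∀ (lam lam₀ : ℕ → ℝ) (σ σ₀ : Fin d × ℕ ≃ ℕ),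
      QuantumGraph.IsEigenvalueSequence ℓ U q lam →
      QuantumGraph.IsEigenvalueSequence ℓ U 0 lam₀ →
      QuantumGraph.IsZeroNumbering ℓ σ → QuantumGraph.IsZeroNumbering ℓ σ₀ →
      -- the trace formula, summed over the zeros below an admissible cut-off `N → ∞`
      (∀ ε > 0, Tendsto
        (fun N : ℝ => ∑ i, ∑ n ∈ Finset.range (⌊N * ℓ i / Real.pi⌋₊ + 1),
          QuantumGraph.traceTerm ℓ q lam lam₀ σ σ₀ i n)
        (atTop ⊓ 𝓟 (QuantumGraph.admissibleCutoffs ℓ ε))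
        (𝓝 (QuantumGraph.traceValue ℓ q))) ∧
      -- the trace formula as an iterated sum, whenever the inner series converge
      (∀ S : Fin d → ℝ,
        (∀ i, Tendsto (fun M : ℕ => ∑ n ∈ Finset.range M,
          QuantumGraph.traceTerm ℓ q lam lam₀ σ σ₀ i n) atTop (𝓝 (S i))) →
        ∑ i, S i = QuantumGraph.traceValue ℓ q) := by
  choose p g hpq hp hg using fun i => (hq i).exists_extension (hℓ i).le
  have hA := QuantumGraph.isHermitian_couplingMatrix hU hU'
  have hp₀ : ∀ (i : Fin d) (x : ℝ), starRingEnd ℂ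
      ((0 : Fin d → BoundedContinuousFunction ℝ ℂ) i x) =
        (0 : Fin d → BoundedContinuousFunction ℝ ℂ) i x := by simp
  have hm := QuantumGraph.analyticOrderAt_secFun hℓ p hp hA
  have hm₀ := QuantumGraph.analyticOrderAt_secFun hℓ 0 hp₀ hA
  have hrank := QuantumGraph.toENat_rank_eigenspace hℓ p hU hU' hpq hp
  have hrank₀ := QuantumGraph.toENat_rank_eigenspace hℓ 0 hU hU' (q := 0) (by simp) hp₀
  obtain ⟨ε₀, hε₀, hfreq⟩ := QuantumGraph.exists_frequently_admissibleCutoffs hℓ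
  refine ⟨?_, ?_, QuantumGraph.exists_isZeroNumbering hd hℓ, ⟨ε₀, hε₀, hfreq⟩, ?_⟩
  · obtain ⟨lam, h1, h2⟩ := QuantumGraph.exists_monotone_zeros hℓ p hd hp hA hm
    exact ⟨lam, h1, fun z => by rw [h2, hrank, hm]⟩
  · obtain ⟨lam, h1, h2⟩ := QuantumGraph.exists_monotone_zeros hℓ 0 hd hp₀ hA hm₀
    exact ⟨lam, h1, fun z => by rw [h2, hrank₀, hm₀]⟩
  · intro lam lam₀ σ σ₀ hlam hlam₀ hσ hσ₀
    have hlim := fun (ε : ℝ) (hε : 0 < ε) => QuantumGraph.tendsto_sum_traceTerm hℓ p hε hp hA hpq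
      hg hm hm₀ hlam.1 hlam₀.1 (fun z => by rw [hlam.2, hrank, hm])
      (fun z => by rw [hlam₀.2, hrank₀, hm₀]) hσ hσ₀
    refine ⟨hlim, fun S hS => ?_⟩
    -- Unboundedness of the admissible cut-offs makes this filter nontrivial, as uniqueness of
    -- limits requires.
    have hne : (atTop ⊓ 𝓟 (QuantumGraph.admissibleCutoffs ℓ ε₀)).NeBot :=
      Filter.frequently_mem_iff_neBot.1 hfreq
    exact tendsto_nhds_unique
      ((QuantumGraph.tendsto_sum_range_floor hℓ hS).mono_left inf_le_left) (hlim ε₀ hε₀)
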